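/- Let $\mathbb K\in\{\mathbb R,\mathbb C\}$ and let $\mathcal H$ be a separable Hilbert space over $\mathbb K$, with inner product linear in its first argument. The spaces $\mathbb K^p$ carry the Euclidean norm and matrices the induced norm. **Plant.** Let $(\mathcal A,\mathcal B)$ be an abstract boundary control system: $\mathcal A:D(\mathcal A)\subset\mathcal H\to\mathcal H$ and $\mathcal B:D(\mathcal B)\subset\mathcal H\to\mathbb K^m$ are linear, $D(\mathcal A)\subset D(\mathcal B)$, the restriction $\mathcal A_0$ of $\mathcal A$ to $D(\mathcal A_0)=D(\mathcal A)\cap\ker\mathcal B$ generates a $C_0$-semigroup, and there is a bounded lifting operator $B:\mathbb K^m\to\mathcal H$ with range in $D(\mathcal A)$, $\mathcal AB$ bounded and $\mathcal BB=I$; fix such a $B$. Assume: (A1) $\mathcal A_0$ is a Riesz spectral operator: it is closed, with simple eigenvalues $\lambda_n$ and eigenvectors $\phi_n$, $n\ge1$; the $\phi_n$ span a dense subspace and, for some $m_R,M_R>0$, $m_R\sum_{n\le N}|a_n|^2\le\|\sum_{n\le N}a_n\phi_n\|^2\le M_R\sum_{n\le N}|a_n|^2$ for all $N$ and all $a_n\in\mathbb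 K$; and no segment $[a,b]$ with $a\neq b$ is contained in $\overline{\{\lambda_n\}}$. Let $(\psi_n)$ be the sequence biorthogonal to $(\phi_n)$. (A2) There are $N_0\ge1$ and $\alpha>0$ with $\operatorname{Re}\lambda_n\le-\alpha$ for all $n\ge N_0+1$. (A3) With $A_{N_0}=\mathrm{diag}(\lambda_1,\dots,\lambda_{N_0})$ and $B_{N_0}=(b_{n,k})_{n\le N_0,k\le m}$, $b_{n,k}=-\lambda_n\langle Be_k,\psi_n\rangle+\langle\mathcal ABe_k,\psi_n\rangle$, the pair $(A_{N_0},B_{N_0})$ satisfies the Kalman rank condition. **Control.** Let $D,t_0>0$ and let $\varphi\in C^2([-D,\infty);\mathbb R)$ satisfy $0\le\varphi\le1$, $\varphi=0$ on $[-D,0]$ and $\varphi=1$ on $[t_0,\infty)$. Let $K\in\mathbb K^{m\times N_0}$ be such that $A_{\rm cl}=A_{N_0}+e^{-DA_{N_0}}B_{N_0}K$ is Hurwitz, and let $P$ be the Hermitian positive definite matrix with $A_{\rm cl}^*P+PA_{\rm cl}=-I$; $\lambda_m(P)$ and $\lambda_M(P)$ denote its smallest and largest eigenvalues. Let $K_i$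 be the rows of $K$ and put $$C_1=2\max\bigl(1,De^{2D\|A_{N_0}\|}\|B_{N_0}K\|^2\bigr),\qquad C_5=\frac{2m}{\alpha m_R}\sum_{i=1}^m\bigl(\|\mathcal ABe_i\|^2\|K_i\|^2+\|Be_i\|^2\|K_iA_{\rm cl}\|^2\bigr).$$ Let $\beta\in(0,1)$, $\gamma_1>C_1/\lambda_m(P)$, $\gamma_2>\max\bigl(\|BK\|^2/(m_R\lambda_m(P)),\,C_5/(1-\beta)\bigr)$, and put $$C_4=\sqrt{2M_R}+\frac{\|BK\|}{\sqrt{\gamma_2\lambda_m(P)-\|BK\|^2/m_R}},\qquad \kappa_0=\frac12\min\Bigl(\frac{1-\beta}{\lambda_M(P)},\frac{1-\beta-C_5/\gamma_2}{\lambda_M(P)},\frac\alpha2\Bigr),$$ $$C_6=\frac1{m_R}\Bigl(\frac{2(m_R+\|BK\|^2)}{\alpha m_R}+\frac{(\gamma_1(1+D)+\gamma_2)\|P\|^2}{\beta}\Bigr).$$ **Coupling (A4).** Let $f_1:\mathbb K^n\times\mathcal H\times\mathbb K^{m_v}\to\mathbb K^n$ and $f_2:\mathbb K^n\times\mathcal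 H\times\mathbb K^{m_v}\to\mathcal H$ be of class $C^1$ and globally Lipschitz in $(x,X)$, uniformly in $v$ over compact sets. Assume that there are constants $D_1,D_2,D_3\ge0$ with $\|f_2(x,X,v)\|\le D_1\|x\|+D_2\|X\|+D_3\|v\|$ for all $x,X,v$, and constants $\tilde\kappa_0>0$, $\tilde C_0,\tilde C_1,\tilde C_2\ge0$ such that, for all continuous $X:\mathbb R_+\to\mathcal H$ and $v:\mathbb R_+\to\mathbb K^{m_v}$, the solutions of $\dot x=f_1(x,X,v)$, $x(0)=x_0$, satisfy for all $t\ge0$ $$\|x(t)\|^2\le\tilde C_0^2e^{-2\tilde\kappa_0t}\|x_0\|^2+\sup_{\tau\in[0,t]}\bigl\{\tilde C_1^2\|X(\tau)\|^2+\tilde C_2^2\|v(\tau)\|^2\bigr\}.$$ **Theorem.** If $(D_1\tilde C_1+D_2)\,C_4\sqrt{C_6/(2\kappa_0)}<1$, then there exist constants $\delta\in(0,\kappa_0)$ and $G_i,H_i\ge0$, $0\le i\le3$, such that for all $(x_0,X_0)\in\mathbb K^n\times D(\mathcal A_0)$ and all $v\in C^1(\mathbb R_+;\mathbb K^{m_v})$,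 the classical solution $x\in C^1(\mathbb R_+;\mathbb K^n)$, $X\in C^0(\mathbb R_+;D(\mathcal A))\cap C^1(\mathbb R_+;\mathcal H)$, with control $u$, of $$\dot x=f_1(x,X,v),\qquad \dot X=\mathcal AX+f_2(x,X,v),\qquad \mathcal BX(t)=u(t-D),\qquad x(0)=x_0,\quad X(0)=X_0,$$ $$u|_{[-D,0]}=0,\qquad u(t)=\varphi(t)KY(t)+\varphi(t)K\int_{\max(t-D,0)}^te^{(t-s-D)A_{N_0}}B_{N_0}u(s)\,ds\quad(t\ge0),$$ where $Y(t)=(\langle X(t),\psi_1\rangle,\dots,\langle X(t),\psi_{N_0}\rangle)^\top$, satisfies for all $t\ge D+t_0$ $$\|x(t)\|+\|X(t)\|\le G_0e^{-\delta t}(\|x_0\|+\|X_0\|)+G_1e^{-\delta t}\sup_{[0,D+t_0]}\|x\|+G_2e^{-\delta t}\sup_{[0,D+t_0]}\|X\|+G_3\sup_{\tau\in[0,t]}e^{-\delta(t-\tau)}\|v(\tau)\|,$$ $$\|u(t)\|\le H_0e^{-\delta t}(\|x_0\|+\|X_0\|)+H_1e^{-\delta t}\sup_{[0,D+t_0]}\|x\|+H_2e^{-\delta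 t}\sup_{[0,D+t_0]}\|X\|+H_3\sup_{\tau\in[0,t]}e^{-\delta(t-\tau)}\|v(\tau)\|.$$ -/

import Mathlib

open Set Filter Topology MeasureTheory
open scoped Matrix ComplexOrder

noncomputable section

/-- The space `𝕜^p` with the Euclidean norm. -/
abbrev Euc (𝕜 : Type*) [RCLike 𝕜] (p : ℕ) : Type _ := EuclideanSpace 𝕜 (Fin p)

/-- The operator `𝕜^q → 𝕜^p` given by a `p × q` matrix. -/
def matCLM {𝕜 : Type*} [RCLike 𝕜] {p q : ℕ} (M : Matrix (Fin p) (Fin q) 𝕜) :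
    Euc 𝕜 q →L[𝕜] Euc 𝕜 p :=
  LinearMap.toContinuousLinearMap (Matrix.toEuclideanLin M)

/-- The matrix norm induced by the Euclidean norms. -/
def matNorm {𝕜 : Type*} [RCLike 𝕜] {p q : ℕ} (M : Matrix (Fin p) (Fin q) 𝕜) : ℝ :=
  ‖matCLM M‖

/-- The (induced, equivalently Euclidean) norm of the `i`-th row of a matrix. -/
def rowNorm {𝕜 : Type*} [RCLike 𝕜] {p q : ℕ} (M : Matrix (Fin p) (Fin q) 𝕜) (i : Fin p) : ℝ :=
  ‖(WithLp.toLp 2 (M i) : Euc 𝕜 q)‖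

/-- All complex eigenvalues of the (real or complex) matrix `M` have negative real part. -/
def IsHurwitz {𝕜 : Type*} [RCLike 𝕜] {p : ℕ} (M : Matrix (Fin p) (Fin p) 𝕜) : Prop :=
  ∀ μ ∈ spectrum ℂ (M.map fun z : 𝕜 => (⟨RCLike.re z, RCLike.im z⟩ : ℂ)), μ.re < 0

/-- The Kalman condition: the matrix `(B, M B, …, M ^ (p - 1) B)` has rank `p`. -/
def KalmanCondition {𝕜 : Type*} [RCLike 𝕜] {p q : ℕ} (M : Matrix (Fin p) (Fin p) 𝕜)
    (B : Matrix (Fin p) (Fin q) 𝕜) : Prop :=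
  (Matrix.of fun (i : Fin p) (j : Fin p × Fin q) => (M ^ (j.1 : ℕ) * B) i j.2).rank = p

/-- The smallest eigenvalue of a Hermitian matrix. -/
def lamMin {𝕜 : Type*} [RCLike 𝕜] {p : ℕ} (P : Matrix (Fin p) (Fin p) 𝕜) : ℝ :=
  sInf (spectrum ℝ P)

/-- The largest eigenvalue of a Hermitian matrix. -/
def lamMax {𝕜 : Type*} [RCLike 𝕜] {p : ℕ} (P : Matrix (Fin p) (Fin p) 𝕜) : ℝ :=
  sSup (spectrum ℝ P)

/-- The supremum of `g` over the interval `[a, b]`. -/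
def supOn (g : ℝ → ℝ) (a b : ℝ) : ℝ := sSup (g '' Icc a b)

section Systems

variable {𝕜 : Type*} [RCLike 𝕜] {H : Type*} [NormedAddCommGroup H] [InnerProductSpace 𝕜 H]

/-- `S` (restricted to `[0, ∞)`) is a strongly continuous semigroup of bounded operators. -/
structure IsC0Semigroup (S : ℝ → H →L[𝕜] H) : Prop where
  zero : S 0 = ContinuousLinearMap.id 𝕜 H
  add : ∀ s t : ℝ, 0 ≤ s → 0 ≤ t → S (s + t) = (S s).comp (S t)
  tendsto : ∀ w : H, Tendsto (fun t => S t w) (𝓝[>] 0) (𝓝 w)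

/-- The unbounded operator `G` is the infinitesimal generator of `S`: `w ∈ D(G)` and `G w = y`
iff `(S t w - w) / t → y` as `t → 0+`. -/
def IsGenerator [NormedSpace ℝ H] (S : ℝ → H →L[𝕜] H) (G : H →ₗ.[𝕜] H) : Prop :=
  ∀ w y : H, (w, y) ∈ G.graph ↔ Tendsto (fun t : ℝ => t⁻¹ • (S t w - w)) (𝓝[>] 0) (𝓝 y)

/-- The restriction of `A` to `D(A) ∩ ker Bd`. -/
def disturbanceFree {m : ℕ} (A : H →ₗ.[𝕜] H) (Bd : H →ₗ.[𝕜] Euc 𝕜 m) : H →ₗ.[𝕜] H :=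
  A.domRestrict ((LinearMap.ker Bd.toFun).map Bd.domain.subtype)

variable (𝕜 H) in
/-- An abstract boundary control system `(A, Bd)` with `m` scalar inputs, together with a lifting
operator `B`; `AB` is the bounded operator `A ∘ B`. -/
structure BoundaryControlSystem [NormedSpace ℝ H] (m : ℕ) where
  /-- the operator `𝒜` -/
  A : H →ₗ.[𝕜] H
  /-- the boundary operator `ℬ` -/
  Bd : H →ₗ.[𝕜] Euc 𝕜 m
  domain_le : A.domain ≤ Bd.domain
  generates : ∃ S : ℝ → H →L[𝕜] H, IsC0Semigroup S ∧ IsGenerator S (disturbanceFree A Bd)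
  /-- the lifting operator -/
  B : Euc 𝕜 m →L[𝕜] H
  /-- the composition `𝒜 B` -/
  AB : Euc 𝕜 m →L[𝕜] H
  lift_A : ∀ w, (B w, AB w) ∈ A.graph
  lift_Bd : ∀ w, (B w, w) ∈ Bd.graph

/-- The disturbance free operator `𝒜₀`. -/
def BoundaryControlSystem.A0 [NormedSpace ℝ H] {m : ℕ} (sys : BoundaryControlSystem 𝕜 H m) :
    H →ₗ.[𝕜] H :=
  disturbanceFree sys.A sys.Bd

/-- The operator `G` is Riesz spectral: it is closed, with simple eigenvalues `lam n` and
eigenvectors `phi n` forming a Riesz basis with constants `mR` and `MR`, and the closure of the set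
of the eigenvalues is totally disconnected. `psi` is the sequence biorthogonal to `phi`.
The sequences are indexed by `n = 0, 1, 2, …` (instead of `n = 1, 2, …`). -/
structure RieszSpectral [NormedSpace ℝ H] (G : H →ₗ.[𝕜] H) where
  /-- eigenvalues -/
  lam : ℕ → 𝕜
  /-- eigenvectors -/
  phi : ℕ → H
  /-- biorthogonal sequence -/
  psi : ℕ → H
  /-- lower Riesz constant -/
  mR : ℝ
  /-- upper Riesz constant -/
  MR : ℝ
  closed : G.IsClosed
  eigen : ∀ n, (phi n, lam n • phi n) ∈ G.graph
  simple : ∀ n w, (w, lam n • w) ∈ G.graph → ∃ c : 𝕜, w = c • phi n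
  dense : (Submodule.span 𝕜 (range phi)).topologicalClosure = ⊤
  mR_pos : 0 < mR
  MR_pos : 0 < MR
  lower : ∀ (N : ℕ) (a : ℕ → 𝕜),
    mR * ∑ n ∈ Finset.range N, ‖a n‖ ^ 2 ≤ ‖∑ n ∈ Finset.range N, a n • phi n‖ ^ 2
  upper : ∀ (N : ℕ) (a : ℕ → 𝕜),
    ‖∑ n ∈ Finset.range N, a n • phi n‖ ^ 2 ≤ MR * ∑ n ∈ Finset.range N, ‖a n‖ ^ 2
  disconnected : ∀ a ∈ closure (range lam), ∀ b ∈ closure (range lam), a ≠ b →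
    ¬ segment ℝ a b ⊆ closure (range lam)
  biorthogonal : ∀ k l, inner 𝕜 (psi l) (phi k) = if k = l then 1 else 0

variable [NormedSpace ℝ H] {m : ℕ}

/-- `A_{N₀} = diag(λ_1, …, λ_{N₀})`. -/
def matA {G : H →ₗ.[𝕜] H} (R : RieszSpectral G) (N₀ : ℕ) : Matrix (Fin N₀) (Fin N₀) 𝕜 :=
  Matrix.diagonal fun i => R.lam i

/-- `B_{N₀} = (b_{n,k})` with `b_{n,k} = - λ_n ⟨B e_k, ψ_n⟩ + ⟨𝒜 B e_k, ψ_n⟩`; the paired inner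
product `⟨x, ψ⟩` (linear in `x`) is `inner 𝕜 ψ x`. -/
def matB (sys : BoundaryControlSystem 𝕜 H m) (R : RieszSpectral sys.A0) (N₀ : ℕ) :
    Matrix (Fin N₀) (Fin m) 𝕜 :=
  Matrix.of fun n k =>
    - R.lam n * inner 𝕜 (R.psi n) (sys.B (EuclideanSpace.single k 1))
      + inner 𝕜 (R.psi n) (sys.AB (EuclideanSpace.single k 1))

/-- The closed-loop matrix `A_cl = A_{N₀} + e^{-D A_{N₀}} B_{N₀} K`. -/
def matAcl (sys : BoundaryControlSystem 𝕜 H m) (R : RieszSpectral sys.A0) {N₀ : ℕ} (D : ℝ)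
    (K : Matrix (Fin m) (Fin N₀) 𝕜) : Matrix (Fin N₀) (Fin N₀) 𝕜 :=
  matA R N₀ + NormedSpace.exp ((-D) • matA R N₀) * matB sys R N₀ * K

/-- `C₁ = 2 max(1, D e^{2 D ‖A_{N₀}‖} ‖B_{N₀} K‖²)`. -/
def constC1 (sys : BoundaryControlSystem 𝕜 H m) (R : RieszSpectral sys.A0) {N₀ : ℕ} (D : ℝ)
    (K : Matrix (Fin m) (Fin N₀) 𝕜) : ℝ :=
  2 * max 1 (D * Real.exp (2 * D * matNorm (matA R N₀)) * matNorm (matB sys R N₀ * K) ^ 2)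

/-- The norm `‖B K‖` of the operator `𝕜^{N₀} → H`. -/
def normBK (sys : BoundaryControlSystem 𝕜 H m) {N₀ : ℕ} (K : Matrix (Fin m) (Fin N₀) 𝕜) : ℝ :=
  ‖sys.B.comp (matCLM K)‖

/-- `C₃ = γ₂ λ_m(P) - ‖B K‖² / m_R`. -/
def constC3 (sys : BoundaryControlSystem 𝕜 H m) (R : RieszSpectral sys.A0) {N₀ : ℕ}
    (K : Matrix (Fin m) (Fin N₀) 𝕜) (P : Matrix (Fin N₀) (Fin N₀) 𝕜) (γ₂ : ℝ) : ℝ :=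
  γ₂ * lamMin P - normBK sys K ^ 2 / R.mR

/-- `C₄ = √(2 M_R) + ‖B K‖ / √C₃`. -/
def constC4 (sys : BoundaryControlSystem 𝕜 H m) (R : RieszSpectral sys.A0) {N₀ : ℕ}
    (K : Matrix (Fin m) (Fin N₀) 𝕜) (P : Matrix (Fin N₀) (Fin N₀) 𝕜) (γ₂ : ℝ) : ℝ :=
  √(2 * R.MR) + normBK sys K / √(constC3 sys R K P γ₂)

/-- `C₅ = (2 m / (α m_R)) ∑ᵢ (‖𝒜 B eᵢ‖² ‖Kᵢ‖² + ‖B eᵢ‖² ‖Kᵢ A_cl‖²)`, `Kᵢ` the rows of `K`. -/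
def constC5 (sys : BoundaryControlSystem 𝕜 H m) (R : RieszSpectral sys.A0) {N₀ : ℕ} (α D : ℝ)
    (K : Matrix (Fin m) (Fin N₀) 𝕜) : ℝ :=
  2 * m / (α * R.mR) * ∑ i : Fin m,
    (‖sys.AB (EuclideanSpace.single i 1)‖ ^ 2 * rowNorm K i ^ 2
      + ‖sys.B (EuclideanSpace.single i 1)‖ ^ 2 * rowNorm (K * matAcl sys R D K) i ^ 2)

/-- `C₆ = (1 / m_R) (2 (m_R + ‖B K‖²) / (α m_R) + (γ₁ (1 + D) + γ₂) ‖P‖² / β)`. -/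
def constC6 (sys : BoundaryControlSystem 𝕜 H m) (R : RieszSpectral sys.A0) {N₀ : ℕ} (α D : ℝ)
    (K : Matrix (Fin m) (Fin N₀) 𝕜) (P : Matrix (Fin N₀) (Fin N₀) 𝕜) (β γ₁ γ₂ : ℝ) : ℝ :=
  1 / R.mR * (2 * (R.mR + normBK sys K ^ 2) / (α * R.mR)
    + (γ₁ * (1 + D) + γ₂) * matNorm P ^ 2 / β)

/-- `κ₀ = (1/2) min((1 - β) / λ_M(P), (1 - β - C₅ / γ₂) / λ_M(P), α / 2)`. -/
def constKappa (sys : BoundaryControlSystem 𝕜 H m) (R : RieszSpectral sys.A0) {N₀ : ℕ} (α D : ℝ)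
    (K : Matrix (Fin m) (Fin N₀) 𝕜) (P : Matrix (Fin N₀) (Fin N₀) 𝕜) (β γ₂ : ℝ) : ℝ :=
  1 / 2 * min ((1 - β) / lamMax P)
    (min ((1 - β - constC5 sys R α D K / γ₂) / lamMax P) (α / 2))

/-- `φ ∈ C²([-D, ∞); ℝ)`, `0 ≤ φ ≤ 1`, `φ = 0` on `[-D, 0]` and `φ = 1` on `[t₀, ∞)`. -/
structure IsTransitionSignal (D t₀ : ℝ) (φ : ℝ → ℝ) : Prop where
  contDiff : ContDiffOn ℝ 2 φ (Ici (-D))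
  nonneg : ∀ t, -D ≤ t → 0 ≤ φ t
  le_one : ∀ t, -D ≤ t → φ t ≤ 1
  eq_zero : ∀ t ∈ Icc (-D) 0, φ t = 0
  eq_one : ∀ t, t₀ ≤ t → φ t = 1

variable {n mv : ℕ}

/-- The assumptions on the coupling vector fields `f₁` and `f₂`: Lipschitz continuity in the state,
linear bound on `f₂`, and ISS estimate for the ODE `ẋ = f₁(x, X, v)`. -/
structure CouplingAssumption (f₁ : Euc 𝕜 n × H × Euc 𝕜 mv → Euc 𝕜 n)
    (f₂ : Euc 𝕜 n × H × Euc 𝕜 mv → H) (D₁ D₂ D₃ κt Ct₀ Ct₁ Ct₂ : ℝ) : Prop where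
  lipschitz : ∀ Q : Set (Euc 𝕜 mv), IsCompact Q → ∃ L : ℝ, ∀ v ∈ Q,
    ∀ (x x' : Euc 𝕜 n) (X X' : H),
      ‖f₁ (x, X, v) - f₁ (x', X', v)‖ ≤ L * (‖x - x'‖ + ‖X - X'‖) ∧
      ‖f₂ (x, X, v) - f₂ (x', X', v)‖ ≤ L * (‖x - x'‖ + ‖X - X'‖)
  D₁_nonneg : 0 ≤ D₁
  D₂_nonneg : 0 ≤ D₂
  D₃_nonneg : 0 ≤ D₃
  bound : ∀ (x : Euc 𝕜 n) (X : H) (v : Euc 𝕜 mv),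
    ‖f₂ (x, X, v)‖ ≤ D₁ * ‖x‖ + D₂ * ‖X‖ + D₃ * ‖v‖
  κt_pos : 0 < κt
  Ct₀_nonneg : 0 ≤ Ct₀
  Ct₁_nonneg : 0 ≤ Ct₁
  Ct₂_nonneg : 0 ≤ Ct₂
  iss : ∀ (X : ℝ → H) (v : ℝ → Euc 𝕜 mv) (x : ℝ → Euc 𝕜 n),
    ContinuousOn X (Ici 0) → ContinuousOn v (Ici 0) →
    (∀ t, 0 ≤ t → HasDerivWithinAt x (f₁ (x t, X t, v t)) (Ici 0) t) →
    ∀ t, 0 ≤ t → ‖x t‖ ^ 2 ≤ Ct₀ ^ 2 * Real.exp (-2 * κt * t) * ‖x 0‖ ^ 2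
      + supOn (fun τ => Ct₁ ^ 2 * ‖X τ‖ ^ 2 + Ct₂ ^ 2 * ‖v τ‖ ^ 2) 0 t

/-- The vector `Y = (⟨w, ψ_1⟩, …, ⟨w, ψ_{N₀}⟩)` of the first coefficients of `w`. -/
def modes {G : H →ₗ.[𝕜] H} (R : RieszSpectral G) (N₀ : ℕ) (w : H) : Euc 𝕜 N₀ :=
  WithLp.toLp 2 fun i => inner 𝕜 (R.psi i) w

/-- `(x, X)` is a classical solution, with control `u`, of the closed-loop interconnection
with disturbance `v` and initial condition `(x₀, X₀)`:
`ẋ = f₁(x, X, v)`, `Ẋ = 𝒜 X + f₂(x, X, v)`, `ℬ X(t) = u(t - D)`, `u = 0` on `[-D, 0]` and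
`u(t) = φ(t) K Y(t) + φ(t) K ∫_{max(t-D,0)}^t e^{(t-s-D) A_{N₀}} B_{N₀} u(s) ds` for `t ≥ 0`,
with `x ∈ C¹(ℝ₊; 𝕜ⁿ)` and `X ∈ C⁰(ℝ₊; D(𝒜)) ∩ C¹(ℝ₊; H)`. -/
structure IsClassicalSolution (sys : BoundaryControlSystem 𝕜 H m) (R : RieszSpectral sys.A0)
    {N₀ : ℕ} (D : ℝ) (φ : ℝ → ℝ) (K : Matrix (Fin m) (Fin N₀) 𝕜)
    (f₁ : Euc 𝕜 n × H × Euc 𝕜 mv → Euc 𝕜 n) (f₂ : Euc 𝕜 n × H × Euc 𝕜 mv → H)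
    (x₀ : Euc 𝕜 n) (X₀ : H) (v : ℝ → Euc 𝕜 mv)
    (x : ℝ → Euc 𝕜 n) (X : ℝ → H) (u : ℝ → Euc 𝕜 m) : Prop where
  x_contDiff : ContDiffOn ℝ 1 x (Ici 0)
  X_contDiff : ContDiffOn ℝ 1 X (Ici 0)
  X_mem : ∀ t, 0 ≤ t → X t ∈ sys.A.domain
  AX_continuous : Continuous fun t : Ici (0 : ℝ) => sys.A ⟨X t, X_mem t t.2⟩
  x_init : x 0 = x₀
  X_init : X 0 = X₀
  x_deriv : ∀ t, 0 ≤ t → HasDerivWithinAt x (f₁ (x t, X t, v t)) (Ici 0) t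
  X_deriv : ∀ t (ht : 0 ≤ t),
    HasDerivWithinAt X (sys.A ⟨X t, X_mem t ht⟩ + f₂ (x t, X t, v t)) (Ici 0) t
  boundary : ∀ t (ht : 0 ≤ t), sys.Bd ⟨X t, sys.domain_le (X_mem t ht)⟩ = u (t - D)
  u_locallyIntegrable : LocallyIntegrableOn u (Ici (-D))
  u_zero : ∀ t ∈ Icc (-D) 0, u t = 0
  u_eq : ∀ t, 0 ≤ t → u t = φ t • matCLM K (modes R N₀ (X t))
    + φ t • matCLM K (∫ s in (max (t - D) 0)..t,
        matCLM (NormedSpace.exp ((t - s - D) • matA R N₀) * matB sys R N₀) (u s))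

end Systems

end

/-! ### Eigenfunctionals of a semigroup generator -/

section Semigroup

variable {𝕜 : Type*} [RCLike 𝕜] {H : Type*} [NormedAddCommGroup H] [InnerProductSpace 𝕜 H]

/-! The plant and the ODE each satisfy an input-to-state estimate in the weighted norm `sup
e^{δτ}‖·‖`, and the product of the two gains tends to the left side of the small gain condition as
`δ → 0`. For a suitable small `δ` the loop therefore closes, and removing the weights gives the
exponential decay and the fading memory of `v`.

Plant. The functional `⟨·, ψ_k⟩` is an eigenfunctional of the generator
(`RieszSpectral.inner_psi_of_generator`), so subtracting the lifted boundary value gives a scalar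
ODE for every mode (`inner_psi_apply_of_boundary`). For the first `N₀` modes the Artstein state `Z`,
that is `Y` plus the integral of the stored control, turns the delayed input into an undelayed one
(`IsClassicalSolution.hasDerivAt_predictor`). Once `φ = 1` the feedback is `u = K Z`, and `Z' = A_cl
Z + F_{N₀}` with `F = f₂(x, X, v)` and `F_{N₀}` its first `N₀` modes. The remaining modes are those
of `w = X - B K Z(· - D)`, which satisfies the homogeneous boundary condition for `t ≥ D + t₀`;
their decay rate is at least `α`.

The Lyapunov functional has a `γ₁` part, the form `P` at `Z(t)` plus its integral over the delay
window, which dominates the modes `Y`; a `γ₂` part at `Z(t - D)`, which pays for the coupling into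
the stable modes; and half the sum of squares of those modes. Its dissipation
(`IsTargetSystem.exists_deriv_lyapunov_le`) and its coercivity
(`IsTargetSystem.norm_le_of_lyapunov_le`) give the gain `C₄ √(C₆ / (2 κ₀))` from `F` to `X`, up to
factors tending to 1. Only finitely many modes enter each functional, with bounds uniform in their
number, so no infinite series is differentiated.

ODE. The assumed estimate has no forgetting in its supremum term. Restarting it after a period `T`
long enough to contract the initial state gives the weighted version
(`CouplingAssumption.exp_mul_norm_le`); with `δ = T⁻²` the weight lost over one period tends to 1
(`exists_decay_rate`). On `[0, D + t₀]`, where the feedback is not yet fully active, `Z` is bounded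
by Gronwall through `sup ‖X‖`. -/

theorem IsC0Semigroup.tendsto_nhdsGE {S : ℝ → H →L[𝕜] H} (hS : IsC0Semigroup S) (w : H) :
    Tendsto (fun t => S t w) (𝓝[≥] 0) (𝓝 w) := by
  have h : ContinuousWithinAt (fun t => S t w) (Ioi 0) 0 := by
    have := hS.tendsto w
    simpa [ContinuousWithinAt, hS.zero] using this
  have h' := continuousWithinAt_Ioi_iff_Ici.1 h
  simpa [ContinuousWithinAt, hS.zero] using h'

/-- Otherwise some `t_k → 0+` has `‖S t_k‖ > k`; but the orbits `S t_k w` converge, so the uniform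
boundedness principle applies. -/
theorem IsC0Semigroup.exists_bound [CompleteSpace H] {S : ℝ → H →L[𝕜] H} (hS : IsC0Semigroup S) :
    ∃ ε > 0, ∃ M, ∀ t ∈ Icc (0 : ℝ) ε, ‖S t‖ ≤ M := by
  by_contra! hcon
  have hk : ∀ k : ℕ, ∃ t ∈ Icc (0 : ℝ) (1 / ((k : ℝ) + 1)), (k : ℝ) < ‖S t‖ :=
    fun k => hcon _ (by positivity) k
  choose t ht hbig using hk
  have ht0 : Tendsto t atTop (𝓝[≥] 0) := by
    refine tendsto_nhdsWithin_iff.2 ⟨?_, Eventually.of_forall fun k => (ht k).1⟩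
    exact squeeze_zero (fun k => (ht k).1) (fun k => (ht k).2)
      tendsto_one_div_add_atTop_nhds_zero_nat
  obtain ⟨C, hC⟩ := banach_steinhaus (g := fun k => S (t k)) fun w => by
    obtain ⟨C, hC⟩ := (((hS.tendsto_nhdsGE w).comp ht0).norm).bddAbove_range
    exact ⟨C, fun k => hC ⟨k, rfl⟩⟩
  obtain ⟨k, hk⟩ := exists_nat_gt C
  exact absurd (hC k) (not_le.2 (hk.trans (hbig k)))

/-- For `s ≤ t` the semigroup law gives `S t w - S s w = S s (S (t - s) w - w)`, so two-sided
continuity follows from right continuity at 0 and the norm bound. -/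
theorem IsC0Semigroup.continuousOn_of_bound {S : ℝ → H →L[𝕜] H} (hS : IsC0Semigroup S) {ε M : ℝ}
    (hM : ∀ t ∈ Icc (0 : ℝ) ε, ‖S t‖ ≤ M) (w : H) :
    ContinuousOn (fun t => S t w) (Icc 0 ε) := by
  rcases lt_or_ge ε 0 with hε | hε
  · simp [Icc_eq_empty (not_le.2 hε)]
  have hM0 : 0 ≤ M := (norm_nonneg _).trans (hM 0 ⟨le_rfl, hε⟩)
  have key : ∀ s ∈ Icc (0 : ℝ) ε, ∀ t ∈ Icc (0 : ℝ) ε,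
      ‖S t w - S s w‖ ≤ M * ‖S |t - s| w - w‖ := by
    have aux : ∀ s ∈ Icc (0 : ℝ) ε, ∀ t ∈ Icc (0 : ℝ) ε, s ≤ t →
        ‖S t w - S s w‖ ≤ M * ‖S |t - s| w - w‖ := by
      intro s hs t _ hst
      have h1 : S t w - S s w = S s (S |t - s| w - w) := by
        have := hS.add s (t - s) hs.1 (sub_nonneg.2 hst)
        rw [abs_of_nonneg (sub_nonneg.2 hst), map_sub]
        rw [add_sub_cancel] at this
        rw [this]; rfl
      rw [h1]
      exact ((S s).le_opNorm _).trans (by gcongr; exact hM s hs)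
    intro s hs t ht
    rcases le_total s t with h | h
    · exact aux s hs t ht h
    · rw [norm_sub_rev, abs_sub_comm]; exact aux t ht s hs h
  intro s hs
  rw [ContinuousWithinAt, tendsto_iff_norm_sub_tendsto_zero]
  have h0 : Tendsto (fun t => |t - s|) (𝓝[Icc 0 ε] s) (𝓝[≥] 0) := by
    refine tendsto_nhdsWithin_iff.2 ⟨?_, Eventually.of_forall fun t => mem_Ici.2 (abs_nonneg _)⟩
    have : Continuous fun t : ℝ => |t - s| := by fun_prop
    simpa using (this.tendsto s).mono_left nhdsWithin_le_nhds
  have h1 := ((((hS.tendsto_nhdsGE w).comp h0).sub_const w).norm).const_mul M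
  simp only [sub_self, norm_zero, mul_zero] at h1
  refine squeeze_zero' (Eventually.of_forall fun t => norm_nonneg _) ?_ h1
  filter_upwards [self_mem_nhdsWithin] with t ht using key s hs t ht

/-- The function `e^{-tμ} S t w` has zero right derivative, hence is constant. A short interval is
enough, since only the derivative at 0 is used later. -/
theorem IsGenerator.apply_eigenvector [NormedSpace ℝ H] [IsScalarTower ℝ 𝕜 H]
    {S : ℝ → H →L[𝕜] H} {G : H →ₗ.[𝕜] H}
    (hS : IsC0Semigroup S) (hG : IsGenerator S G) {ε M : ℝ}
    (hM : ∀ t ∈ Icc (0 : ℝ) ε, ‖S t‖ ≤ M) {w : H} {μ : 𝕜} (hw : (w, μ • w) ∈ G.graph) :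
    ∀ t ∈ Icc (0 : ℝ) ε, S t w = NormedSpace.exp (t • μ) • w := by
  have hexp : ∀ t : ℝ, HasDerivAt (fun t : ℝ => NormedSpace.exp (-(t • μ)))
      (-(NormedSpace.exp (-(t • μ)) * μ)) t := fun t => by
    have := hasDerivAt_exp_smul_const (𝕂 := ℝ) (-μ) t
    simpa [smul_neg] using this
  have h0 : ∀ t ∈ Icc (0 : ℝ) ε, NormedSpace.exp (-(t • μ)) • S t w
      = NormedSpace.exp (-((0 : ℝ) • μ)) • S 0 w := by
    refine constant_of_has_deriv_right_zero ?_ ?_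
    · refine ContinuousOn.smul (fun t _ => (hexp t).continuousAt.continuousWithinAt)
        (hS.continuousOn_of_bound hM w)
    · intro t ht
      have hd : HasDerivWithinAt (fun t => S t w) (S t (μ • w)) (Ici t) t := by
        rw [← hasDerivWithinAt_Ioi_iff_Ici, hasDerivWithinAt_iff_tendsto_slope]
        have h1 : Tendsto (fun r : ℝ => r - t) (𝓝[Ioi t \ {t}] t) (𝓝[>] 0) := by
          refine tendsto_nhdsWithin_iff.2 ⟨?_, ?_⟩
          · have : Continuous fun r : ℝ => r - t := by fun_prop
            simpa using (this.tendsto t).mono_left nhdsWithin_le_nhds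
          · filter_upwards [self_mem_nhdsWithin] with r hr
            exact mem_Ioi.2 (sub_pos.2 (mem_Ioi.1 hr.1))
        have h2 := (((S t).continuous.tendsto _).comp ((hG w (μ • w)).1 hw)).comp h1
        refine h2.congr' ?_
        filter_upwards [self_mem_nhdsWithin] with r hr
        have hr' : t < r := hr.1
        have h3 := hS.add t (r - t) ht.1 (sub_nonneg.2 hr'.le)
        rw [add_sub_cancel] at h3
        simp only [Function.comp_apply, slope_def_module]
        rw [h3, ContinuousLinearMap.map_smul_of_tower, map_sub]; rfl
      have h4 := ((hexp t).hasDerivWithinAt (s := Ici t)).smul hd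
      refine h4.congr_deriv ?_ |>.congr (fun _ _ => rfl) rfl
      rw [map_smul, neg_smul, mul_smul]
      simp
  intro t ht
  have h1 := congrArg (fun z => NormedSpace.exp (t • μ) • z) (h0 t ht)
  have h2 : NormedSpace.exp (t • μ) * NormedSpace.exp (-(t • μ)) = 1 := by
    rw [← NormedSpace.exp_add_of_commute (Commute.neg_right rfl)]; simp
  simpa [smul_smul, h2, hS.zero] using h1

/-- The functional `⟨·, ψ_n⟩` diagonalizes a Riesz spectral generator. -/
theorem RieszSpectral.inner_psi_of_generator [CompleteSpace H] [NormedSpace ℝ H]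
    [IsScalarTower ℝ 𝕜 H] {S : ℝ → H →L[𝕜] H} {G : H →ₗ.[𝕜] H}
    (R : RieszSpectral G) (hS : IsC0Semigroup S) (hG : IsGenerator S G) {w y : H}
    (hw : (w, y) ∈ G.graph) (k : ℕ) :
    inner 𝕜 (R.psi k) y = R.lam k * inner 𝕜 (R.psi k) w := by
  obtain ⟨ε, hε, M, hM⟩ := hS.exists_bound
  have h1 : ∀ t ∈ Icc (0 : ℝ) ε, ∀ w, inner 𝕜 (R.psi k) (S t w)
      = NormedSpace.exp (t • R.lam k) * inner 𝕜 (R.psi k) w := by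
    intro t ht w
    -- Two bounded functionals that agree on the eigenvectors agree on their closed span. The
    -- unbounded generator would not allow this density argument; its semigroup does.
    have hclm : (innerSL 𝕜 (R.psi k)).comp (S t)
        = NormedSpace.exp (t • R.lam k) • innerSL 𝕜 (R.psi k) := by
      refine ContinuousLinearMap.ext_on (s := range R.phi)
        (Submodule.dense_iff_topologicalClosure_eq_top.2 R.dense) ?_
      rintro _ ⟨j, rfl⟩
      simp only [ContinuousLinearMap.comp_apply, innerSL_apply_apply,
        hG.apply_eigenvector hS hM (R.eigen j) t ht, inner_smul_right, R.biorthogonal,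
        smul_apply, smul_eq_mul]
      split_ifs with h
      · rw [h]
      · simp
    simpa using congrArg (fun f => f w) hclm
  have h2 := ((innerSL 𝕜 (R.psi k)).continuous.tendsto _).comp ((hG w y).1 hw)
  have h3 : Tendsto (fun t : ℝ => t⁻¹ • (NormedSpace.exp (t • R.lam k) - 1)) (𝓝[>] 0)
      (𝓝 (R.lam k)) := by
    have := (hasDerivAt_exp_smul_const (𝕂 := ℝ) (R.lam k) (0 : ℝ)).tendsto_slope_zero_right
    simpa using this
  refine tendsto_nhds_unique h2 ((h3.mul_const (inner 𝕜 (R.psi k) w)).congr' ?_)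
  have hmem : Icc (0 : ℝ) ε ∈ 𝓝[>] (0 : ℝ) :=
    mem_of_superset (Ioo_mem_nhdsGT hε) Ioo_subset_Icc_self
  filter_upwards [hmem] with t ht
  simp only [Function.comp_apply]
  rw [ContinuousLinearMap.map_smul_of_tower, map_sub, innerSL_apply_apply, innerSL_apply_apply, h1 t ht w,
    smul_mul_assoc, sub_mul, one_mul]

end Semigroup

/-! ### Coefficients in a Riesz basis -/

section Riesz

variable {𝕜 : Type*} [RCLike 𝕜] {H : Type*} [NormedAddCommGroup H] [InnerProductSpace 𝕜 H]
  [NormedSpace ℝ H] {G : H →ₗ.[𝕜] H} (R : RieszSpectral G)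

/-- Holding for every large `N` rather than for one, the expansion is stable under sums. -/
theorem RieszSpectral.exists_expansion {w : H} (hw : w ∈ Submodule.span 𝕜 (range R.phi)) :
    ∃ N₁, ∀ N, N₁ ≤ N → w = ∑ j ∈ Finset.range N, inner 𝕜 (R.psi j) w • R.phi j := by
  induction hw using Submodule.span_induction with
  | mem w hw =>
    obtain ⟨k, rfl⟩ := hw
    refine ⟨k + 1, fun N hN => ?_⟩
    simp [R.biorthogonal, ite_smul, Nat.lt_of_succ_le hN]
  | zero => exact ⟨0, fun N _ => by simp⟩
  | add w w' _ _ h h' =>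
    obtain ⟨N₁, h⟩ := h
    obtain ⟨N₂, h'⟩ := h'
    refine ⟨max N₁ N₂, fun N hN => ?_⟩
    simp only [inner_add_right, add_smul, Finset.sum_add_distrib]
    rw [← h N (le_of_max_le_left hN), ← h' N (le_of_max_le_right hN)]
  | smul c w _ h =>
    obtain ⟨N₁, h⟩ := h
    refine ⟨N₁, fun N hN => ?_⟩
    simp only [inner_smul_right, mul_smul, ← Finset.smul_sum]
    rw [← h N hN]

/-- Bessel inequality for the coefficients in a Riesz basis. -/
theorem RieszSpectral.bessel (N : ℕ) (w : H) :
    ∑ j ∈ Finset.range N, ‖(inner 𝕜 (R.psi j) w : 𝕜)‖ ^ 2 ≤ ‖w‖ ^ 2 / R.mR := by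
  have hd : Dense (Submodule.span 𝕜 (range R.phi) : Set H) :=
    Submodule.dense_iff_topologicalClosure_eq_top.2 R.dense
  refine hd.induction (P := fun w => ∑ j ∈ Finset.range N,
    ‖(inner 𝕜 (R.psi j) w : 𝕜)‖ ^ 2 ≤ ‖w‖ ^ 2 / R.mR) (fun w hw => ?_) ?_ w
  · obtain ⟨N₁, h⟩ := R.exists_expansion hw
    have h1 := R.lower (max N N₁) fun j => inner 𝕜 (R.psi j) w
    rw [← h _ (le_max_right _ _)] at h1
    rw [le_div_iff₀ R.mR_pos, mul_comm]
    refine le_trans ?_ h1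
    have := R.mR_pos
    gcongr
    exact le_max_left _ _
  · exact isClosed_le (by fun_prop) (by fun_prop)

/-- A uniform bound on the truncated coefficient sums bounds the norm. -/
theorem RieszSpectral.norm_sq_le {w : H} {C : ℝ}
    (hC : ∀ N, ∑ j ∈ Finset.range N, ‖(inner 𝕜 (R.psi j) w : 𝕜)‖ ^ 2 ≤ C) :
    ‖w‖ ^ 2 ≤ R.MR * C := by
  have hd : Dense (Submodule.span 𝕜 (range R.phi) : Set H) :=
    Submodule.dense_iff_topologicalClosure_eq_top.2 R.dense
  have hmR := R.mR_pos
  have hMR := R.MR_pos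
  have hC0 : 0 ≤ C := by simpa using hC 0
  have key : ∀ ε > 0, ‖w‖ ≤ ε + √(R.MR / R.mR) * ε + √(R.MR * C) := by
    intro ε hε
    obtain ⟨w', hw', hlt⟩ := hd.exists_dist_lt w hε
    obtain ⟨N, hN⟩ := R.exists_expansion hw'
    -- Here `w'` is a finite combination close to `w` and equals its own expansion up to `N`. The
    -- middle sum is small by `bessel` and the upper Riesz bound, so convergence of the expansion of
    -- `w` is not needed.
    have h1 : w = (w - w') + (∑ j ∈ Finset.range N, inner 𝕜 (R.psi j) (w' - w) • R.phi j)
        + ∑ j ∈ Finset.range N, inner 𝕜 (R.psi j) w • R.phi j := by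
      simp only [inner_sub_right, sub_smul, Finset.sum_sub_distrib]
      rw [← hN N le_rfl]; abel
    have h2 : ‖∑ j ∈ Finset.range N, inner 𝕜 (R.psi j) (w' - w) • R.phi j‖
        ≤ √(R.MR / R.mR) * ε := by
      refine abs_le_of_sq_le_sq' ?_ (by positivity) |>.2
      refine (R.upper N _).trans ?_
      rw [mul_pow, Real.sq_sqrt (by positivity)]
      have h3 := R.bessel N (w' - w)
      have h4 : ‖w' - w‖ ^ 2 ≤ ε ^ 2 := by
        rw [← dist_eq_norm, dist_comm]; gcongr
      calc _ ≤ R.MR * (‖w' - w‖ ^ 2 / R.mR) := by gcongr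
        _ ≤ R.MR * (ε ^ 2 / R.mR) := by gcongr
        _ = _ := by ring
    have h5 : ‖∑ j ∈ Finset.range N, inner 𝕜 (R.psi j) w • R.phi j‖ ≤ √(R.MR * C) :=
      Real.le_sqrt_of_sq_le ((R.upper N _).trans (by gcongr; exact hC N))
    rw [dist_eq_norm] at hlt
    calc ‖w‖ = _ := congrArg norm h1
      _ ≤ _ := norm_add₃_le
      _ ≤ _ := by gcongr
  have h6 : ‖w‖ ≤ √(R.MR * C) := by
    refine le_of_forall_pos_le_add fun η hη => ?_
    have hp : 0 < 1 + √(R.MR / R.mR) := by positivity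
    have := key (η / (1 + √(R.MR / R.mR))) (by positivity)
    have h7 : η / (1 + √(R.MR / R.mR)) + √(R.MR / R.mR) * (η / (1 + √(R.MR / R.mR))) = η := by
      field_simp
    linarith
  calc ‖w‖ ^ 2 ≤ √(R.MR * C) ^ 2 := by gcongr
    _ = _ := Real.sq_sqrt (by positivity)

theorem RieszSpectral.norm_modes_sq_le (N₀ : ℕ) (w : H) :
    ‖modes R N₀ w‖ ^ 2 ≤ ‖w‖ ^ 2 / R.mR := by
  have := R.bessel N₀ w
  rw [← Fin.sum_univ_eq_sum_range (fun j => ‖(inner 𝕜 (R.psi j) w : 𝕜)‖ ^ 2)] at this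
  rw [EuclideanSpace.norm_sq_eq]
  exact this

end Riesz

/-! ### Matrix estimates and the Lyapunov form -/

section Matrices

variable {𝕜 : Type*} [RCLike 𝕜] {p q r : ℕ}

theorem matCLM_apply (M : Matrix (Fin p) (Fin q) 𝕜) (z : Euc 𝕜 q) (i : Fin p) :
    matCLM M z i = ∑ j, M i j * z j := by
  simp [matCLM, Matrix.toLpLin_apply, Matrix.mulVec, dotProduct]

theorem matCLM_mul (M : Matrix (Fin p) (Fin q) 𝕜) (N : Matrix (Fin q) (Fin r) 𝕜) (z : Euc 𝕜 r) :
    matCLM (M * N) z = matCLM M (matCLM N z) := by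
  simp [matCLM, Matrix.toLpLin_apply, Matrix.mulVec_mulVec]

theorem matCLM_add (M N : Matrix (Fin p) (Fin q) 𝕜) (z : Euc 𝕜 q) :
    matCLM (M + N) z = matCLM M z + matCLM N z := by
  simp [matCLM]

theorem matCLM_diagonal (d : Fin p → 𝕜) (z : Euc 𝕜 p) (i : Fin p) :
    matCLM (Matrix.diagonal d) z i = d i * z i := by
  simp [matCLM_apply, Matrix.diagonal_apply]

theorem norm_matCLM_le (M : Matrix (Fin p) (Fin q) 𝕜) (z : Euc 𝕜 q) :
    ‖matCLM M z‖ ≤ matNorm M * ‖z‖ := (matCLM M).le_opNorm z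

theorem norm_matCLM_diagonal_le {d : Fin p → 𝕜} {C : ℝ} (hC : 0 ≤ C) (hd : ∀ i, ‖d i‖ ≤ C)
    (z : Euc 𝕜 p) : ‖matCLM (Matrix.diagonal d) z‖ ≤ C * ‖z‖ := by
  refine abs_le_of_sq_le_sq' ?_ (by positivity) |>.2
  rw [mul_pow, EuclideanSpace.norm_sq_eq, EuclideanSpace.norm_sq_eq, Finset.mul_sum]
  refine Finset.sum_le_sum fun i _ => ?_
  rw [matCLM_diagonal, norm_mul, mul_pow]
  gcongr
  exact hd i

theorem norm_le_matNorm_diagonal (d : Fin p → 𝕜) (i : Fin p) :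
    ‖d i‖ ≤ matNorm (Matrix.diagonal d) := by
  have h := norm_matCLM_le (Matrix.diagonal d) (EuclideanSpace.single i (1 : 𝕜))
  have h1 := PiLp.norm_apply_le (matCLM (Matrix.diagonal d) (EuclideanSpace.single i (1 : 𝕜))) i
  rw [matCLM_diagonal] at h1
  simpa using h1.trans h

theorem norm_exp_le_exp_norm_of_rclike (z : 𝕜) : ‖NormedSpace.exp z‖ ≤ Real.exp ‖z‖ := by
  rw [NormedSpace.exp_eq_tsum 𝕜, Real.exp_eq_exp_ℝ, NormedSpace.exp_eq_tsum ℝ]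
  refine (norm_tsum_le_tsum_norm (NormedSpace.norm_expSeries_summable' z)).trans (le_of_eq ?_)
  refine tsum_congr fun k => ?_
  simp

theorem exp_smul_diagonal (d : Fin p → 𝕜) (t : ℝ) :
    NormedSpace.exp (t • Matrix.diagonal d)
      = Matrix.diagonal fun i => NormedSpace.exp (t • d i) := by
  rw [← Matrix.diagonal_smul, Matrix.exp_diagonal]
  congr 1
  ext i
  simp [Pi.coe_exp]

/-- The exponential is diagonal, so its norm is controlled by its entries, and each `|d i|` is at
most the norm of the diagonal matrix. -/
theorem norm_matCLM_exp_le (d : Fin p → 𝕜) (t : ℝ) (z : Euc 𝕜 p) :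
    ‖matCLM (NormedSpace.exp (t • Matrix.diagonal d)) z‖
      ≤ Real.exp (|t| * matNorm (Matrix.diagonal d)) * ‖z‖ := by
  rw [exp_smul_diagonal]
  refine norm_matCLM_diagonal_le (Real.exp_pos _).le (fun i => ?_) z
  refine (norm_exp_le_exp_norm_of_rclike _).trans (Real.exp_le_exp.2 ?_)
  rw [norm_smul, Real.norm_eq_abs]
  gcongr
  exact norm_le_matNorm_diagonal d i

/-- Cauchy–Schwarz on each row, then on the sum over the rows; the latter gives the factor `p`,
which is the factor `m` in `constC5`. -/
theorem norm_sq_apply_matCLM_le {H : Type*} [NormedAddCommGroup H] [InnerProductSpace 𝕜 H]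
    (L : Euc 𝕜 p →L[𝕜] H) (M : Matrix (Fin p) (Fin q) 𝕜) (z : Euc 𝕜 q) :
    ‖L (matCLM M z)‖ ^ 2
      ≤ p * ∑ i, ‖L (EuclideanSpace.single i 1)‖ ^ 2 * rowNorm M i ^ 2 * ‖z‖ ^ 2 := by
  have hrow : ∀ i, ‖matCLM M z i‖ ≤ rowNorm M i * ‖z‖ := by
    intro i
    have h := norm_inner_le_norm (𝕜 := 𝕜) (WithLp.toLp 2 (star (M i)) : Euc 𝕜 q) z
    have h1 : inner 𝕜 (WithLp.toLp 2 (star (M i)) : Euc 𝕜 q) z = matCLM M z i := by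
      simp [matCLM_apply, PiLp.inner_apply, mul_comm]
    have h2 : ‖(WithLp.toLp 2 (star (M i)) : Euc 𝕜 q)‖ = rowNorm M i := by
      simp [rowNorm, EuclideanSpace.norm_eq]
    rwa [h1, h2] at h
  have hsum : matCLM M z = ∑ i, matCLM M z i • (EuclideanSpace.single i (1 : 𝕜) : Euc 𝕜 p) := by
    ext j
    simp [Finset.sum_apply, Pi.single_apply]
  have h1 : ‖L (matCLM M z)‖
      ≤ ∑ i, ‖L (EuclideanSpace.single i 1)‖ * (rowNorm M i * ‖z‖) := by
    conv_lhs => rw [hsum, map_sum]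
    refine (norm_sum_le _ _).trans (Finset.sum_le_sum fun i _ => ?_)
    rw [map_smul, norm_smul, mul_comm]
    gcongr
    exact hrow i
  calc ‖L (matCLM M z)‖ ^ 2
      ≤ (∑ i, ‖L (EuclideanSpace.single i 1)‖ * (rowNorm M i * ‖z‖)) ^ 2 := by gcongr
    _ ≤ (Finset.univ : Finset (Fin p)).card
        * ∑ i, (‖L (EuclideanSpace.single i 1)‖ * (rowNorm M i * ‖z‖)) ^ 2 :=
      sq_sum_le_card_mul_sum_sq
    _ = _ := by simp only [Finset.card_univ, Fintype.card_fin, mul_pow, mul_assoc]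

/-- The quadratic form `z ↦ Re (z* P z)`. -/
noncomputable def quadForm (P : Matrix (Fin p) (Fin p) 𝕜) (z : Euc 𝕜 p) : ℝ :=
  RCLike.re (inner 𝕜 z (matCLM P z))

theorem inner_matCLM_right (M : Matrix (Fin p) (Fin q) 𝕜) (y : Euc 𝕜 p) (z : Euc 𝕜 q) :
    inner 𝕜 y (matCLM M z) = inner 𝕜 (matCLM Mᴴ y) z := by
  simp only [PiLp.inner_apply, matCLM_apply, RCLike.inner_apply, map_sum, Finset.sum_mul,
    Finset.mul_sum, map_mul, Matrix.conjTranspose_apply, RCLike.star_def, RCLike.conj_conj]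
  rw [Finset.sum_comm]
  refine Finset.sum_congr rfl fun i _ => Finset.sum_congr rfl fun j _ => ?_
  ring

theorem quadForm_eq_dotProduct (P : Matrix (Fin p) (Fin p) 𝕜) (z : Euc 𝕜 p) :
    quadForm P z = RCLike.re (star (WithLp.ofLp z) ⬝ᵥ (P *ᵥ WithLp.ofLp z)) := by
  simp [quadForm, PiLp.inner_apply, matCLM_apply, dotProduct, Matrix.mulVec, mul_comm]

theorem quadForm_nonneg_of_spectrum {P : Matrix (Fin p) (Fin p) 𝕜} (hP : P.IsHermitian)
    (h : ∀ x ∈ spectrum ℝ P, 0 ≤ x) (z : Euc 𝕜 p) : 0 ≤ quadForm P z := by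
  have h1 : P.PosSemidef := by
    rw [hP.posSemidef_iff_eigenvalues_nonneg]
    intro i
    refine h _ ?_
    rw [hP.spectrum_real_eq_range_eigenvalues]
    exact ⟨i, rfl⟩
  rw [quadForm_eq_dotProduct]
  exact (RCLike.nonneg_iff.1 (h1.dotProduct_mulVec_nonneg _)).1

/-- Reduces both spectral bounds on the form to positivity of the shifted matrices `P - λ_m(P)` and
`λ_M(P) - P`. -/
theorem quadForm_add_smul_one (P : Matrix (Fin p) (Fin p) 𝕜) (a b : ℝ) (z : Euc 𝕜 p) :
    quadForm (algebraMap ℝ _ a + b • P) z = a * ‖z‖ ^ 2 + b * quadForm P z := by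
  have h1 : matCLM (algebraMap ℝ (Matrix (Fin p) (Fin p) 𝕜) a + b • P) z
      = (a : 𝕜) • z + (b : 𝕜) • matCLM P z := by
    ext i
    simp [matCLM_apply, add_mul, Finset.sum_add_distrib, Matrix.algebraMap_matrix_apply,
      ite_mul, Finset.mul_sum, RCLike.real_smul_eq_coe_mul, mul_assoc]
  rw [quadForm, h1, inner_add_right, inner_smul_right, inner_smul_right, map_add,
    RCLike.re_ofReal_mul, RCLike.re_ofReal_mul, inner_self_eq_norm_sq, quadForm]

theorem finite_spectrum_real {P : Matrix (Fin p) (Fin p) 𝕜} (hP : P.IsHermitian) :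
    (spectrum ℝ P).Finite := by
  rw [hP.spectrum_real_eq_range_eigenvalues]; exact finite_range _

theorem lamMin_mul_le_quadForm {P : Matrix (Fin p) (Fin p) 𝕜} (hP : P.IsHermitian)
    (z : Euc 𝕜 p) : lamMin P * ‖z‖ ^ 2 ≤ quadForm P z := by
  have h := quadForm_nonneg_of_spectrum (P := algebraMap ℝ _ (-lamMin P) + (1 : ℝ) • P)
    (by
      rw [one_smul]
      refine Matrix.IsHermitian.add ?_ hP
      rw [Matrix.IsHermitian, ← Matrix.star_eq_conjTranspose, ← algebraMap_star_comm]; simp)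
    (fun x hx => by
      rw [one_smul, ← spectrum.vadd_eq, Set.mem_vadd_set] at hx
      obtain ⟨y, hy, rfl⟩ := hx
      have := csInf_le (finite_spectrum_real hP).bddBelow hy
      rw [vadd_eq_add, lamMin]
      linarith) z
  rw [quadForm_add_smul_one] at h
  linarith

theorem quadForm_le_lamMax_mul {P : Matrix (Fin p) (Fin p) 𝕜} (hP : P.IsHermitian)
    (z : Euc 𝕜 p) : quadForm P z ≤ lamMax P * ‖z‖ ^ 2 := by
  have h := quadForm_nonneg_of_spectrum (P := algebraMap ℝ _ (lamMax P) + (-1 : ℝ) • P)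
    (by
      rw [neg_one_smul]
      refine Matrix.IsHermitian.add ?_ hP.neg
      rw [Matrix.IsHermitian, ← Matrix.star_eq_conjTranspose, ← algebraMap_star_comm]; simp)
    (fun x hx => by
      rw [neg_one_smul, ← spectrum.vadd_eq, Set.mem_vadd_set] at hx
      obtain ⟨y, hy, rfl⟩ := hx
      rw [← spectrum.neg_eq, Set.mem_neg] at hy
      have := le_csSup (finite_spectrum_real hP).bddAbove hy
      rw [vadd_eq_add, lamMax]
      linarith) z
  rw [quadForm_add_smul_one] at h
  linarith

/-- For `p = 0` the spectrum is empty and its `sInf` is 0, hence the `NeZero` instance. -/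
theorem lamMin_pos [NeZero p] {P : Matrix (Fin p) (Fin p) 𝕜} (hP : P.PosDef) : 0 < lamMin P := by
  have hne : (spectrum ℝ P).Nonempty := by
    rw [hP.1.spectrum_real_eq_range_eigenvalues]; exact range_nonempty _
  have hmem := hne.csInf_mem (finite_spectrum_real hP.1)
  rw [hP.1.spectrum_real_eq_range_eigenvalues] at hmem
  obtain ⟨i, hi⟩ := hmem
  rw [lamMin, hP.1.spectrum_real_eq_range_eigenvalues, ← hi]
  exact hP.eigenvalues_pos i

theorem lamMax_pos [NeZero p] {P : Matrix (Fin p) (Fin p) 𝕜} (hP : P.PosDef) : 0 < lamMax P := by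
  have hne : (spectrum ℝ P).Nonempty := by
    rw [hP.1.spectrum_real_eq_range_eigenvalues]; exact range_nonempty _
  refine (lamMin_pos hP).trans_le ?_
  exact csInf_le_csSup hne (finite_spectrum_real hP.1).bddBelow (finite_spectrum_real hP.1).bddAbove

theorem hasDerivAt_quadForm {P : Matrix (Fin p) (Fin p) 𝕜} (hP : P.IsHermitian)
    {Z : ℝ → Euc 𝕜 p} {Z' : Euc 𝕜 p} {t : ℝ} (hZ : HasDerivAt Z Z' t) :
    HasDerivAt (fun s => quadForm P (Z s)) (2 * RCLike.re (inner 𝕜 (matCLM P (Z t)) Z')) t := by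
  have h1 : HasDerivAt (fun s => matCLM P (Z s)) (matCLM P Z') t :=
    ((matCLM P).restrictScalars ℝ).hasFDerivAt.comp_hasDerivAt t hZ
  have h2 := (RCLike.reCLM (K := 𝕜)).hasFDerivAt.comp_hasDerivAt t (hZ.inner 𝕜 h1)
  refine h2.congr_deriv ?_
  rw [inner_matCLM_right, hP.eq]
  simp only [RCLike.reCLM_apply, map_add]
  rw [← inner_re_symm (𝕜 := 𝕜) (matCLM P (Z t)) Z']
  ring

theorem continuous_quadForm (P : Matrix (Fin p) (Fin p) 𝕜) : Continuous (quadForm P) := by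
  unfold quadForm
  fun_prop

/-- Dissipation of the quadratic form of a Lyapunov matrix along a perturbed linear system. -/
theorem two_re_inner_lyapunov_le {P M : Matrix (Fin p) (Fin p) 𝕜} (hP : P.IsHermitian)
    (hL : Mᴴ * P + P * M = -1) {β : ℝ} (hβ : 0 < β) (z d : Euc 𝕜 p) :
    2 * RCLike.re (inner 𝕜 (matCLM P z) (matCLM M z + d))
      ≤ -(1 - β) * ‖z‖ ^ 2 + matNorm P ^ 2 / β * ‖d‖ ^ 2 := by
  have h1 : inner 𝕜 (matCLM P z) (matCLM M z) = inner 𝕜 z (matCLM (P * M) z) := by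
    rw [matCLM_mul, inner_matCLM_right P, hP.eq]
  have h2 : inner 𝕜 (matCLM M z) (matCLM P z) = inner 𝕜 z (matCLM (Mᴴ * P) z) := by
    rw [matCLM_mul, inner_matCLM_right Mᴴ, Matrix.conjTranspose_conjTranspose]
  have h3 : matCLM (Mᴴ * P) z + matCLM (P * M) z = -z := by
    rw [← matCLM_add, hL]
    ext i
    simp [matCLM_apply, Matrix.one_apply]
  have h4 : 2 * RCLike.re (inner 𝕜 (matCLM P z) (matCLM M z)) = -‖z‖ ^ 2 := by
    have h5 := congrArg (fun w => RCLike.re (inner 𝕜 z w)) h3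
    simp only [inner_add_right, inner_neg_right, map_add, map_neg, ← h1, ← h2,
      inner_self_eq_norm_sq] at h5
    rw [inner_re_symm (𝕜 := 𝕜) (matCLM M z)] at h5
    linarith
  have h6 : RCLike.re (inner 𝕜 (matCLM P z) d) ≤ matNorm P * ‖z‖ * ‖d‖ :=
    (re_inner_le_norm _ _).trans (by gcongr; exact norm_matCLM_le P z)
  -- Young's inequality spends the share `β` of the unit dissipation on the perturbation and leaves
  -- `1 - β`.
  have h7 : 2 * (matNorm P * ‖z‖ * ‖d‖) ≤ β * ‖z‖ ^ 2 + matNorm P ^ 2 / β * ‖d‖ ^ 2 := by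
    have h8 : β * ‖z‖ ^ 2 + matNorm P ^ 2 / β * ‖d‖ ^ 2 - 2 * (matNorm P * ‖z‖ * ‖d‖)
        = (β * ‖z‖ - matNorm P * ‖d‖) ^ 2 / β := by field_simp; ring
    have : 0 ≤ (β * ‖z‖ - matNorm P * ‖d‖) ^ 2 / β := by positivity
    linarith
  rw [inner_add_right, map_add]
  linarith

end Matrices

/-! ### The flow of a diagonal matrix, coordinate by coordinate -/

section DiagonalFlow

variable {𝕜 : Type*} [RCLike 𝕜] {p : ℕ}

theorem hasDerivAt_of_apply {f : ℝ → Euc 𝕜 p} {f' : Euc 𝕜 p} {t : ℝ}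
    (h : ∀ i, HasDerivAt (fun s => f s i) (f' i) t) : HasDerivAt f f' t :=
  (PiLp.continuousLinearEquiv 2 ℝ (fun _ : Fin p => 𝕜)).symm.toContinuousLinearMap.hasFDerivAt
    |>.comp_hasDerivAt t (hasDerivAt_pi.2 h)

theorem hasDerivAt_apply {f : ℝ → Euc 𝕜 p} {f' : Euc 𝕜 p} {t : ℝ} (h : HasDerivAt f f' t)
    (i : Fin p) : HasDerivAt (fun s => f s i) (f' i) t :=
  hasDerivAt_pi.1 ((PiLp.continuousLinearEquiv 2 ℝ (fun _ : Fin p => 𝕜)).toContinuousLinearMap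
    |>.hasFDerivAt.comp_hasDerivAt t h) i

/-- The flow `e^{t diag(d)}`. -/
noncomputable def diagFlow (d : Fin p → 𝕜) (t : ℝ) : Euc 𝕜 p →L[𝕜] Euc 𝕜 p :=
  matCLM (NormedSpace.exp (t • Matrix.diagonal d))

theorem diagFlow_apply (d : Fin p → 𝕜) (t : ℝ) (z : Euc 𝕜 p) (i : Fin p) :
    diagFlow d t z i = NormedSpace.exp (t • d i) * z i := by
  rw [diagFlow, exp_smul_diagonal, matCLM_diagonal]

theorem diagFlow_add (d : Fin p → 𝕜) (s t : ℝ) (z : Euc 𝕜 p) :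
    diagFlow d (s + t) z = diagFlow d s (diagFlow d t z) := by
  ext i
  simp only [diagFlow_apply]
  rw [add_smul, NormedSpace.exp_add_of_commute (Commute.all _ _), mul_assoc]

theorem diagFlow_zero (d : Fin p → 𝕜) (z : Euc 𝕜 p) : diagFlow d 0 z = z := by
  ext i
  simp [diagFlow_apply]

theorem hasDerivAt_diagFlow (d : Fin p → 𝕜) {z : ℝ → Euc 𝕜 p} {z' : Euc 𝕜 p} {t : ℝ}
    (hz : HasDerivAt z z' t) :
    HasDerivAt (fun s => diagFlow d s (z s))
      (matCLM (Matrix.diagonal d) (diagFlow d t (z t)) + diagFlow d t z') t := by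
  refine hasDerivAt_of_apply fun i => ?_
  have h := (hasDerivAt_exp_smul_const (𝕂 := ℝ) (d i) t).mul (hasDerivAt_apply hz i)
  refine (h.congr_deriv ?_).congr_of_eventuallyEq
    (Eventually.of_forall fun s => diagFlow_apply d s (z s) i)
  simp only [PiLp.add_apply, matCLM_diagonal, diagFlow_apply]
  ring

theorem continuousOn_diagFlow (d : Fin p → 𝕜) {z : ℝ → Euc 𝕜 p} {τ : ℝ → ℝ} {s : Set ℝ}
    (hτ : Continuous τ) (hz : ContinuousOn z s) :
    ContinuousOn (fun t => diagFlow d (τ t) (z t)) s := by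
  refine (PiLp.continuous_toLp 2 _).comp_continuousOn (f := fun t i => diagFlow d (τ t) (z t) i)
    (continuousOn_pi.2 fun i => ?_)
  simp only [diagFlow_apply]
  have h1 : Continuous fun t : ℝ => NormedSpace.exp (t • d i) :=
    continuous_iff_continuousAt.2 fun t => (hasDerivAt_exp_smul_const (𝕂 := ℝ) (d i) t).continuousAt
  have h2 : ContinuousOn (fun t => z t i) s := by fun_prop
  exact (h1.comp hτ).continuousOn.mul h2

theorem integrable_diagFlow_neg (d : Fin p → 𝕜) {z : ℝ → Euc 𝕜 p} (hz : LocallyIntegrable z) :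
    LocallyIntegrable fun s => diagFlow d (-s) (z s) := by
  rw [← locallyIntegrableOn_univ] at hz ⊢
  have hcomp : ∀ i, LocallyIntegrableOn (fun s => z s i) univ := fun i => by
    rw [locallyIntegrableOn_univ] at hz ⊢
    intro s
    obtain ⟨S, hS, hi⟩ := hz s
    exact ⟨S, hS, (PiLp.proj (𝕜 := 𝕜) 2 (fun _ : Fin p => 𝕜) i).integrable_comp hi⟩
  have hcomp2 : ∀ i, LocallyIntegrable (fun s => diagFlow d (-s) (z s) i) := fun i => by
    rw [← locallyIntegrableOn_univ]
    simp only [diagFlow_apply]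
    refine (hcomp i).continuousOn_mul (Continuous.continuousOn ?_) isClosed_univ.isLocallyClosed
    have h1 : Continuous fun t : ℝ => NormedSpace.exp (t • d i) :=
      continuous_iff_continuousAt.2 fun t =>
        (hasDerivAt_exp_smul_const (𝕂 := ℝ) (d i) t).continuousAt
    exact h1.comp continuous_neg
  rw [locallyIntegrableOn_univ, locallyIntegrable_iff]
  intro k hk
  exact Integrable.of_eval_piLp fun i => (hcomp2 i).integrableOn_isCompact hk

theorem norm_diagFlow_le (d : Fin p → 𝕜) (t : ℝ) (z : Euc 𝕜 p) :
    ‖diagFlow d t z‖ ≤ Real.exp (|t| * matNorm (Matrix.diagonal d)) * ‖z‖ :=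
  norm_matCLM_exp_le d t z

end DiagonalFlow

/-! ### Modal equations under a boundary input -/

section Modal

theorem mem_graph_disturbanceFree {𝕜 : Type*} [RCLike 𝕜] {H : Type*} [NormedAddCommGroup H]
    [InnerProductSpace 𝕜 H] {m : ℕ} {A : H →ₗ.[𝕜] H} {Bd : H →ₗ.[𝕜] Euc 𝕜 m} {w y : H}
    (hA : (w, y) ∈ A.graph) (hB : (w, (0 : Euc 𝕜 m)) ∈ Bd.graph) :
    (w, y) ∈ (disturbanceFree A Bd).graph := by
  rw [LinearPMap.mem_graph_iff] at hA hB ⊢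
  obtain ⟨a, ha, hay⟩ := hA
  obtain ⟨b, hb, hb0⟩ := hB
  simp only at ha hay hb hb0
  refine ⟨⟨w, ⟨⟨b, hb0, hb⟩, ha ▸ a.2⟩⟩, rfl, ?_⟩
  rw [← hay]
  exact LinearPMap.domRestrict_apply ha.symm

variable {𝕜 : Type*} [RCLike 𝕜] {H : Type*} [NormedAddCommGroup H] [InnerProductSpace 𝕜 H]
  [NormedSpace ℝ H] {m : ℕ}

/-- The map `w ↦ (⟨w, ψ_1⟩, …, ⟨w, ψ_{N₀}⟩)` as a bounded operator. -/
noncomputable def modesCLM {G : H →ₗ.[𝕜] H} (R : RieszSpectral G) (N₀ : ℕ) : H →L[𝕜] Euc 𝕜 N₀ :=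
  (PiLp.continuousLinearEquiv 2 𝕜 (fun _ : Fin N₀ => 𝕜)).symm.toContinuousLinearMap.comp
    (ContinuousLinearMap.pi fun i : Fin N₀ => innerSL 𝕜 (R.psi i))

theorem modesCLM_apply {G : H →ₗ.[𝕜] H} (R : RieszSpectral G) (N₀ : ℕ) (w : H) :
    modesCLM R N₀ w = modes R N₀ w := rfl

theorem modes_apply {G : H →ₗ.[𝕜] H} (R : RieszSpectral G) (N₀ : ℕ) (w : H) (i : Fin N₀) :
    modes R N₀ w i = inner 𝕜 (R.psi i) w := rfl

/-- Since `ℬ B = I`, the vector `w - B μ` lies in the domain of `𝒜₀`, where `⟨·, ψ_k⟩` is an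
eigenfunctional; and `𝒜 (w - B μ) = 𝒜 w - 𝒜 B μ`. -/
theorem inner_psi_apply_of_boundary [CompleteSpace H] [IsScalarTower ℝ 𝕜 H]
    (sys : BoundaryControlSystem 𝕜 H m) (R : RieszSpectral sys.A0) (k : ℕ) (w : sys.A.domain)
    {μ : Euc 𝕜 m} (hμ : sys.Bd ⟨w, sys.domain_le w.2⟩ = μ) :
    inner 𝕜 (R.psi k) (sys.A w) = R.lam k * inner 𝕜 (R.psi k) ((w : H) - sys.B μ)
      + inner 𝕜 (R.psi k) (sys.AB μ) := by
  obtain ⟨S, hS, hG⟩ := sys.generates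
  have h1 : ((w : H) - sys.B μ, sys.A w - sys.AB μ) ∈ sys.A0.graph := by
    refine mem_graph_disturbanceFree ?_ ?_
    · exact Submodule.sub_mem _ (LinearPMap.mem_graph sys.A w) (sys.lift_A μ)
    · have h := LinearPMap.mem_graph sys.Bd ⟨w, sys.domain_le w.2⟩
      rw [hμ] at h
      simpa using Submodule.sub_mem _ h (sys.lift_Bd μ)
  have h2 := R.inner_psi_of_generator hS hG h1 k
  rw [inner_sub_right] at h2
  rw [← h2]; ring

theorem matCLM_matB_apply (sys : BoundaryControlSystem 𝕜 H m) (R : RieszSpectral sys.A0) (N₀ : ℕ)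
    (μ : Euc 𝕜 m) (i : Fin N₀) :
    matCLM (matB sys R N₀) μ i
      = -R.lam i * inner 𝕜 (R.psi i) (sys.B μ) + inner 𝕜 (R.psi i) (sys.AB μ) := by
  have hsum : μ = ∑ j, μ j • (EuclideanSpace.single j (1 : 𝕜) : Euc 𝕜 m) := by
    ext j
    simp [Finset.sum_apply, Pi.single_apply]
  rw [matCLM_apply]
  conv_rhs => rw [hsum]
  simp only [map_sum, map_smul, inner_sum, inner_smul_right, Finset.mul_sum, matB, Matrix.of_apply,
    ← Finset.sum_add_distrib]
  exact Finset.sum_congr rfl fun j _ => by ring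

theorem modes_apply_of_boundary [CompleteSpace H] [IsScalarTower ℝ 𝕜 H]
    (sys : BoundaryControlSystem 𝕜 H m) (R : RieszSpectral sys.A0) (N₀ : ℕ) (w : sys.A.domain)
    {μ : Euc 𝕜 m} (hμ : sys.Bd ⟨w, sys.domain_le w.2⟩ = μ) :
    modes R N₀ (sys.A w) = matCLM (matA R N₀) (modes R N₀ w) + matCLM (matB sys R N₀) μ := by
  ext i
  rw [PiLp.add_apply, matCLM_matB_apply, matA, matCLM_diagonal, modes_apply, modes_apply,
    inner_psi_apply_of_boundary sys R i w hμ, inner_sub_right]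
  ring

end Modal

/-! ### The Artstein predictor state -/

section Predictor

variable {𝕜 : Type*} [RCLike 𝕜] {H : Type*} [NormedAddCommGroup H] [InnerProductSpace 𝕜 H]
  [NormedSpace ℝ H] {m n mv N₀ : ℕ}

/-- The predictor (Artstein) state. -/
noncomputable def predictor (sys : BoundaryControlSystem 𝕜 H m) (R : RieszSpectral sys.A0) (N₀ : ℕ)
    (D : ℝ) (X : ℝ → H) (u : ℝ → Euc 𝕜 m) (t : ℝ) : Euc 𝕜 N₀ :=
  modes R N₀ (X t) + ∫ s in (max (t - D) 0)..t,
    matCLM (NormedSpace.exp ((t - s - D) • matA R N₀) * matB sys R N₀) (u s)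

/-- The diagonal flow generated by the first `N₀` eigenvalues. -/
noncomputable abbrev modalFlow {G : H →ₗ.[𝕜] H} (R : RieszSpectral G) (N₀ : ℕ) (t : ℝ) :
    Euc 𝕜 N₀ →L[𝕜] Euc 𝕜 N₀ :=
  diagFlow (fun i : Fin N₀ => R.lam i) t

/-- The control, set to zero for negative times and mapped back along the modal flow. -/
noncomputable def pulledInput (sys : BoundaryControlSystem 𝕜 H m) (R : RieszSpectral sys.A0)
    (N₀ : ℕ) (u : ℝ → Euc 𝕜 m) (s : ℝ) : Euc 𝕜 N₀ :=
  modalFlow R N₀ (-s) (matCLM (matB sys R N₀) ((Ici (0 : ℝ)).indicator u s))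

theorem matCLM_exp_matA_mul (sys : BoundaryControlSystem 𝕜 H m) (R : RieszSpectral sys.A0) (τ : ℝ)
    (w : Euc 𝕜 m) :
    matCLM (NormedSpace.exp (τ • matA R N₀) * matB sys R N₀) w
      = modalFlow R N₀ τ (matCLM (matB sys R N₀) w) :=
  matCLM_mul _ _ _

theorem locallyIntegrable_indicator_Ici {E : Type*} [NormedAddCommGroup E] {u : ℝ → E} {a b : ℝ}
    (hab : a ≤ b) (hu : LocallyIntegrableOn u (Ici a)) :
    LocallyIntegrable ((Ici b).indicator u) := by
  rw [locallyIntegrable_iff]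
  intro k hk
  rw [IntegrableOn, integrable_indicator_iff measurableSet_Ici, IntegrableOn,
    Measure.restrict_restrict measurableSet_Ici]
  exact (hu.mono_set (Ici_subset_Ici.2 hab)).integrableOn_compact_subset inter_subset_left
    (hk.inter_left isClosed_Ici)

variable {sys : BoundaryControlSystem 𝕜 H m} {R : RieszSpectral sys.A0}
    {D t₀ : ℝ} {φ : ℝ → ℝ} {K : Matrix (Fin m) (Fin N₀) 𝕜}
    {f₁ : Euc 𝕜 n × H × Euc 𝕜 mv → Euc 𝕜 n} {f₂ : Euc 𝕜 n × H × Euc 𝕜 mv → H}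
    {x₀ : Euc 𝕜 n} {X₀ : H} {v : ℝ → Euc 𝕜 mv}
    {x : ℝ → Euc 𝕜 n} {X : ℝ → H} {u : ℝ → Euc 𝕜 m}

theorem locallyIntegrable_pulledInput {a : ℝ} (ha : a ≤ 0) (hu : LocallyIntegrableOn u (Ici a)) :
    LocallyIntegrable (pulledInput sys R N₀ u) := by
  refine integrable_diagFlow_neg _ fun s => ?_
  obtain ⟨S, hS, hi⟩ := locallyIntegrable_indicator_Ici ha hu s
  exact ⟨S, hS, (matCLM (matB sys R N₀)).integrable_comp hi⟩

theorem IsClassicalSolution.pulledInput_eq_zero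
    (h : IsClassicalSolution sys R D φ K f₁ f₂ x₀ X₀ v x X u) (hD : 0 ≤ D) {s : ℝ} (hs : s ≤ 0) :
    pulledInput sys R N₀ u s = 0 := by
  have : (Ici (0 : ℝ)).indicator u s = 0 := by
    rcases hs.lt_or_eq with hs | rfl
    · exact indicator_of_notMem (by simpa using hs) _
    · rw [indicator_of_mem (by simp), h.u_zero 0 ⟨by linarith, le_rfl⟩]
  simp [pulledInput, this]

theorem IsClassicalSolution.intervalIntegrable_pulledInput
    (h : IsClassicalSolution sys R D φ K f₁ f₂ x₀ X₀ v x X u) (hD : 0 ≤ D) (a b : ℝ) :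
    IntervalIntegrable (pulledInput sys R N₀ u) volume a b :=
  ((locallyIntegrable_pulledInput (by linarith : -D ≤ 0)
    h.u_locallyIntegrable).integrableOn_isCompact isCompact_uIcc).intervalIntegrable

/-- Splitting `e^{(t-s-D)A}` into `e^{(t-D)A} e^{-sA}` removes `t` from the integrand, so the delay
integral becomes a flow applied to a difference of primitives. The pulled-back input vanishes for `s
≤ 0`, which takes care of the maximum in the lower limit. -/
theorem IsClassicalSolution.predictor_eq
    (h : IsClassicalSolution sys R D φ K f₁ f₂ x₀ X₀ v x X u) (hD : 0 ≤ D) {t : ℝ} (ht : 0 ≤ t) :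
    predictor sys R N₀ D X u t = modes R N₀ (X t) + modalFlow R N₀ (t - D)
      ((∫ s in (0 : ℝ)..t, pulledInput sys R N₀ u s)
        - ∫ s in (0 : ℝ)..(t - D), pulledInput sys R N₀ u s) := by
  have hint := h.intervalIntegrable_pulledInput hD
  have hmax : (∫ s in (0 : ℝ)..(t - D), pulledInput sys R N₀ u s)
      = ∫ s in (0 : ℝ)..(max (t - D) 0), pulledInput sys R N₀ u s := by
    rcases le_total (t - D) 0 with h0 | h0
    · rw [max_eq_right h0, intervalIntegral.integral_same]
      refine (intervalIntegral.integral_congr (g := fun _ => 0) fun s hs => ?_).trans (by simp)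
      rw [uIcc_of_ge h0] at hs
      exact h.pulledInput_eq_zero hD hs.2
    · rw [max_eq_left h0]
  rw [predictor, hmax, intervalIntegral.integral_interval_sub_left (hint _ _) (hint _ _),
    ← ContinuousLinearMap.intervalIntegral_comp_comm _ (hint _ _)]
  congr 1
  refine intervalIntegral.integral_congr fun s hs => ?_
  rw [uIcc_of_le (max_le (by linarith) ht)] at hs
  have hs0 : s ∈ Ici (0 : ℝ) := (le_max_right _ _).trans hs.1
  simp only [matCLM_exp_matA_mul, pulledInput, indicator_of_mem hs0]
  rw [modalFlow, ← diagFlow_add]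
  congr 2
  ring

theorem IsClassicalSolution.u_eq_predictor
    (h : IsClassicalSolution sys R D φ K f₁ f₂ x₀ X₀ v x X u) {t : ℝ} (ht : 0 ≤ t) :
    u t = φ t • matCLM K (predictor sys R N₀ D X u t) := by
  rw [h.u_eq t ht, predictor, map_add, smul_add]

theorem IsClassicalSolution.continuousOn_predictor
    (h : IsClassicalSolution sys R D φ K f₁ f₂ x₀ X₀ v x X u) (hD : 0 ≤ D) :
    ContinuousOn (predictor sys R N₀ D X u) (Ici 0) := by
  have hint := h.intervalIntegrable_pulledInput hD
  have hG := intervalIntegral.continuous_primitive hint 0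
  refine ContinuousOn.congr ?_ fun t ht => h.predictor_eq hD ht
  refine ((modesCLM R N₀).continuous.comp_continuousOn h.X_contDiff.continuousOn).add ?_
  refine continuousOn_diagFlow _ (by fun_prop) (Continuous.continuousOn ?_)
  exact hG.sub (hG.comp (by fun_prop))

/-- Bootstrap: a locally integrable control makes the predictor continuous, and the control is `φ K`
times the predictor. It also vanishes at 0, so its extension by zero has no jump; this makes the
primitives differentiable. -/
theorem IsClassicalSolution.continuous_indicator
    (h : IsClassicalSolution sys R D φ K f₁ f₂ x₀ X₀ v x X u) (hD : 0 ≤ D)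
    (hφ : ContinuousOn φ (Ici 0)) : Continuous ((Ici (0 : ℝ)).indicator u) := by
  have hu : ContinuousOn u (Ici 0) := by
    refine ContinuousOn.congr ?_ fun t ht => h.u_eq_predictor ht
    exact hφ.smul ((matCLM K).continuous.comp_continuousOn (h.continuousOn_predictor hD))
  have h1 : (Ici (0 : ℝ)).indicator u = fun t => u (max t 0) := by
    ext1 t
    rcases le_or_gt 0 t with ht | ht
    · rw [indicator_of_mem (mem_Ici.2 ht), max_eq_left ht]
    · rw [indicator_of_notMem (by simpa using ht), max_eq_right ht.le,
        h.u_zero 0 ⟨by linarith, le_rfl⟩]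
  rw [h1]
  exact hu.comp_continuous (by fun_prop) fun t => mem_Ici.2 (le_max_right _ _)

theorem IsClassicalSolution.X_hasDerivAt
    (h : IsClassicalSolution sys R D φ K f₁ f₂ x₀ X₀ v x X u) {t : ℝ} (ht : 0 < t) :
    HasDerivAt X (sys.A ⟨X t, h.X_mem t ht.le⟩ + f₂ (x t, X t, v t)) t :=
  (h.X_deriv t ht.le).hasDerivAt (Ici_mem_nhds ht)

/-- Differentiating the lower limit of the delay integral produces `-B_{N₀} u(t - D)`, which cancels
the delayed input in the equation of the modes; the upper limit leaves `e^{-D A_{N₀}} B_{N₀} u(t)`.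
-/
theorem IsClassicalSolution.hasDerivAt_predictor [CompleteSpace H] [IsScalarTower ℝ 𝕜 H]
    (h : IsClassicalSolution sys R D φ K f₁ f₂ x₀ X₀ v x X u) (hD : 0 ≤ D)
    (hφ : ContinuousOn φ (Ici 0)) {t : ℝ} (ht : 0 < t) :
    HasDerivAt (predictor sys R N₀ D X u) (matCLM (matA R N₀) (predictor sys R N₀ D X u t)
      + modalFlow R N₀ (-D) (matCLM (matB sys R N₀) (u t))
      + modes R N₀ (f₂ (x t, X t, v t))) t := by
  have hũ := h.continuous_indicator hD hφ
  have hg : Continuous (pulledInput sys R N₀ u) := by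
    rw [← continuousOn_univ]
    exact continuousOn_diagFlow _ continuous_neg
      ((matCLM (matB sys R N₀)).continuous.comp hũ).continuousOn
  have hG : ∀ s, HasDerivAt (fun r => ∫ s in (0 : ℝ)..r, pulledInput sys R N₀ u s)
      (pulledInput sys R N₀ u s) s := fun s => (hg.integral_hasStrictDerivAt 0 s).hasDerivAt
  have hGD : HasDerivAt (fun r => ∫ s in (0 : ℝ)..(r - D), pulledInput sys R N₀ u s)
      (pulledInput sys R N₀ u (t - D)) t := by
    have := (hG (t - D)).comp_sub_const t D
    exact this
  set J := fun r => (∫ s in (0 : ℝ)..r, pulledInput sys R N₀ u s)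
    - ∫ s in (0 : ℝ)..(r - D), pulledInput sys R N₀ u s
  have hflow : HasDerivAt (fun r => modalFlow R N₀ (r - D) (J r))
      (matCLM (matA R N₀) (modalFlow R N₀ (t - D) (J t))
        + modalFlow R N₀ (t - D) (pulledInput sys R N₀ u t - pulledInput sys R N₀ u (t - D))) t := by
    have h1 : HasDerivAt (fun r => modalFlow R N₀ r (J (r + D)))
        (matCLM (matA R N₀) (modalFlow R N₀ (t - D) (J (t - D + D)))
          + modalFlow R N₀ (t - D)
            (pulledInput sys R N₀ u t - pulledInput sys R N₀ u (t - D))) (t - D) := by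
      refine hasDerivAt_diagFlow (fun i : Fin N₀ => R.lam i) ?_
      refine HasDerivAt.comp_add_const (t - D) D ?_
      rw [sub_add_cancel]
      exact (hG t).sub hGD
    have h2 := h1.comp_sub_const t D
    simpa only [sub_add_cancel] using h2
  have hX : HasDerivAt (fun r => modes R N₀ (X r))
      (modes R N₀ (sys.A ⟨X t, h.X_mem t ht.le⟩ + f₂ (x t, X t, v t))) t :=
    ((modesCLM R N₀).restrictScalars ℝ).hasFDerivAt.comp_hasDerivAt t (h.X_hasDerivAt ht)
  have hsum := (hX.add hflow).congr_of_eventuallyEq (f₁ := predictor sys R N₀ D X u)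
    (by filter_upwards [Ioi_mem_nhds ht] with r hr using h.predictor_eq hD (mem_Ioi.1 hr).le)
  refine hsum.congr_deriv ?_
  -- For `t < D` both sides are 0, because the control is zero on `[-D, 0]`.
  have hdelay : (Ici (0 : ℝ)).indicator u (t - D) = u (t - D) := by
    rcases le_or_gt 0 (t - D) with h0 | h0
    · exact indicator_of_mem (mem_Ici.2 h0) _
    · rw [indicator_of_notMem (by simpa using h0), h.u_zero _ ⟨by linarith, h0.le⟩]
  have e1 : modalFlow R N₀ (t - D) (pulledInput sys R N₀ u t)
      = modalFlow R N₀ (-D) (matCLM (matB sys R N₀) (u t)) := by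
    rw [pulledInput, modalFlow, ← diagFlow_add, indicator_of_mem (mem_Ici.2 ht.le)]
    congr 2; ring
  have e2 : modalFlow R N₀ (t - D) (pulledInput sys R N₀ u (t - D))
      = matCLM (matB sys R N₀) (u (t - D)) := by
    rw [pulledInput, modalFlow, ← diagFlow_add, hdelay, add_neg_cancel, diagFlow_zero]
  have e3 := modes_apply_of_boundary sys R N₀ ⟨X t, h.X_mem t ht.le⟩ (h.boundary t ht.le)
  have e4 : modalFlow R N₀ (t - D) (pulledInput sys R N₀ u t - pulledInput sys R N₀ u (t - D))
      = modalFlow R N₀ (-D) (matCLM (matB sys R N₀) (u t)) - matCLM (matB sys R N₀) (u (t - D)) := by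
    rw [map_sub, e1, e2]
  rw [e4, ← modesCLM_apply, map_add, modesCLM_apply, modesCLM_apply, e3,
    h.predictor_eq hD ht.le, map_add]
  abel

/-- In the integrand `u = φ K Z` with `0 ≤ φ ≤ 1`, and the flow time `t - s - D` lies in `[-D, 0]`.
-/
theorem IsClassicalSolution.norm_predictor_sub_modes_le
    (h : IsClassicalSolution sys R D φ K f₁ f₂ x₀ X₀ v x X u) (hD : 0 ≤ D)
    (hφ : IsTransitionSignal D t₀ φ) {t : ℝ} (ht : 0 ≤ t) :
    ‖predictor sys R N₀ D X u t - modes R N₀ (X t)‖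
      ≤ Real.exp (D * matNorm (matA R N₀)) * matNorm (matB sys R N₀ * K)
        * ∫ s in (max (t - D) 0)..t, ‖predictor sys R N₀ D X u s‖ := by
  have hle : max (t - D) 0 ≤ t := max_le (by linarith) ht
  rw [predictor, add_sub_cancel_left, ← intervalIntegral.integral_const_mul]
  refine intervalIntegral.norm_integral_le_of_norm_le hle (Eventually.of_forall fun s hs => ?_) ?_
  · have hs0 : 0 ≤ s := (le_max_right _ _).trans hs.1.le
    have hsD : t - D ≤ s := (le_max_left _ _).trans hs.1.le
    rw [matCLM_exp_matA_mul, h.u_eq_predictor hs0]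
    have e1 : matCLM (matB sys R N₀) (φ s • matCLM K (predictor sys R N₀ D X u s))
        = (φ s : 𝕜) • matCLM (matB sys R N₀ * K) (predictor sys R N₀ D X u s) := by
      rw [matCLM_mul, ← ContinuousLinearMap.map_smul]
      congr 1
      ext i
      simp [RCLike.real_smul_eq_coe_mul]
    rw [e1, map_smul, norm_smul, RCLike.norm_ofReal]
    have e2 : |φ s| ≤ 1 := abs_le.2 ⟨by linarith [hφ.nonneg s (by linarith)],
      hφ.le_one s (by linarith)⟩
    have e3 : |t - s - D| ≤ D := abs_le.2 ⟨by linarith [hs.2], by linarith [hs.2]⟩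
    calc _ ≤ 1 * ‖modalFlow R N₀ (t - s - D)
            (matCLM (matB sys R N₀ * K) (predictor sys R N₀ D X u s))‖ := by gcongr
      _ ≤ Real.exp (|t - s - D| * matNorm (matA R N₀))
            * ‖matCLM (matB sys R N₀ * K) (predictor sys R N₀ D X u s)‖ := by
          rw [one_mul]; exact norm_diagFlow_le _ _ _
      _ ≤ Real.exp (D * matNorm (matA R N₀))
            * (matNorm (matB sys R N₀ * K) * ‖predictor sys R N₀ D X u s‖) := by
          gcongr
          · exact norm_nonneg _
          · exact norm_matCLM_le _ _
      _ = _ := by ring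
  · refine ContinuousOn.intervalIntegrable ?_
    rw [uIcc_of_le hle]
    refine continuousOn_const.mul ((h.continuousOn_predictor hD).mono fun s hs => ?_).norm
    exact (le_max_right _ _).trans hs.1

end Predictor

/-! ### Scalar comparison and square inequalities -/

section RealAnalysis

/-- The function `e^{2κs} V - C / (2(κ - δ)) e^{2(κ - δ)s}` is nonincreasing. The forcing decays at
the slower rate `δ`, so `V` inherits that rate and the gap `κ - δ` enters the gain. -/
theorem exp_mul_le_of_deriv_le {V : ℝ → ℝ} {T t₁ κ δ C : ℝ} (hδ : δ < κ) (hC : 0 ≤ C)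
    (hV0 : 0 ≤ V T)
    (hV : ∀ t ∈ Icc T t₁, ∃ V', HasDerivAt V V' t ∧
      V' ≤ -(2 * κ) * V t + C * Real.exp (-(2 * δ) * t)) :
    ∀ t ∈ Icc T t₁, Real.exp (2 * δ * t) * V t
      ≤ Real.exp (2 * δ * T) * V T + C / (2 * (κ - δ)) := by
  intro t ht
  have hpos : 0 < 2 * (κ - δ) := by linarith
  have hne : κ - δ ≠ 0 := (sub_pos.2 hδ).ne'
  set W : ℝ → ℝ := fun s => Real.exp (2 * κ * s) * V s
    - C / (2 * (κ - δ)) * Real.exp (2 * (κ - δ) * s) with hW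
  have hder : ∀ s ∈ Icc T t₁, ∃ W', HasDerivAt W W' s ∧ W' ≤ 0 := by
    intro s hs
    obtain ⟨V', hd, hle⟩ := hV s hs
    have h1 : HasDerivAt (fun s => Real.exp (2 * κ * s)) (Real.exp (2 * κ * s) * (2 * κ)) s := by
      simpa using ((hasDerivAt_id s).const_mul (2 * κ)).exp
    have h2 : HasDerivAt (fun s => Real.exp (2 * (κ - δ) * s))
        (Real.exp (2 * (κ - δ) * s) * (2 * (κ - δ))) s := by
      simpa using ((hasDerivAt_id s).const_mul (2 * (κ - δ))).exp
    refine ⟨_, (h1.mul hd).sub (h2.const_mul (C / (2 * (κ - δ)))), ?_⟩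
    have h3 : Real.exp (2 * (κ - δ) * s) = Real.exp (2 * κ * s) * Real.exp (-(2 * δ) * s) := by
      rw [← Real.exp_add]; ring_nf
    have h4 : C / (2 * (κ - δ)) * (Real.exp (2 * (κ - δ) * s) * (2 * (κ - δ)))
        = Real.exp (2 * κ * s) * (C * Real.exp (-(2 * δ) * s)) := by
      rw [h3]; field_simp
    have h5 := mul_le_mul_of_nonneg_left hle (Real.exp_pos (2 * κ * s)).le
    rw [h4]
    linarith
  have hanti : AntitoneOn W (Icc T t₁) := by
    refine antitoneOn_of_deriv_nonpos (convex_Icc _ _) ?_ ?_ ?_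
    · intro s hs
      obtain ⟨W', hd, -⟩ := hder s hs
      exact hd.continuousAt.continuousWithinAt
    · intro s hs
      obtain ⟨W', hd, -⟩ := hder s (interior_subset hs)
      exact hd.differentiableAt.differentiableWithinAt
    · intro s hs
      obtain ⟨W', hd, hle⟩ := hder s (interior_subset hs)
      rw [hd.deriv]; exact hle
  have h := hanti ⟨le_rfl, ht.1.trans ht.2⟩ ht ht.1
  simp only [hW] at h
  have h0 : 0 ≤ C / (2 * (κ - δ)) * Real.exp (2 * (κ - δ) * T) := by positivity
  have h1 : Real.exp (2 * κ * t) * V t ≤ Real.exp (2 * κ * T) * V T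
      + C / (2 * (κ - δ)) * Real.exp (2 * (κ - δ) * t) := by linarith
  have h2 := mul_le_mul_of_nonneg_left h1 (Real.exp_pos (-(2 * (κ - δ)) * t)).le
  have e1 : Real.exp (-(2 * (κ - δ)) * t) * (Real.exp (2 * κ * t) * V t)
      = Real.exp (2 * δ * t) * V t := by
    rw [← mul_assoc, ← Real.exp_add]; ring_nf
  have e2 : Real.exp (-(2 * (κ - δ)) * t) * Real.exp (2 * (κ - δ) * t) = 1 := by
    rw [← Real.exp_add]; simp
  have e3 : Real.exp (-(2 * (κ - δ)) * t) * Real.exp (2 * κ * T) ≤ Real.exp (2 * δ * T) := by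
    rw [← Real.exp_add]
    refine Real.exp_le_exp.2 ?_
    nlinarith [mul_le_mul_of_nonneg_left ht.1 hpos.le]
  rw [e1] at h2
  calc _ ≤ _ := h2
    _ = Real.exp (-(2 * (κ - δ)) * t) * Real.exp (2 * κ * T) * V T + C / (2 * (κ - δ))
        * (Real.exp (-(2 * (κ - δ)) * t) * Real.exp (2 * (κ - δ) * t)) := by ring
    _ ≤ _ := by rw [e2, mul_one]; gcongr

/-- The integral of the squared deviation of `f` from its mean is nonnegative. -/
theorem sq_integral_le {f : ℝ → ℝ} (hf : Continuous f) {a b : ℝ} (hab : a < b) :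
    (∫ s in a..b, f s) ^ 2 ≤ (b - a) * ∫ s in a..b, f s ^ 2 := by
  set I := ∫ s in a..b, f s
  have hpos : 0 < b - a := sub_pos.2 hab
  have h1 : 0 ≤ ∫ s in a..b, (f s - I / (b - a)) ^ 2 :=
    intervalIntegral.integral_nonneg hab.le fun s _ => sq_nonneg _
  have h2 : ∫ s in a..b, (f s - I / (b - a)) ^ 2
      = (∫ s in a..b, f s ^ 2) - 2 * (I / (b - a)) * I + (I / (b - a)) ^ 2 * (b - a) := by
    have e1 : ∀ s, (f s - I / (b - a)) ^ 2
        = f s ^ 2 - 2 * (I / (b - a)) * f s + (I / (b - a)) ^ 2 := fun s => by ring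
    simp only [e1]
    rw [intervalIntegral.integral_add, intervalIntegral.integral_sub,
      intervalIntegral.integral_const_mul, intervalIntegral.integral_const, smul_eq_mul]
    · ring
    all_goals exact Continuous.intervalIntegrable (by fun_prop) _ _
  rw [h2] at h1
  have h3 : (∫ s in a..b, f s ^ 2) - 2 * (I / (b - a)) * I + (I / (b - a)) ^ 2 * (b - a)
      = (∫ s in a..b, f s ^ 2) - I ^ 2 / (b - a) := by field_simp; ring
  rw [h3, sub_nonneg, div_le_iff₀ hpos] at h1
  linarith

theorem hasDerivAt_norm_sq_rclike {𝕜 : Type*} [RCLike 𝕜] {f : ℝ → 𝕜} {f' : 𝕜} {t : ℝ}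
    (hf : HasDerivAt f f' t) :
    HasDerivAt (fun s => ‖f s‖ ^ 2) (2 * RCLike.re (inner 𝕜 (f t) f')) t := by
  have h := (RCLike.reCLM (K := 𝕜)).hasFDerivAt.comp_hasDerivAt t (hf.inner 𝕜 hf)
  refine (h.congr_deriv ?_).congr_of_eventuallyEq (Eventually.of_forall fun s => ?_)
  · simp only [RCLike.reCLM_apply, map_add]
    rw [inner_re_symm (𝕜 := 𝕜) f' (f t)]; ring
  · simp only [Function.comp_apply, RCLike.reCLM_apply, inner_self_eq_norm_sq]

/-- Half of the decay `α` is spent on completing the square with the forcing `a`. -/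
theorem re_inner_mul_add_le {𝕜 : Type*} [RCLike 𝕜] {μ w a : 𝕜} {α : ℝ} (hα : 0 < α)
    (hμ : RCLike.re μ ≤ -α) :
    RCLike.re (inner 𝕜 w (μ * w + a)) ≤ -(α / 2) * ‖w‖ ^ 2 + 1 / (2 * α) * ‖a‖ ^ 2 := by
  have h1 : RCLike.re (inner 𝕜 w (μ * w)) = RCLike.re μ * ‖w‖ ^ 2 := by
    have : inner 𝕜 w (μ * w) = μ * (inner 𝕜 w w : 𝕜) := by
      rw [← smul_eq_mul μ w, inner_smul_right]
    rw [this, inner_self_eq_norm_sq_to_K, ← RCLike.ofReal_pow, RCLike.re_mul_ofReal]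
  have h2 : RCLike.re (inner 𝕜 w a) ≤ ‖w‖ * ‖a‖ := re_inner_le_norm w a
  have h3 : ‖w‖ * ‖a‖ ≤ α / 2 * ‖w‖ ^ 2 + 1 / (2 * α) * ‖a‖ ^ 2 := by
    have e : α / 2 * ‖w‖ ^ 2 + 1 / (2 * α) * ‖a‖ ^ 2 - ‖w‖ * ‖a‖
        = (α * ‖w‖ - ‖a‖) ^ 2 / (2 * α) := by field_simp; ring
    have : 0 ≤ (α * ‖w‖ - ‖a‖) ^ 2 / (2 * α) := by positivity
    linarith
  have h4 := mul_le_mul_of_nonneg_right hμ (sq_nonneg ‖w‖)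
  rw [inner_add_right, map_add, h1]
  linarith

theorem norm_add_add_sub_sub_sq_le {E : Type*} [NormedAddCommGroup E] (a b c d : E) :
    ‖a + b - (c + d)‖ ^ 2 ≤ 4 * (‖a‖ ^ 2 + ‖b‖ ^ 2 + ‖c‖ ^ 2 + ‖d‖ ^ 2) := by
  have h : ‖a + b - (c + d)‖ ≤ ‖a‖ + ‖b‖ + (‖c‖ + ‖d‖) :=
    (norm_sub_le _ _).trans (add_le_add (norm_add_le _ _) (norm_add_le _ _))
  have h2 : ‖a + b - (c + d)‖ ^ 2 ≤ (‖a‖ + ‖b‖ + (‖c‖ + ‖d‖)) ^ 2 := by gcongr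
  nlinarith [sq_nonneg (‖a‖ - ‖b‖), sq_nonneg (‖a‖ - ‖c‖), sq_nonneg (‖a‖ - ‖d‖),
    sq_nonneg (‖b‖ - ‖c‖), sq_nonneg (‖b‖ - ‖d‖), sq_nonneg (‖c‖ - ‖d‖)]

end RealAnalysis

/-! ### The closed loop after the feedback is switched on -/

section Target

variable {𝕜 : Type*} [RCLike 𝕜] {H : Type*} [NormedAddCommGroup H] [InnerProductSpace 𝕜 H]
  [NormedSpace ℝ H] {m n mv N₀ : ℕ}

/-- The closed loop in the coordinates given by the predictor state `Z` and by the modes of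
`X - B K Z(· - D)`, once the feedback is fully switched on. -/
structure IsTargetSystem (sys : BoundaryControlSystem 𝕜 H m) (R : RieszSpectral sys.A0) (D t₀ : ℝ)
    (K : Matrix (Fin m) (Fin N₀) 𝕜) (X : ℝ → H) (Z : ℝ → Euc 𝕜 N₀) (F : ℝ → H) : Prop where
  continuous_Z : Continuous Z
  deriv_Z : ∀ t, t₀ ≤ t →
    HasDerivAt Z (matCLM (matAcl sys R D K) (Z t) + modes R N₀ (F t)) t
  deriv_mode : ∀ k t, D + t₀ ≤ t →
    HasDerivAt (fun s => (inner 𝕜 (R.psi k) (X s - sys.B (matCLM K (Z (s - D)))) : 𝕜))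
      (R.lam k * inner 𝕜 (R.psi k) (X t - sys.B (matCLM K (Z (t - D))))
        + inner 𝕜 (R.psi k) (F t + sys.AB (matCLM K (Z (t - D)))
          - (sys.B (matCLM K (matCLM (matAcl sys R D K) (Z (t - D))))
            + sys.B (matCLM K (modes R N₀ (F (t - D))))))) t
  norm_modes_le : ∀ t, D + t₀ ≤ t → ‖modes R N₀ (X t)‖ ≤ ‖Z t‖
    + Real.exp (D * matNorm (matA R N₀)) * matNorm (matB sys R N₀ * K)
      * ∫ s in (t - D)..t, ‖Z s‖

variable {sys : BoundaryControlSystem 𝕜 H m} {R : RieszSpectral sys.A0}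
    {D t₀ : ℝ} {φ : ℝ → ℝ} {K : Matrix (Fin m) (Fin N₀) 𝕜}
    {f₁ : Euc 𝕜 n × H × Euc 𝕜 mv → Euc 𝕜 n} {f₂ : Euc 𝕜 n × H × Euc 𝕜 mv → H}
    {x₀ : Euc 𝕜 n} {X₀ : H} {v : ℝ → Euc 𝕜 mv}
    {x : ℝ → Euc 𝕜 n} {X : ℝ → H} {u : ℝ → Euc 𝕜 m}

/-- For `t ≥ D + t₀` the boundary value is `u(t - D) = K Z(t - D)`, so the lifting subtracted from
`X` removes it exactly. The price is the derivative of `B K Z(· - D)`, which brings in `A_cl Z(t -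
D)` and the modes of `F(t - D)`. Freezing the predictor at its value at 0 for negative times makes
`Z` continuous on the whole line. -/
theorem IsClassicalSolution.isTargetSystem [CompleteSpace H] [IsScalarTower ℝ 𝕜 H]
    (h : IsClassicalSolution sys R D φ K f₁ f₂ x₀ X₀ v x X u) (hD : 0 < D) (ht₀ : 0 < t₀)
    (hφ : IsTransitionSignal D t₀ φ) :
    IsTargetSystem sys R D t₀ K X (fun t => predictor sys R N₀ D X u (max t 0))
      (fun t => f₂ (x t, X t, v t)) := by
  have hφc : ContinuousOn φ (Ici 0) :=
    hφ.contDiff.continuousOn.mono (Ici_subset_Ici.2 (by linarith))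
  have hmax : ∀ t, 0 ≤ t → predictor sys R N₀ D X u (max t 0) = predictor sys R N₀ D X u t :=
    fun t ht => by rw [max_eq_left ht]
  have hu : ∀ t, t₀ ≤ t → u t = matCLM K (predictor sys R N₀ D X u t) := fun t ht => by
    rw [h.u_eq_predictor (ht₀.le.trans ht), hφ.eq_one t ht, one_smul]
  have hZ : ∀ t, t₀ ≤ t → HasDerivAt (fun t => predictor sys R N₀ D X u (max t 0))
      (matCLM (matAcl sys R D K) (predictor sys R N₀ D X u (max t 0))
        + modes R N₀ (f₂ (x t, X t, v t))) t := by
    intro t ht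
    have ht' : 0 < t := ht₀.trans_le ht
    have h1 := (h.hasDerivAt_predictor hD.le hφc ht').congr_of_eventuallyEq
      (f₁ := fun t => predictor sys R N₀ D X u (max t 0))
      (by filter_upwards [Ioi_mem_nhds ht'] with r hr using hmax r (mem_Ioi.1 hr).le)
    refine h1.congr_deriv ?_
    rw [hmax t ht'.le, hu t ht, matAcl, matCLM_add, matCLM_mul, matCLM_exp_matA_mul]
  refine ⟨?_, hZ, ?_, ?_⟩
  · exact (h.continuousOn_predictor hD.le).comp_continuous (by fun_prop)
      fun t => mem_Ici.2 (le_max_right _ _)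
  · intro k t ht
    have ht' : 0 < t := by linarith
    have htD : t₀ ≤ t - D := by linarith
    have h1 := (hZ (t - D) htD).comp_sub_const t D
    have h2 : HasDerivAt
        (fun s => sys.B (matCLM K (predictor sys R N₀ D X u (max (s - D) 0)))) _ t :=
      ((sys.B.comp (matCLM K)).restrictScalars ℝ).hasFDerivAt.comp_hasDerivAt t h1
    have h3 := ((innerSL 𝕜 (R.psi k)).restrictScalars ℝ).hasFDerivAt.comp_hasDerivAt t
      ((h.X_hasDerivAt ht').sub h2)
    refine h3.congr_deriv ?_
    have h4 := inner_psi_apply_of_boundary sys R k ⟨X t, h.X_mem t ht'.le⟩ (h.boundary t ht'.le)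
    rw [hu _ htD, ← hmax (t - D) (by linarith)] at h4
    simp only [ContinuousLinearMap.coe_restrictScalars', ContinuousLinearMap.comp_apply,
      innerSL_apply_apply, inner_sub_right, inner_add_right, map_add] at h4 ⊢
    rw [h4]
    ring
  · intro t ht
    have ht' : 0 ≤ t := by linarith
    have h1 := h.norm_predictor_sub_modes_le hD.le hφ ht'
    rw [max_eq_left (by linarith : 0 ≤ t - D)] at h1
    have h2 : ∫ s in (t - D)..t, ‖predictor sys R N₀ D X u (max s 0)‖
        = ∫ s in (t - D)..t, ‖predictor sys R N₀ D X u s‖ := by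
      refine intervalIntegral.integral_congr fun s hs => ?_
      rw [uIcc_of_le (by linarith)] at hs
      simp only [hmax s (by linarith [hs.1])]
    rw [h2, hmax t ht']
    have h3 := norm_sub_norm_le (modes R N₀ (X t)) (predictor sys R N₀ D X u t)
    rw [norm_sub_rev] at h3
    linarith

end Target

/-! ### The truncated Lyapunov functional: bounds from below and above -/

section Lyapunov

variable {𝕜 : Type*} [RCLike 𝕜] {H : Type*} [NormedAddCommGroup H] [InnerProductSpace 𝕜 H]
  [NormedSpace ℝ H] {m N₀ : ℕ}

/-- The `k`-th coefficient of `X - B K Z(· - D)`. -/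
noncomputable def shiftedMode (sys : BoundaryControlSystem 𝕜 H m) (R : RieszSpectral sys.A0) (D : ℝ)
    (K : Matrix (Fin m) (Fin N₀) 𝕜) (X : ℝ → H) (Z : ℝ → Euc 𝕜 N₀) (k : ℕ) (t : ℝ) : 𝕜 :=
  inner 𝕜 (R.psi k) (X t - sys.B (matCLM K (Z (t - D))))

/-- The Lyapunov functional, truncated to finitely many modes. -/
noncomputable def lyapunov (sys : BoundaryControlSystem 𝕜 H m) (R : RieszSpectral sys.A0) (D : ℝ)
    (K : Matrix (Fin m) (Fin N₀) 𝕜) (P : Matrix (Fin N₀) (Fin N₀) 𝕜) (γ₁ γ₂ : ℝ)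
    (X : ℝ → H) (Z : ℝ → Euc 𝕜 N₀) (N : ℕ) (t : ℝ) : ℝ :=
  γ₁ * (quadForm P (Z t) + ∫ s in (t - D)..t, quadForm P (Z s)) + γ₂ * quadForm P (Z (t - D))
    + 1 / 2 * ∑ k ∈ Finset.Ico N₀ N, ‖shiftedMode sys R D K X Z k t‖ ^ 2

/-- The standing relations between the free parameters of the Lyapunov functional. -/
structure LyapunovData (sys : BoundaryControlSystem 𝕜 H m) (R : RieszSpectral sys.A0) (α D : ℝ)
    (K : Matrix (Fin m) (Fin N₀) 𝕜) (P : Matrix (Fin N₀) (Fin N₀) 𝕜) (β γ₁ γ₂ : ℝ) : Prop where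
  D_pos : 0 < D
  N₀_pos : 1 ≤ N₀
  α_pos : 0 < α
  stable : ∀ k, N₀ ≤ k → RCLike.re (R.lam k) ≤ -α
  posDef : P.PosDef
  lyapunov_eq : (matAcl sys R D K)ᴴ * P + P * matAcl sys R D K = -1
  β_mem : β ∈ Set.Ioo (0 : ℝ) 1
  γ₁_gt : constC1 sys R D K / lamMin P < γ₁
  γ₂_gt : max (normBK sys K ^ 2 / (R.mR * lamMin P)) (constC5 sys R α D K / (1 - β)) < γ₂

variable {sys : BoundaryControlSystem 𝕜 H m} {R : RieszSpectral sys.A0} {α D t₀ : ℝ}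
    {K : Matrix (Fin m) (Fin N₀) 𝕜} {P : Matrix (Fin N₀) (Fin N₀) 𝕜} {β γ₁ γ₂ : ℝ}
    {X : ℝ → H} {Z : ℝ → Euc 𝕜 N₀} {F : ℝ → H}

theorem norm_B_matCLM_le (z : Euc 𝕜 N₀) : ‖sys.B (matCLM K z)‖ ≤ normBK sys K * ‖z‖ :=
  (sys.B.comp (matCLM K)).le_opNorm z

theorem normBK_nonneg : 0 ≤ normBK sys K := norm_nonneg _

namespace LyapunovData

theorem lamMin_pos (h : LyapunovData sys R α D K P β γ₁ γ₂) : 0 < lamMin P := by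
  have : NeZero N₀ := ⟨by have := h.N₀_pos; omega⟩
  exact _root_.lamMin_pos h.posDef

theorem lamMax_pos (h : LyapunovData sys R α D K P β γ₁ γ₂) : 0 < lamMax P := by
  have : NeZero N₀ := ⟨by have := h.N₀_pos; omega⟩
  exact _root_.lamMax_pos h.posDef

theorem constC1_lt (h : LyapunovData sys R α D K P β γ₁ γ₂) :
    constC1 sys R D K < γ₁ * lamMin P := (div_lt_iff₀ h.lamMin_pos).1 h.γ₁_gt

theorem two_le_constC1 : 2 ≤ constC1 sys R D K := by
  unfold constC1
  linarith [le_max_left (1 : ℝ)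
    (D * Real.exp (2 * D * matNorm (matA R N₀)) * matNorm (matB sys R N₀ * K) ^ 2)]

theorem γ₁_pos (h : LyapunovData sys R α D K P β γ₁ γ₂) : 0 < γ₁ := by
  refine (div_nonneg ?_ h.lamMin_pos.le).trans_lt h.γ₁_gt
  linarith [two_le_constC1 (sys := sys) (R := R) (D := D) (K := K)]

theorem γ₂_pos (h : LyapunovData sys R α D K P β γ₁ γ₂) : 0 < γ₂ := by
  refine lt_of_le_of_lt ?_ h.γ₂_gt
  have := R.mR_pos
  have := h.lamMin_pos
  exact le_max_of_le_left (by positivity)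

theorem constC3_pos (h : LyapunovData sys R α D K P β γ₁ γ₂) : 0 < constC3 sys R K P γ₂ := by
  have h1 := (le_max_left _ _).trans_lt h.γ₂_gt
  have h2 := R.mR_pos
  have h3 := h.lamMin_pos
  rw [div_lt_iff₀ (by positivity)] at h1
  rw [constC3, sub_pos, div_lt_iff₀ h2]
  linarith

theorem constC5_lt (h : LyapunovData sys R α D K P β γ₁ γ₂) :
    constC5 sys R α D K / γ₂ < 1 - β := by
  have h1 := (le_max_right _ _).trans_lt h.γ₂_gt
  have h2 : 0 < 1 - β := by linarith [h.β_mem.2]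
  rw [div_lt_iff₀ h2] at h1
  rw [div_lt_iff₀ h.γ₂_pos]
  linarith

theorem constC6_nonneg (h : LyapunovData sys R α D K P β γ₁ γ₂) :
    0 ≤ constC6 sys R α D K P β γ₁ γ₂ := by
  have := R.mR_pos
  have := h.α_pos
  have := h.γ₁_pos
  have := h.γ₂_pos
  have := h.D_pos
  have := h.β_mem.1
  unfold constC6
  positivity

theorem constC4_pos (_ : LyapunovData sys R α D K P β γ₁ γ₂) : 0 < constC4 sys R K P γ₂ := by
  have := R.MR_pos
  have := normBK_nonneg (sys := sys) (K := K)
  unfold constC4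
  positivity

theorem constKappa_pos (h : LyapunovData sys R α D K P β γ₁ γ₂) :
    0 < constKappa sys R α D K P β γ₂ := by
  have h1 : 0 < 1 - β := by linarith [h.β_mem.2]
  have h2 : 0 < 1 - β - constC5 sys R α D K / γ₂ := by linarith [h.constC5_lt]
  have h3 := h.lamMax_pos
  have h4 := h.α_pos
  unfold constKappa
  positivity

theorem kappa_lamMax_le (h : LyapunovData sys R α D K P β γ₁ γ₂) :
    2 * constKappa sys R α D K P β γ₂ * lamMax P ≤ 1 - β := by
  have h1 : 2 * constKappa sys R α D K P β γ₂ ≤ (1 - β) / lamMax P := by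
    unfold constKappa
    linarith [min_le_left ((1 - β) / lamMax P)
      (min ((1 - β - constC5 sys R α D K / γ₂) / lamMax P) (α / 2))]
  exact (le_div_iff₀ h.lamMax_pos).1 h1

theorem kappa_lamMax_le' (h : LyapunovData sys R α D K P β γ₁ γ₂) :
    2 * constKappa sys R α D K P β γ₂ * lamMax P ≤ 1 - β - constC5 sys R α D K / γ₂ := by
  have h1 : 2 * constKappa sys R α D K P β γ₂
      ≤ (1 - β - constC5 sys R α D K / γ₂) / lamMax P := by
    unfold constKappa
    linarith [(min_le_right ((1 - β) / lamMax P)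
      (min ((1 - β - constC5 sys R α D K / γ₂) / lamMax P) (α / 2))).trans (min_le_left _ _)]
  exact (le_div_iff₀ h.lamMax_pos).1 h1

theorem kappa_le (_ : LyapunovData sys R α D K P β γ₁ γ₂) :
    2 * constKappa sys R α D K P β γ₂ ≤ α / 2 := by
  unfold constKappa
  linarith [(min_le_right ((1 - β) / lamMax P)
    (min ((1 - β - constC5 sys R α D K / γ₂) / lamMax P) (α / 2))).trans (min_le_right _ _)]

theorem quadForm_nonneg (h : LyapunovData sys R α D K P β γ₁ γ₂) (z : Euc 𝕜 N₀) :
    0 ≤ quadForm P z :=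
  (mul_nonneg h.lamMin_pos.le (sq_nonneg _)).trans (lamMin_mul_le_quadForm h.posDef.1 z)

theorem integral_quadForm_nonneg (h : LyapunovData sys R α D K P β γ₁ γ₂) (t : ℝ) :
    0 ≤ ∫ s in (t - D)..t, quadForm P (Z s) :=
  intervalIntegral.integral_nonneg (by linarith [h.D_pos]) fun _ _ => h.quadForm_nonneg _

theorem lyapunov_nonneg (h : LyapunovData sys R α D K P β γ₁ γ₂) (N : ℕ) (t : ℝ) :
    0 ≤ lyapunov sys R D K P γ₁ γ₂ X Z N t := by
  have h1 := h.γ₁_pos.le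
  have h2 := h.γ₂_pos.le
  have h3 := h.quadForm_nonneg (Z t)
  have h4 := h.quadForm_nonneg (Z (t - D))
  have h5 := h.integral_quadForm_nonneg (Z := Z) t
  unfold lyapunov
  positivity

theorem norm_sq_le_lyapunov (h : LyapunovData sys R α D K P β γ₁ γ₂) (N : ℕ) (t : ℝ) :
    γ₁ * lamMin P * ‖Z t‖ ^ 2 ≤ lyapunov sys R D K P γ₁ γ₂ X Z N t := by
  have h1 := h.γ₁_pos.le
  have h2 := h.γ₂_pos.le
  have h3 := mul_le_mul_of_nonneg_left (lamMin_mul_le_quadForm h.posDef.1 (Z t)) h1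
  have h4 := mul_nonneg h2 (h.quadForm_nonneg (Z (t - D)))
  have h5 := mul_nonneg h1 (h.integral_quadForm_nonneg (Z := Z) t)
  have h6 : 0 ≤ 1 / 2 * ∑ k ∈ Finset.Ico N₀ N, ‖shiftedMode sys R D K X Z k t‖ ^ 2 := by positivity
  unfold lyapunov
  linarith

end LyapunovData

/-- Square `‖Y‖ ≤ ‖Z‖ + c ∫ ‖Z‖` and apply Cauchy–Schwarz over a window of length `D`: both
coefficients are at most `C₁`, and `C₁ < γ₁ λ_m(P)`. -/
theorem IsTargetSystem.norm_modes_sq_le (hT : IsTargetSystem sys R D t₀ K X Z F)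
    (h : LyapunovData sys R α D K P β γ₁ γ₂) {t : ℝ} (ht : D + t₀ ≤ t) :
    ‖modes R N₀ (X t)‖ ^ 2
      ≤ γ₁ * (quadForm P (Z t) + ∫ s in (t - D)..t, quadForm P (Z s)) := by
  have hD := h.D_pos
  set c := Real.exp (D * matNorm (matA R N₀)) * matNorm (matB sys R N₀ * K) with hc
  have hc0 : 0 ≤ c := mul_nonneg (Real.exp_pos _).le (norm_nonneg _)
  have hI0 : 0 ≤ ∫ s in (t - D)..t, ‖Z s‖ :=
    intervalIntegral.integral_nonneg (by linarith) fun _ _ => norm_nonneg _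
  have h1 : ‖modes R N₀ (X t)‖ ^ 2 ≤ (‖Z t‖ + c * ∫ s in (t - D)..t, ‖Z s‖) ^ 2 :=
    pow_le_pow_left₀ (norm_nonneg _) (hT.norm_modes_le t ht) 2
  have h2 := sq_integral_le hT.continuous_Z.norm (by linarith : t - D < t)
  rw [sub_sub_cancel] at h2
  have h3 : 0 ≤ ∫ s in (t - D)..t, ‖Z s‖ ^ 2 :=
    intervalIntegral.integral_nonneg (by linarith) fun _ _ => sq_nonneg _
  have hC1 : 2 * (D * c ^ 2) ≤ constC1 sys R D K := by
    have e : D * c ^ 2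
        = D * Real.exp (2 * D * matNorm (matA R N₀)) * matNorm (matB sys R N₀ * K) ^ 2 := by
      rw [hc, mul_pow, ← Real.exp_nat_mul]
      push_cast
      ring_nf
    rw [e, constC1]
    gcongr
    exact le_max_right _ _
  have hint : lamMin P * (∫ s in (t - D)..t, ‖Z s‖ ^ 2) ≤ ∫ s in (t - D)..t, quadForm P (Z s) := by
    rw [← intervalIntegral.integral_const_mul]
    refine intervalIntegral.integral_mono_on (by linarith) ?_ ?_
      fun s _ => lamMin_mul_le_quadForm h.posDef.1 (Z s)
    · exact (continuous_const.mul (hT.continuous_Z.norm.pow 2)).intervalIntegrable _ _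
    · exact ((continuous_quadForm P).comp hT.continuous_Z).intervalIntegrable _ _
  have hq := lamMin_mul_le_quadForm h.posDef.1 (Z t)
  have hγ := h.γ₁_pos.le
  calc ‖modes R N₀ (X t)‖ ^ 2 ≤ (‖Z t‖ + c * ∫ s in (t - D)..t, ‖Z s‖) ^ 2 := h1
    _ ≤ 2 * ‖Z t‖ ^ 2 + 2 * c ^ 2 * (∫ s in (t - D)..t, ‖Z s‖) ^ 2 := by
        nlinarith [sq_nonneg (‖Z t‖ - c * ∫ s in (t - D)..t, ‖Z s‖)]
    _ ≤ 2 * ‖Z t‖ ^ 2 + 2 * c ^ 2 * (D * ∫ s in (t - D)..t, ‖Z s‖ ^ 2) := by gcongr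
    _ = 2 * ‖Z t‖ ^ 2 + 2 * (D * c ^ 2) * ∫ s in (t - D)..t, ‖Z s‖ ^ 2 := by ring
    _ ≤ constC1 sys R D K * ‖Z t‖ ^ 2 + constC1 sys R D K * ∫ s in (t - D)..t, ‖Z s‖ ^ 2 := by
        gcongr
        exact LyapunovData.two_le_constC1
    _ ≤ γ₁ * lamMin P * ‖Z t‖ ^ 2 + γ₁ * lamMin P * ∫ s in (t - D)..t, ‖Z s‖ ^ 2 := by
        gcongr <;> exact h.constC1_lt.le
    _ = γ₁ * (lamMin P * ‖Z t‖ ^ 2 + lamMin P * ∫ s in (t - D)..t, ‖Z s‖ ^ 2) := by ring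
    _ ≤ _ := by gcongr

/-- The state is controlled by a uniform bound on the truncated Lyapunov functionals. -/
theorem IsTargetSystem.norm_le_of_lyapunov_le (hT : IsTargetSystem sys R D t₀ K X Z F)
    (h : LyapunovData sys R α D K P β γ₁ γ₂) {t V : ℝ} (ht : D + t₀ ≤ t)
    (hV : ∀ N, lyapunov sys R D K P γ₁ γ₂ X Z N t ≤ V) :
    ‖X t‖ ≤ constC4 sys R K P γ₂ * √V := by
  have hmR := R.mR_pos
  have hMR := R.MR_pos
  have hV0 : 0 ≤ V := (h.lyapunov_nonneg 0 t).trans (hV 0)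
  have hC3 := h.constC3_pos
  set zD := Z (t - D) with hzD
  set w := X t - sys.B (matCLM K zD) with hw
  have hmod := hT.norm_modes_sq_le h ht
  have hq := mul_le_mul_of_nonneg_left (lamMin_mul_le_quadForm h.posDef.1 zD) h.γ₂_pos.le
  have hBK : ‖sys.B (matCLM K zD)‖ ^ 2 / R.mR ≤ normBK sys K ^ 2 / R.mR * ‖zD‖ ^ 2 := by
    rw [div_mul_eq_mul_div, ← mul_pow]
    gcongr
    exact norm_B_matCLM_le zD
  have hmodw : ‖modes R N₀ w‖ ^ 2
      ≤ 2 * ‖modes R N₀ (X t)‖ ^ 2 + 2 * (normBK sys K ^ 2 / R.mR * ‖zD‖ ^ 2) := by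
    have e1 : modes R N₀ w = modes R N₀ (X t) - modes R N₀ (sys.B (matCLM K zD)) := by
      simp only [← modesCLM_apply, hw, map_sub]
    have e2 := norm_sub_le (modes R N₀ (X t)) (modes R N₀ (sys.B (matCLM K zD)))
    have e3 := (R.norm_modes_sq_le N₀ (sys.B (matCLM K zD))).trans hBK
    rw [← e1] at e2
    have e4 := pow_le_pow_left₀ (norm_nonneg _) e2 2
    nlinarith [sq_nonneg (‖modes R N₀ (X t)‖ - ‖modes R N₀ (sys.B (matCLM K zD))‖)]
  -- The first `N₀` coefficients of `w` cost at most `2‖Y‖²` plus `2‖BK‖²/m_R ‖zD‖²`, covered by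
  -- twice the `γ₁` part and twice the `γ₂` part; the others are twice the modal part.
  have hsum : ∀ N, ∑ j ∈ Finset.range N, ‖(inner 𝕜 (R.psi j) w : 𝕜)‖ ^ 2 ≤ 2 * V := by
    intro N
    have e1 : ∑ j ∈ Finset.range N, ‖(inner 𝕜 (R.psi j) w : 𝕜)‖ ^ 2
        ≤ ∑ j ∈ Finset.range (max N₀ N), ‖(inner 𝕜 (R.psi j) w : 𝕜)‖ ^ 2 :=
      Finset.sum_le_sum_of_subset_of_nonneg (Finset.range_mono (le_max_right _ _))
        fun _ _ _ => sq_nonneg _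
    refine e1.trans ?_
    rw [← Finset.sum_range_add_sum_Ico _ (le_max_left N₀ N)]
    have e2 : ∑ j ∈ Finset.range N₀, ‖(inner 𝕜 (R.psi j) w : 𝕜)‖ ^ 2 = ‖modes R N₀ w‖ ^ 2 := by
      rw [← Fin.sum_univ_eq_sum_range (fun j => ‖(inner 𝕜 (R.psi j) w : 𝕜)‖ ^ 2),
        EuclideanSpace.norm_sq_eq]
      rfl
    have e3 := hV (max N₀ N)
    have e4 : 0 ≤ constC3 sys R K P γ₂ * ‖zD‖ ^ 2 := by positivity
    rw [constC3] at e4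
    simp only [lyapunov, shiftedMode, ← hzD, ← hw] at e3
    rw [e2]
    linarith
  have hw2 := R.norm_sq_le hsum
  have hwn : ‖w‖ ≤ √(2 * R.MR) * √V := by
    rw [← Real.sqrt_mul (by positivity)]
    exact Real.le_sqrt_of_sq_le (by linarith)
  -- The truncation `N = 0` has an empty modal sum, and `C₃ ≤ γ₂ λ_m(P)`.
  have hz : constC3 sys R K P γ₂ * ‖zD‖ ^ 2 ≤ V := by
    have e3 := hV 0
    have e5 : (0 : ℝ) ≤ normBK sys K ^ 2 / R.mR * ‖zD‖ ^ 2 := by positivity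
    have e6 : 0 ≤ γ₁ * (quadForm P (Z t) + ∫ s in (t - D)..t, quadForm P (Z s)) :=
      (sq_nonneg _).trans hmod
    simp only [lyapunov, ← hzD, Finset.Ico_eq_empty_of_le (Nat.zero_le N₀), Finset.sum_empty] at e3
    rw [constC3]
    linarith
  have hzn : ‖zD‖ ≤ √V / √(constC3 sys R K P γ₂) := by
    rw [← Real.sqrt_div hV0]
    refine Real.le_sqrt_of_sq_le ?_
    rw [le_div_iff₀ hC3]
    linarith
  calc ‖X t‖ = ‖w + sys.B (matCLM K zD)‖ := by rw [hw, sub_add_cancel]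
    _ ≤ ‖w‖ + ‖sys.B (matCLM K zD)‖ := norm_add_le _ _
    _ ≤ √(2 * R.MR) * √V + normBK sys K * (√V / √(constC3 sys R K P γ₂)) := by
        gcongr
        exact (norm_B_matCLM_le zD).trans (mul_le_mul_of_nonneg_left hzn normBK_nonneg)
    _ = _ := by rw [constC4]; ring

/-- Serves to bound the initial value at `D + t₀`; Bessel makes the bound independent of `N`. -/
theorem LyapunovData.lyapunov_le (h : LyapunovData sys R α D K P β γ₁ γ₂) {t M : ℝ}
    (hZc : Continuous Z) (hZ : ∀ s ∈ Icc (t - D) t, ‖Z s‖ ≤ M) (N : ℕ) :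
    lyapunov sys R D K P γ₁ γ₂ X Z N t ≤ (γ₁ * (1 + D) + γ₂) * (lamMax P * M ^ 2)
      + 1 / 2 * ((‖X t‖ + normBK sys K * M) ^ 2 / R.mR) := by
  have hD := h.D_pos
  have hmR := R.mR_pos
  have hq : ∀ s ∈ Icc (t - D) t, quadForm P (Z s) ≤ lamMax P * M ^ 2 := fun s hs =>
    (quadForm_le_lamMax_mul h.posDef.1 (Z s)).trans (mul_le_mul_of_nonneg_left
      (pow_le_pow_left₀ (norm_nonneg _) (hZ s hs) 2) h.lamMax_pos.le)
  have h1 : ∫ s in (t - D)..t, quadForm P (Z s) ≤ D * (lamMax P * M ^ 2) := by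
    have := intervalIntegral.integral_mono_on (by linarith : t - D ≤ t)
      (((continuous_quadForm P).comp hZc).intervalIntegrable (μ := volume) _ _)
      (intervalIntegrable_const (μ := volume) (c := lamMax P * M ^ 2)) hq
    rw [intervalIntegral.integral_const, sub_sub_cancel, smul_eq_mul] at this
    exact this
  have h2 : ∑ k ∈ Finset.Ico N₀ N, ‖shiftedMode sys R D K X Z k t‖ ^ 2
      ≤ (‖X t‖ + normBK sys K * M) ^ 2 / R.mR := by
    have e1 : ∑ k ∈ Finset.Ico N₀ N, ‖shiftedMode sys R D K X Z k t‖ ^ 2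
        ≤ ∑ k ∈ Finset.range N, ‖shiftedMode sys R D K X Z k t‖ ^ 2 := by
      refine Finset.sum_le_sum_of_subset_of_nonneg (fun k hk => ?_) fun _ _ _ => sq_nonneg _
      exact Finset.mem_range.2 (Finset.mem_Ico.1 hk).2
    refine (e1.trans (R.bessel N _)).trans ?_
    gcongr
    refine (norm_sub_le _ _).trans ?_
    gcongr
    exact (norm_B_matCLM_le _).trans (mul_le_mul_of_nonneg_left
      (hZ _ ⟨le_rfl, by linarith⟩) normBK_nonneg)
  have h3 := hq t ⟨by linarith, le_rfl⟩
  have h4 := hq (t - D) ⟨le_rfl, by linarith⟩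
  have h5 := h.γ₁_pos.le
  have h6 := h.γ₂_pos.le
  have h7 := mul_le_mul_of_nonneg_left (add_le_add h3 h1) h5
  have h8 := mul_le_mul_of_nonneg_left h4 h6
  unfold lyapunov
  linarith

end Lyapunov

/-! ### Dissipation of the Lyapunov functional -/

section LyapunovDerivative

variable {𝕜 : Type*} [RCLike 𝕜] {H : Type*} [NormedAddCommGroup H] [InnerProductSpace 𝕜 H]
  [NormedSpace ℝ H] {m N₀ : ℕ}
  {sys : BoundaryControlSystem 𝕜 H m} {R : RieszSpectral sys.A0} {α D t₀ : ℝ}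
  {K : Matrix (Fin m) (Fin N₀) 𝕜} {P : Matrix (Fin N₀) (Fin N₀) 𝕜} {β γ₁ γ₂ : ℝ}
  {X : ℝ → H} {Z : ℝ → Euc 𝕜 N₀} {F : ℝ → H}

theorem LyapunovData.norm_sq_add_norm_sq_le (h : LyapunovData sys R α D K P β γ₁ γ₂)
    (z : Euc 𝕜 N₀) :
    2 / (α * R.mR) * (‖sys.AB (matCLM K z)‖ ^ 2
      + ‖sys.B (matCLM K (matCLM (matAcl sys R D K) z))‖ ^ 2) ≤ constC5 sys R α D K * ‖z‖ ^ 2 := by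
  have hα := h.α_pos
  have hmR := R.mR_pos
  have h1 := norm_sq_apply_matCLM_le sys.AB K z
  have h2 := norm_sq_apply_matCLM_le sys.B (K * matAcl sys R D K) z
  rw [matCLM_mul] at h2
  have h3 := mul_le_mul_of_nonneg_left (add_le_add h1 h2)
    (by positivity : 0 ≤ 2 / (α * R.mR))
  refine h3.trans (le_of_eq ?_)
  rw [constC5, ← Finset.sum_mul, ← Finset.sum_mul, Finset.sum_add_distrib]
  ring

/-- Each stable mode gives up half its decay to its forcing, at cost `1/(2α)`; Bessel sums the
forcings to `‖E‖²/m_R`, and the four terms of `E` give a factor 4. The two terms in `Z(t - D)` make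
up `C₅`, the two in `F` the first part of `C₆`. -/
theorem IsTargetSystem.exists_deriv_modes_le (hT : IsTargetSystem sys R D t₀ K X Z F)
    (h : LyapunovData sys R α D K P β γ₁ γ₂) (N : ℕ) {t M : ℝ} (ht : D + t₀ ≤ t)
    (hM : ∀ s ∈ Icc (t - D) t, ‖F s‖ ^ 2 ≤ M) :
    ∃ S', HasDerivAt
        (fun s => 1 / 2 * ∑ k ∈ Finset.Ico N₀ N, ‖shiftedMode sys R D K X Z k s‖ ^ 2) S' t ∧
      S' ≤ -(α / 2) * ∑ k ∈ Finset.Ico N₀ N, ‖shiftedMode sys R D K X Z k t‖ ^ 2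
        + constC5 sys R α D K * ‖Z (t - D)‖ ^ 2
        + 1 / R.mR * (2 * (R.mR + normBK sys K ^ 2) / (α * R.mR)) * M := by
  have hα := h.α_pos
  have hmR := R.mR_pos
  have hD := h.D_pos
  set E : H := F t + sys.AB (matCLM K (Z (t - D)))
    - (sys.B (matCLM K (matCLM (matAcl sys R D K) (Z (t - D))))
      + sys.B (matCLM K (modes R N₀ (F (t - D))))) with hE
  have hder : ∀ k, HasDerivAt (fun s => ‖shiftedMode sys R D K X Z k s‖ ^ 2)
      (2 * RCLike.re (inner 𝕜 (shiftedMode sys R D K X Z k t)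
        (R.lam k * shiftedMode sys R D K X Z k t + inner 𝕜 (R.psi k) E))) t := fun k =>
    hasDerivAt_norm_sq_rclike (hT.deriv_mode k t ht)
  refine ⟨_, (HasDerivAt.fun_sum fun k _ => hder k).const_mul (1 / 2), ?_⟩
  have hk : ∀ k ∈ Finset.Ico N₀ N, 2 * RCLike.re (inner 𝕜 (shiftedMode sys R D K X Z k t)
        (R.lam k * shiftedMode sys R D K X Z k t + inner 𝕜 (R.psi k) E))
      ≤ 2 * (-(α / 2) * ‖shiftedMode sys R D K X Z k t‖ ^ 2
        + 1 / (2 * α) * ‖(inner 𝕜 (R.psi k) E : 𝕜)‖ ^ 2) := fun k hk =>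
    mul_le_mul_of_nonneg_left (re_inner_mul_add_le hα (h.stable k (Finset.mem_Ico.1 hk).1)) (by simp)
  have hbes : ∑ k ∈ Finset.Ico N₀ N, ‖(inner 𝕜 (R.psi k) E : 𝕜)‖ ^ 2 ≤ ‖E‖ ^ 2 / R.mR := by
    refine le_trans ?_ (R.bessel N E)
    refine Finset.sum_le_sum_of_subset_of_nonneg (fun k hk => ?_) fun _ _ _ => sq_nonneg _
    exact Finset.mem_range.2 (Finset.mem_Ico.1 hk).2
  have hEn := norm_add_add_sub_sub_sq_le (F t) (sys.AB (matCLM K (Z (t - D))))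
    (sys.B (matCLM K (matCLM (matAcl sys R D K) (Z (t - D)))))
    (sys.B (matCLM K (modes R N₀ (F (t - D)))))
  rw [← hE] at hEn
  have h5 := h.norm_sq_add_norm_sq_le (Z (t - D))
  have hp : ‖sys.B (matCLM K (modes R N₀ (F (t - D))))‖ ^ 2 ≤ normBK sys K ^ 2 * (M / R.mR) := by
    have e1 := pow_le_pow_left₀ (norm_nonneg _)
      (norm_B_matCLM_le (sys := sys) (K := K) (modes R N₀ (F (t - D)))) 2
    rw [mul_pow] at e1
    refine e1.trans ?_
    gcongr
    refine (R.norm_modes_sq_le N₀ _).trans ?_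
    gcongr
    exact hM _ ⟨le_rfl, by linarith⟩
  have hF := hM t ⟨by linarith, le_rfl⟩
  calc 1 / 2 * ∑ k ∈ Finset.Ico N₀ N, 2 * RCLike.re (inner 𝕜 (shiftedMode sys R D K X Z k t)
        (R.lam k * shiftedMode sys R D K X Z k t + inner 𝕜 (R.psi k) E))
      ≤ 1 / 2 * ∑ k ∈ Finset.Ico N₀ N, 2 * (-(α / 2) * ‖shiftedMode sys R D K X Z k t‖ ^ 2
        + 1 / (2 * α) * ‖(inner 𝕜 (R.psi k) E : 𝕜)‖ ^ 2) := by
        gcongr with k hk'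
        exact le_of_mul_le_mul_left (hk k hk') two_pos
    _ = -(α / 2) * ∑ k ∈ Finset.Ico N₀ N, ‖shiftedMode sys R D K X Z k t‖ ^ 2
        + 1 / (2 * α) * ∑ k ∈ Finset.Ico N₀ N, ‖(inner 𝕜 (R.psi k) E : 𝕜)‖ ^ 2 := by
        rw [← Finset.mul_sum, Finset.sum_add_distrib, ← Finset.mul_sum, ← Finset.mul_sum]
        ring
    _ ≤ -(α / 2) * ∑ k ∈ Finset.Ico N₀ N, ‖shiftedMode sys R D K X Z k t‖ ^ 2
        + 1 / (2 * α) * (4 * (M + ‖sys.AB (matCLM K (Z (t - D)))‖ ^ 2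
          + ‖sys.B (matCLM K (matCLM (matAcl sys R D K) (Z (t - D))))‖ ^ 2
          + normBK sys K ^ 2 * (M / R.mR)) / R.mR) := by
        gcongr
        refine hbes.trans ?_
        gcongr
        linarith
    _ = -(α / 2) * ∑ k ∈ Finset.Ico N₀ N, ‖shiftedMode sys R D K X Z k t‖ ^ 2
        + 2 / (α * R.mR) * (‖sys.AB (matCLM K (Z (t - D)))‖ ^ 2
          + ‖sys.B (matCLM K (matCLM (matAcl sys R D K) (Z (t - D))))‖ ^ 2)
        + 1 / R.mR * (2 * (R.mR + normBK sys K ^ 2) / (α * R.mR)) * M := by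
        field_simp
        ring
    _ ≤ _ := by gcongr

theorem IsTargetSystem.exists_deriv_quadForm_le (hT : IsTargetSystem sys R D t₀ K X Z F)
    (h : LyapunovData sys R α D K P β γ₁ γ₂) {t M : ℝ} (ht : t₀ ≤ t) (hM : ‖F t‖ ^ 2 ≤ M) :
    ∃ q', HasDerivAt (fun s => quadForm P (Z s)) q' t ∧
      q' ≤ -(1 - β) * ‖Z t‖ ^ 2 + matNorm P ^ 2 / β * (M / R.mR) := by
  have hmR := R.mR_pos
  have hβ := h.β_mem.1
  refine ⟨_, hasDerivAt_quadForm h.posDef.1 (hT.deriv_Z t ht), ?_⟩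
  refine (two_re_inner_lyapunov_le h.posDef.1 h.lyapunov_eq hβ _ _).trans ?_
  gcongr
  refine (R.norm_modes_sq_le N₀ _).trans ?_
  gcongr

/-- Dissipation inequality for the truncated Lyapunov functional. -/
theorem IsTargetSystem.exists_deriv_lyapunov_le (hT : IsTargetSystem sys R D t₀ K X Z F)
    (h : LyapunovData sys R α D K P β γ₁ γ₂) (N : ℕ) {t M : ℝ} (ht : D + t₀ ≤ t)
    (hM : ∀ s ∈ Icc (t - D) t, ‖F s‖ ^ 2 ≤ M) :
    ∃ V', HasDerivAt (lyapunov sys R D K P γ₁ γ₂ X Z N) V' t ∧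
      V' ≤ -(2 * constKappa sys R α D K P β γ₂) * lyapunov sys R D K P γ₁ γ₂ X Z N t
        + constC6 sys R α D K P β γ₁ γ₂ * M := by
  have hα := h.α_pos
  have hmR := R.mR_pos
  have hD := h.D_pos
  have hγ₁ := h.γ₁_pos
  have hγ₂ := h.γ₂_pos
  have hβ0 := h.β_mem.1
  have hβ : 0 < 1 - β := by linarith [h.β_mem.2]
  have hκ := h.constKappa_pos
  set κ := constKappa sys R α D K P β γ₂
  set L := matNorm P ^ 2 / β * (M / R.mR) with hL
  have hqc : Continuous fun s => quadForm P (Z s) :=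
    (continuous_quadForm P).comp hT.continuous_Z
  have hZ2 : Continuous fun s => ‖Z s‖ ^ 2 := hT.continuous_Z.norm.pow 2
  have htD : t - D ∈ Icc (t - D) t := ⟨le_rfl, by linarith⟩
  have htt : t ∈ Icc (t - D) t := ⟨by linarith, le_rfl⟩
  obtain ⟨q', hq, hq'⟩ := hT.exists_deriv_quadForm_le h (t := t) (by linarith) (hM t htt)
  obtain ⟨p', hp, hp'⟩ := hT.exists_deriv_quadForm_le h (t := t - D) (by linarith) (hM _ htD)
  obtain ⟨S', hS, hS'⟩ := hT.exists_deriv_modes_le h N ht hM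
  rw [← hL] at hq' hp'
  have hpD : HasDerivAt (fun s => quadForm P (Z (s - D))) p' t := hp.comp_sub_const t D
  have hI : HasDerivAt (fun s => ∫ r in (s - D)..s, quadForm P (Z r))
      (quadForm P (Z t) - quadForm P (Z (t - D))) t := by
    have e1 := (hqc.integral_hasStrictDerivAt 0 t).hasDerivAt
    have e2 := (hqc.integral_hasStrictDerivAt 0 (t - D)).hasDerivAt.comp_sub_const t D
    refine (e1.sub e2).congr_of_eventuallyEq (Eventually.of_forall fun s => ?_)
    exact (intervalIntegral.integral_interval_sub_left (hqc.intervalIntegrable _ _)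
      (hqc.intervalIntegrable _ _)).symm
  -- This difference is the derivative of the integral term. Integrating the dissipation of the form
  -- over the delay window yields the negative integral of `‖Z‖²` that makes the integral term
  -- decay; its forcing is the `D` in the factor `1 + D` of `C₆`.
  have hdiff : quadForm P (Z t) - quadForm P (Z (t - D))
      ≤ -(1 - β) * (∫ s in (t - D)..t, ‖Z s‖ ^ 2) + D * L := by
    have hex : ∀ s ∈ Ioo (t - D) t, HasDerivWithinAt (fun s => quadForm P (Z s))
        (deriv (fun s => quadForm P (Z s)) s) (Ioi s) s ∧
        deriv (fun s => quadForm P (Z s)) s ≤ -(1 - β) * ‖Z s‖ ^ 2 + L := fun s hs => by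
      obtain ⟨q'', hd, hle⟩ := hT.exists_deriv_quadForm_le h (t := s) (by linarith [hs.1])
        (hM s ⟨hs.1.le, hs.2.le⟩)
      rw [hd.deriv]
      exact ⟨hd.hasDerivWithinAt, hle⟩
    have hcont : Continuous fun s => -(1 - β) * ‖Z s‖ ^ 2 + L := by fun_prop
    have e := intervalIntegral.sub_le_integral_of_hasDeriv_right_of_le (by linarith : t - D ≤ t)
      hqc.continuousOn (fun s hs => (hex s hs).1) (hcont.integrableOn_Icc)
      fun s hs => (hex s hs).2
    have hcont' : Continuous fun s => -(1 - β) * ‖Z s‖ ^ 2 := by fun_prop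
    rw [intervalIntegral.integral_add (hcont'.intervalIntegrable _ _)
      intervalIntegrable_const, intervalIntegral.integral_const_mul,
      intervalIntegral.integral_const, sub_sub_cancel, smul_eq_mul] at e
    exact e
  -- The three entries of the minimum in `κ₀` serve the `γ₁` part, the `γ₂` part (after it has
  -- absorbed `C₅ ‖Z(t - D)‖²`) and the modal sum.
  have hκq : ∀ z : Euc 𝕜 N₀, 2 * κ * quadForm P z ≤ (1 - β) * ‖z‖ ^ 2 := fun z => by
    have e1 := mul_le_mul_of_nonneg_left (quadForm_le_lamMax_mul h.posDef.1 z)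
      (by positivity : 0 ≤ 2 * κ)
    have e2 := mul_le_mul_of_nonneg_right h.kappa_lamMax_le (sq_nonneg ‖z‖)
    linarith
  have hκq' : ∀ z : Euc 𝕜 N₀,
      2 * κ * (γ₂ * quadForm P z) ≤ (γ₂ * (1 - β) - constC5 sys R α D K) * ‖z‖ ^ 2 := fun z => by
    have e1 := mul_le_mul_of_nonneg_left (quadForm_le_lamMax_mul h.posDef.1 z)
      (by positivity : 0 ≤ 2 * κ * γ₂)
    have e2 := mul_le_mul_of_nonneg_right h.kappa_lamMax_le' (sq_nonneg ‖z‖)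
    have e3 := mul_le_mul_of_nonneg_left e2 hγ₂.le
    have e4 : γ₂ * ((1 - β - constC5 sys R α D K / γ₂) * ‖z‖ ^ 2)
        = (γ₂ * (1 - β) - constC5 sys R α D K) * ‖z‖ ^ 2 := by field_simp
    rw [e4] at e3
    refine le_trans (le_of_eq ?_) (e1.trans (le_trans (le_of_eq ?_) e3)) <;> ring
  have hκI : 2 * κ * (∫ s in (t - D)..t, quadForm P (Z s))
      ≤ (1 - β) * ∫ s in (t - D)..t, ‖Z s‖ ^ 2 := by
    rw [← intervalIntegral.integral_const_mul, ← intervalIntegral.integral_const_mul]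
    exact intervalIntegral.integral_mono_on (by linarith)
      ((continuous_const.mul hqc).intervalIntegrable _ _)
      ((continuous_const.mul hZ2).intervalIntegrable _ _) fun s _ => hκq (Z s)
  have hκS : 2 * κ * (1 / 2 * ∑ k ∈ Finset.Ico N₀ N, ‖shiftedMode sys R D K X Z k t‖ ^ 2)
      ≤ α / 2 * ∑ k ∈ Finset.Ico N₀ N, ‖shiftedMode sys R D K X Z k t‖ ^ 2 := by
    have e0 : 0 ≤ ∑ k ∈ Finset.Ico N₀ N, ‖shiftedMode sys R D K X Z k t‖ ^ 2 := by positivity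
    have e1 := mul_le_mul_of_nonneg_right h.kappa_le e0
    have e2 : 0 ≤ κ * ∑ k ∈ Finset.Ico N₀ N, ‖shiftedMode sys R D K X Z k t‖ ^ 2 := by positivity
    linarith
  refine ⟨_, (((hq.add hI).const_mul γ₁).add (hpD.const_mul γ₂)).add hS, ?_⟩
  have g1 : γ₁ * (q' + (quadForm P (Z t) - quadForm P (Z (t - D))))
      ≤ γ₁ * (-(2 * κ) * (quadForm P (Z t) + ∫ s in (t - D)..t, quadForm P (Z s))
        + (1 + D) * L) := by
    refine mul_le_mul_of_nonneg_left ?_ hγ₁.le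
    linarith [hκq (Z t)]
  have g2 := mul_le_mul_of_nonneg_left hp' hγ₂.le
  have g3 := hκq' (Z (t - D))
  have hC6 : constC6 sys R α D K P β γ₁ γ₂ * M = (γ₁ * (1 + D) + γ₂) * L
      + 1 / R.mR * (2 * (R.mR + normBK sys K ^ 2) / (α * R.mR)) * M := by
    rw [constC6, hL]; field_simp; ring
  rw [hC6]
  unfold lyapunov
  linarith

/-- Exponentially weighted estimate of the truncated Lyapunov functional. -/
theorem IsTargetSystem.exp_mul_lyapunov_le (hT : IsTargetSystem sys R D t₀ K X Z F)
    (h : LyapunovData sys R α D K P β γ₁ γ₂) (N : ℕ) {δ Φ t : ℝ} (hδ0 : 0 ≤ δ)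
    (hδ : δ < constKappa sys R α D K P β γ₂) (ht : D + t₀ ≤ t)
    (hF : ∀ s ∈ Icc t₀ t, Real.exp (δ * s) * ‖F s‖ ≤ Φ) :
    Real.exp (2 * δ * t) * lyapunov sys R D K P γ₁ γ₂ X Z N t
      ≤ Real.exp (2 * δ * (D + t₀)) * lyapunov sys R D K P γ₁ γ₂ X Z N (D + t₀)
        + constC6 sys R α D K P β γ₁ γ₂ * (Real.exp (δ * D) * Φ) ^ 2
          / (2 * (constKappa sys R α D K P β γ₂ - δ)) := by
  refine exp_mul_le_of_deriv_le hδ (mul_nonneg h.constC6_nonneg (sq_nonneg _))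
    (h.lyapunov_nonneg N _) (fun r hr => ?_) t ⟨ht, le_rfl⟩
  obtain ⟨V', hd, hle⟩ := hT.exists_deriv_lyapunov_le h N hr.1
    (M := (Real.exp (δ * D) * Φ) ^ 2 * Real.exp (-(2 * δ) * r)) fun s hs => by
      have e1 := hF s ⟨by linarith [hs.1, hr.1], hs.2.trans hr.2⟩
      have e2 : ‖F s‖ ≤ Real.exp (-(δ * s)) * Φ := by
        have := mul_le_mul_of_nonneg_left e1 (Real.exp_pos (-(δ * s))).le
        rwa [← mul_assoc, ← Real.exp_add, neg_add_cancel, Real.exp_zero, one_mul] at this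
      have hΦ : 0 ≤ Φ := le_trans (by positivity) e1
      -- The forcing is needed on the whole window `[r - D, r]`; moving its weight to time `r` costs
      -- `e^{δD}`.
      have e3 : Real.exp (-(δ * s)) ≤ Real.exp (δ * D) * Real.exp (-(δ * r)) := by
        rw [← Real.exp_add]
        exact Real.exp_le_exp.2 (by nlinarith [hs.1])
      calc ‖F s‖ ^ 2 ≤ (Real.exp (δ * D) * Real.exp (-(δ * r)) * Φ) ^ 2 := by
            gcongr
            exact e2.trans (by gcongr)
        _ = (Real.exp (δ * D) * Φ) ^ 2 * Real.exp (-(δ * r)) ^ 2 := by ring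
        _ = _ := by rw [← Real.exp_nat_mul]; push_cast; ring_nf
  exact ⟨V', hd, hle.trans (le_of_eq (by ring))⟩

end LyapunovDerivative

/-! ### Suprema over compact intervals -/

section SupOn

theorem supOn_le {g : ℝ → ℝ} {a b C : ℝ} (hab : a ≤ b) (h : ∀ τ ∈ Icc a b, g τ ≤ C) :
    supOn g a b ≤ C := by
  refine csSup_le ((nonempty_Icc.2 hab).image g) ?_
  rintro _ ⟨τ, hτ, rfl⟩
  exact h τ hτ

/-- Continuity supplies boundedness; the real `sSup` of a set unbounded above is 0. -/
theorem le_supOn {g : ℝ → ℝ} {a b τ : ℝ} (hg : ContinuousOn g (Icc a b)) (hτ : τ ∈ Icc a b) :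
    g τ ≤ supOn g a b :=
  le_csSup (isCompact_Icc.bddAbove_image hg) ⟨τ, hτ, rfl⟩

end SupOn

/-! ### The predictor during the transition period -/

section Gronwall

/-- Lets the size of the data factor out, so that the final constants do not depend on the solution.
-/
theorem gronwallBound_zero_eq_mul (K ε x : ℝ) :
    gronwallBound 0 K ε x = ε * gronwallBound 0 K 1 x := by
  unfold gronwallBound
  split_ifs <;> ring

/-- Integral form of the Gronwall inequality. -/
theorem le_of_le_add_integral {g : ℝ → ℝ} {A c T : ℝ} (hg : Continuous g) (hg0 : ∀ t, 0 ≤ g t)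
    (hc : 0 ≤ c) (hA : 0 ≤ A)
    (h : ∀ t ∈ Icc 0 T, g t ≤ A + c * ∫ s in (0 : ℝ)..t, g s) :
    ∀ t ∈ Icc 0 T, g t ≤ A * (1 + c * gronwallBound 0 c 1 T) := by
  have hI : ∀ t ∈ Icc 0 T, 0 ≤ ∫ s in (0 : ℝ)..t, g s := fun t ht =>
    intervalIntegral.integral_nonneg ht.1 fun s _ => hg0 s
  have h1 := norm_le_gronwallBound_of_norm_deriv_right_le (f := fun t => ∫ s in (0 : ℝ)..t, g s)
    (f' := g) (δ := 0) (K := c) (ε := A) (a := 0) (b := T)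
    (intervalIntegral.continuous_primitive (fun a b => hg.intervalIntegrable a b) 0).continuousOn
    (fun t _ => (hg.integral_hasStrictDerivAt 0 t).hasDerivAt.hasDerivWithinAt)
    (by simp) (fun t ht => by
      rw [Real.norm_of_nonneg (hg0 t), Real.norm_of_nonneg (hI t ⟨ht.1, ht.2.le⟩)]
      linarith [h t ⟨ht.1, ht.2.le⟩])
  intro t ht
  have h2 := h1 t ht
  rw [Real.norm_of_nonneg (hI t ht), sub_zero] at h2
  have h3 := h2.trans (gronwallBound_mono le_rfl hA hc ht.2)
  rw [gronwallBound_zero_eq_mul] at h3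
  calc g t ≤ A + c * ∫ s in (0 : ℝ)..t, g s := h t ht
    _ ≤ A + c * (A * gronwallBound 0 c 1 T) := by gcongr
    _ = _ := by ring

variable {𝕜 : Type*} [RCLike 𝕜] {H : Type*} [NormedAddCommGroup H] [InnerProductSpace 𝕜 H]
  [NormedSpace ℝ H] {m n mv N₀ : ℕ}

/-- A bound for the predictor state on a bounded time interval in terms of the state. -/
noncomputable def predictorBound (sys : BoundaryControlSystem 𝕜 H m) (R : RieszSpectral sys.A0)
    (D T : ℝ) (K : Matrix (Fin m) (Fin N₀) 𝕜) : ℝ :=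
  (√R.mR)⁻¹ * (1 + Real.exp (D * matNorm (matA R N₀)) * matNorm (matB sys R N₀ * K)
    * gronwallBound 0 (Real.exp (D * matNorm (matA R N₀)) * matNorm (matB sys R N₀ * K)) 1 T)

/-- The predictor obeys `‖Z‖ ≤ ‖Y‖ + c ∫ ‖Z‖`, where Bessel bounds `‖Y‖` by `M / √m_R`; Gronwall
concludes. -/
theorem IsClassicalSolution.norm_predictor_le {sys : BoundaryControlSystem 𝕜 H m}
    {R : RieszSpectral sys.A0} {D t₀ : ℝ} {φ : ℝ → ℝ} {K : Matrix (Fin m) (Fin N₀) 𝕜}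
    {f₁ : Euc 𝕜 n × H × Euc 𝕜 mv → Euc 𝕜 n} {f₂ : Euc 𝕜 n × H × Euc 𝕜 mv → H}
    {x₀ : Euc 𝕜 n} {X₀ : H} {v : ℝ → Euc 𝕜 mv}
    {x : ℝ → Euc 𝕜 n} {X : ℝ → H} {u : ℝ → Euc 𝕜 m}
    (h : IsClassicalSolution sys R D φ K f₁ f₂ x₀ X₀ v x X u) (hD : 0 ≤ D)
    (hφ : IsTransitionSignal D t₀ φ) {T M : ℝ} (hM0 : 0 ≤ M) (hM : ∀ t ∈ Icc 0 T, ‖X t‖ ≤ M) :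
    ∀ t ∈ Icc 0 T, ‖predictor sys R N₀ D X u (max t 0)‖ ≤ predictorBound sys R D T K * M := by
  have hmR := R.mR_pos
  set c := Real.exp (D * matNorm (matA R N₀)) * matNorm (matB sys R N₀ * K) with hc
  have hc0 : 0 ≤ c := mul_nonneg (Real.exp_pos _).le (norm_nonneg _)
  have hcont : Continuous fun t => ‖predictor sys R N₀ D X u (max t 0)‖ :=
    ((h.continuousOn_predictor hD).comp_continuous (by fun_prop)
      fun t => mem_Ici.2 (le_max_right _ _)).norm
  have key := le_of_le_add_integral (A := (√R.mR)⁻¹ * M) (T := T) hcont (fun _ => norm_nonneg _) hc0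
    (by positivity) fun t ht => by
      have h1 := h.norm_predictor_sub_modes_le hD hφ ht.1
      have h2 : ‖modes R N₀ (X t)‖ ≤ (√R.mR)⁻¹ * M := by
        refine abs_le_of_sq_le_sq' ?_ (by positivity) |>.2
        refine (R.norm_modes_sq_le N₀ (X t)).trans ?_
        rw [mul_pow, inv_pow, Real.sq_sqrt hmR.le, div_eq_inv_mul]
        gcongr
        exact hM t ht
      have h3 : ∫ s in (max (t - D) 0)..t, ‖predictor sys R N₀ D X u s‖
          ≤ ∫ s in (0 : ℝ)..t, ‖predictor sys R N₀ D X u (max s 0)‖ := by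
        have hle : max (t - D) 0 ≤ t := max_le (by linarith) ht.1
        have e : ∫ s in (max (t - D) 0)..t, ‖predictor sys R N₀ D X u s‖
            = ∫ s in (max (t - D) 0)..t, ‖predictor sys R N₀ D X u (max s 0)‖ := by
          refine intervalIntegral.integral_congr fun s hs => ?_
          rw [uIcc_of_le hle] at hs
          simp only [max_eq_left ((le_max_right _ _).trans hs.1)]
        rw [e]
        exact intervalIntegral.integral_mono_interval (le_max_right _ _) hle le_rfl
          (Eventually.of_forall fun s => norm_nonneg _) (hcont.intervalIntegrable _ _)
      have h4 := norm_sub_norm_le (predictor sys R N₀ D X u t) (modes R N₀ (X t))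
      have h5 := mul_le_mul_of_nonneg_left h3 hc0
      rw [max_eq_left ht.1]
      linarith
  intro t ht
  refine (key t ht).trans (le_of_eq ?_)
  rw [predictorBound, ← hc]
  ring

end Gronwall

/-! ### Fading memory for the ODE -/

section FadingMemory

variable {𝕜 : Type*} [RCLike 𝕜] {H : Type*} [NormedAddCommGroup H] {n mv : ℕ}
  {f₁ : Euc 𝕜 n × H × Euc 𝕜 mv → Euc 𝕜 n} {f₂ : Euc 𝕜 n × H × Euc 𝕜 mv → H}
  {D₁ D₂ D₃ κt Ct₀ Ct₁ Ct₂ : ℝ}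

/-- `f₁` does not depend on time, so a time shift of a solution is a solution with shifted inputs.
-/
theorem CouplingAssumption.iss_restart
    (hf : CouplingAssumption f₁ f₂ D₁ D₂ D₃ κt Ct₀ Ct₁ Ct₂)
    {X : ℝ → H} {v : ℝ → Euc 𝕜 mv} {x : ℝ → Euc 𝕜 n}
    (hX : ContinuousOn X (Ici 0)) (hv : ContinuousOn v (Ici 0))
    (hx : ∀ t, 0 ≤ t → HasDerivWithinAt x (f₁ (x t, X t, v t)) (Ici 0) t)
    {s r B : ℝ} (hs : 0 ≤ s) (hr : 0 ≤ r)
    (hB : ∀ τ ∈ Icc s (s + r), Ct₁ ^ 2 * ‖X τ‖ ^ 2 + Ct₂ ^ 2 * ‖v τ‖ ^ 2 ≤ B) :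
    ‖x (s + r)‖ ^ 2 ≤ Ct₀ ^ 2 * Real.exp (-2 * κt * r) * ‖x s‖ ^ 2 + B := by
  have hmaps : MapsTo (fun τ : ℝ => s + τ) (Ici 0) (Ici 0) := fun τ hτ =>
    mem_Ici.2 (add_nonneg hs hτ)
  have hcs : ContinuousOn (fun τ : ℝ => s + τ) (Ici 0) := by fun_prop
  have h := hf.iss (fun τ => X (s + τ)) (fun τ => v (s + τ)) (fun τ => x (s + τ))
    (hX.comp hcs hmaps) (hv.comp hcs hmaps) (fun t ht => by
      have h1 : HasDerivWithinAt (fun τ : ℝ => s + τ) 1 (Ici 0) t :=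
        ((hasDerivAt_id t).const_add s).hasDerivWithinAt
      have h2 := (hx (s + t) (add_nonneg hs ht)).scomp t h1 hmaps
      rwa [one_smul] at h2) r hr
  simp only [add_zero] at h
  refine h.trans (add_le_add le_rfl (supOn_le hr fun τ hτ => hB _ ⟨?_, ?_⟩)) <;>
    linarith [hτ.1, hτ.2]

/-- Exponentially weighted form of the ISS estimate, with gains arbitrarily close to the
original ones. -/
theorem CouplingAssumption.exp_mul_norm_le
    (hf : CouplingAssumption f₁ f₂ D₁ D₂ D₃ κt Ct₀ Ct₁ Ct₂)
    {X : ℝ → H} {v : ℝ → Euc 𝕜 mv} {x : ℝ → Euc 𝕜 n}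
    (hX : ContinuousOn X (Ici 0)) (hv : ContinuousOn v (Ici 0))
    (hx : ∀ t, 0 ≤ t → HasDerivWithinAt x (f₁ (x t, X t, v t)) (Ici 0) t)
    {δ T t ξ ν : ℝ} (hδ : 0 ≤ δ) (hT : 0 ≤ T) (ht : 0 ≤ t)
    (hη : Ct₀ ^ 2 * Real.exp (-2 * κt * T) * Real.exp (2 * δ * T) < 1)
    (hξ : ∀ τ ∈ Icc 0 t, Real.exp (δ * τ) * ‖X τ‖ ≤ ξ)
    (hν : ∀ τ ∈ Icc 0 t, Real.exp (δ * τ) * ‖v τ‖ ≤ ν) :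
    ∀ τ ∈ Icc 0 t, Real.exp (δ * τ) * ‖x τ‖ ≤
      √(Real.exp (2 * δ * T) / (1 - Ct₀ ^ 2 * Real.exp (-2 * κt * T) * Real.exp (2 * δ * T)))
        * (Ct₀ * ‖x 0‖ + Ct₁ * ξ + Ct₂ * ν) := by
  have hC0 := hf.Ct₀_nonneg
  have hC1 := hf.Ct₁_nonneg
  have hC2 := hf.Ct₂_nonneg
  set η := Ct₀ ^ 2 * Real.exp (-2 * κt * T) * Real.exp (2 * δ * T) with hηdef
  have hξ0 : 0 ≤ ξ := le_trans (by positivity) (hξ 0 ⟨le_rfl, ht⟩)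
  have hν0 : 0 ≤ ν := le_trans (by positivity) (hν 0 ⟨le_rfl, ht⟩)
  set B := Ct₁ ^ 2 * ξ ^ 2 + Ct₂ ^ 2 * ν ^ 2 with hBdef
  have hB0 : 0 ≤ B := by positivity
  have hexp : ∀ τ, Real.exp (2 * δ * τ) = Real.exp (δ * τ) ^ 2 := fun τ => by
    rw [← Real.exp_nat_mul]; push_cast; ring_nf
  have hW : ∀ τ ∈ Icc 0 t,
      Real.exp (2 * δ * τ) * (Ct₁ ^ 2 * ‖X τ‖ ^ 2 + Ct₂ ^ 2 * ‖v τ‖ ^ 2) ≤ B := by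
    intro τ hτ
    have e1 := pow_le_pow_left₀ (by positivity) (hξ τ hτ) 2
    have e2 := pow_le_pow_left₀ (by positivity) (hν τ hτ) 2
    calc _ = Ct₁ ^ 2 * (Real.exp (δ * τ) * ‖X τ‖) ^ 2 + Ct₂ ^ 2 * (Real.exp (δ * τ) * ‖v τ‖) ^ 2 := by
          rw [hexp]; ring
      _ ≤ B := by rw [hBdef]; gcongr
  have hrestart : ∀ s r, 0 ≤ s → 0 ≤ r → s + r ≤ t →
      Real.exp (2 * δ * (s + r)) * ‖x (s + r)‖ ^ 2
        ≤ Ct₀ ^ 2 * Real.exp (-2 * κt * r) * Real.exp (2 * δ * r)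
            * (Real.exp (2 * δ * s) * ‖x s‖ ^ 2) + Real.exp (2 * δ * r) * B := by
    intro s r hs hr hsr
    have e1 := hf.iss_restart hX hv hx hs hr (B := Real.exp (-(2 * δ * s)) * B) fun τ hτ => by
      have e2 := hW τ ⟨hs.trans hτ.1, hτ.2.trans hsr⟩
      have e3 : Real.exp (2 * δ * s) * (Ct₁ ^ 2 * ‖X τ‖ ^ 2 + Ct₂ ^ 2 * ‖v τ‖ ^ 2) ≤ B := by
        refine le_trans ?_ e2
        gcongr
        exact hτ.1
      rw [Real.exp_neg, ← div_eq_inv_mul, le_div_iff₀' (Real.exp_pos _)]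
      exact e3
    have e4 := mul_le_mul_of_nonneg_left e1 (Real.exp_pos (2 * δ * (s + r))).le
    have e5 : Real.exp (2 * δ * (s + r)) = Real.exp (2 * δ * s) * Real.exp (2 * δ * r) := by
      rw [← Real.exp_add]; ring_nf
    have e6 : Real.exp (2 * δ * s) * Real.exp (-(2 * δ * s)) = 1 := by
      rw [← Real.exp_add]; simp
    refine e4.trans (le_of_eq ?_)
    rw [e5]
    linear_combination (Real.exp (2 * δ * r) * B) * e6
  have hxc : ContinuousOn x (Ici 0) := fun τ hτ => (hx τ hτ).continuousWithinAt
  -- Working at a maximiser of the weighted square turns the restart inequality into a bound of the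
  -- maximum by `η < 1` times itself.
  obtain ⟨σ, hσ, hmax⟩ := isCompact_Icc.exists_isMaxOn (nonempty_Icc.2 ht)
    (f := fun τ => Real.exp (2 * δ * τ) * ‖x τ‖ ^ 2)
    ((by fun_prop : Continuous fun τ : ℝ => Real.exp (2 * δ * τ)).continuousOn.mul
      ((hxc.mono fun τ hτ => mem_Ici.2 hτ.1).norm.pow 2))
  set S := Real.exp (2 * δ * σ) * ‖x σ‖ ^ 2 with hS
  have hmax' : ∀ τ ∈ Icc 0 t, Real.exp (2 * δ * τ) * ‖x τ‖ ^ 2 ≤ S := fun τ hτ => hmax hτ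
  have hS0 : 0 ≤ S := by positivity
  have hη0 : 0 ≤ η := by positivity
  have hκ := hf.κt_pos
  -- If `σ ≤ T`, start from time 0 and lose at most the weight `e^{2δT}`; otherwise restart at `σ -
  -- T`, where the weighted square is at most `S`.
  have hmain : S ≤ η * S + Real.exp (2 * δ * T) * (Ct₀ ^ 2 * ‖x 0‖ ^ 2 + B) := by
    rcases le_total σ T with hle | hle
    · have e1 := hrestart 0 σ le_rfl hσ.1 (by linarith [hσ.2])
      rw [zero_add, mul_zero, Real.exp_zero, one_mul, ← hS] at e1
      have e2 : Real.exp (-2 * κt * σ) ≤ 1 :=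
        Real.exp_le_one_iff.2 (by nlinarith [mul_nonneg hκ.le hσ.1])
      have e3 : Real.exp (2 * δ * σ) ≤ Real.exp (2 * δ * T) := by gcongr
      have e4 : Ct₀ ^ 2 * Real.exp (-2 * κt * σ) * Real.exp (2 * δ * σ) * ‖x 0‖ ^ 2
          ≤ Ct₀ ^ 2 * 1 * Real.exp (2 * δ * T) * ‖x 0‖ ^ 2 := by gcongr
      have e5 : Real.exp (2 * δ * σ) * B ≤ Real.exp (2 * δ * T) * B := by gcongr
      have e6 : 0 ≤ η * S := by positivity
      linarith
    · have e1 := hrestart (σ - T) T (by linarith) hT (by linarith [hσ.2])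
      rw [sub_add_cancel, ← hS, ← hηdef] at e1
      have e2 := mul_le_mul_of_nonneg_left
        (hmax' (σ - T) ⟨by linarith, by linarith [hσ.2]⟩) hη0
      have e3 : 0 ≤ Real.exp (2 * δ * T) * (Ct₀ ^ 2 * ‖x 0‖ ^ 2) := by positivity
      linarith
  have h1η : 0 < 1 - η := by linarith
  have hSle : S ≤ Real.exp (2 * δ * T) / (1 - η) * (Ct₀ ^ 2 * ‖x 0‖ ^ 2 + B) := by
    rw [div_mul_eq_mul_div, le_div_iff₀ h1η]
    linarith
  intro τ hτ
  refine abs_le_of_sq_le_sq' ?_ (by positivity) |>.2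
  rw [mul_pow, mul_pow, Real.sq_sqrt (by positivity), ← hexp]
  refine (hmax' τ hτ).trans (hSle.trans ?_)
  gcongr
  rw [hBdef]
  have p1 : 0 ≤ Ct₀ * ‖x 0‖ := by positivity
  have p2 : 0 ≤ Ct₁ * ξ := by positivity
  have p3 : 0 ≤ Ct₂ * ν := by positivity
  nlinarith [mul_nonneg p1 p2, mul_nonneg p1 p3, mul_nonneg p2 p3]

end FadingMemory

/-! ### Choice of the decay rate -/

section SmallGain

/-- The loop gain with decay rate `T⁻²` and restart period `T` tends to the nominal loop gain. -/
theorem exists_decay_rate {C₀ C₁ D₁ D₂ C₄ C₆ κt κ D : ℝ} (hκt : 0 < κt) (hκ : 0 < κ)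
    (hgain : (D₁ * C₁ + D₂) * C₄ * √(C₆ / (2 * κ)) < 1) :
    ∃ δ ∈ Ioo 0 κ, ∃ T ≥ 0,
      C₀ ^ 2 * Real.exp (-2 * κt * T) * Real.exp (2 * δ * T) < 1 ∧
      C₄ * (√(C₆ / (2 * (κ - δ))) * Real.exp (δ * D)) *
        (D₁ * (√(Real.exp (2 * δ * T)
          / (1 - C₀ ^ 2 * Real.exp (-2 * κt * T) * Real.exp (2 * δ * T))) * C₁) + D₂) < 1 := by
  have hδ : Tendsto (fun T : ℝ => T⁻¹ ^ 2) atTop (𝓝 0) := by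
    simpa using (tendsto_inv_atTop_zero (𝕜 := ℝ)).pow 2
  -- The exponent is `2 / T`: the rate tends to 0 faster than the period grows.
  have hδT : Tendsto (fun T : ℝ => Real.exp (2 * T⁻¹ ^ 2 * T)) atTop (𝓝 1) := by
    have h1 : Tendsto (fun T : ℝ => 2 * T⁻¹ ^ 2 * T) atTop (𝓝 0) := by
      have h2 : Tendsto (fun T : ℝ => 2 * T⁻¹) atTop (𝓝 0) := by
        simpa using (tendsto_inv_atTop_zero (𝕜 := ℝ)).const_mul 2
      refine h2.congr' ?_
      filter_upwards [eventually_gt_atTop 0] with T hT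
      field_simp
    simpa using h1.rexp
  have hκT : Tendsto (fun T : ℝ => Real.exp (-2 * κt * T)) atTop (𝓝 0) := by
    refine Real.tendsto_exp_atBot.comp ?_
    exact tendsto_id.const_mul_atTop_of_neg (by linarith)
  have hη : Tendsto (fun T : ℝ => C₀ ^ 2 * Real.exp (-2 * κt * T) * Real.exp (2 * T⁻¹ ^ 2 * T))
      atTop (𝓝 0) := by
    simpa using (hκT.const_mul (C₀ ^ 2)).mul hδT
  have hρ : Tendsto (fun T : ℝ => √(Real.exp (2 * T⁻¹ ^ 2 * T)
      / (1 - C₀ ^ 2 * Real.exp (-2 * κt * T) * Real.exp (2 * T⁻¹ ^ 2 * T)))) atTop (𝓝 1) := by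
    have := (hδT.div (hη.const_sub 1) (by norm_num)).sqrt
    simpa using this
  have hs : Tendsto (fun T : ℝ => √(C₆ / (2 * (κ - T⁻¹ ^ 2)))) atTop (𝓝 √(C₆ / (2 * κ))) := by
    have h1 : Tendsto (fun T : ℝ => 2 * (κ - T⁻¹ ^ 2)) atTop (𝓝 (2 * κ)) := by
      simpa using (hδ.const_sub κ).const_mul 2
    exact (tendsto_const_nhds.div h1 (by positivity)).sqrt
  have hD : Tendsto (fun T : ℝ => Real.exp (T⁻¹ ^ 2 * D)) atTop (𝓝 1) := by
    simpa using (hδ.mul_const D).rexp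
  have hall := ((hs.mul hD).const_mul C₄).mul
    (((hρ.mul_const C₁).const_mul D₁).add_const D₂)
  have hlim : C₄ * (√(C₆ / (2 * κ)) * 1) * (D₁ * (1 * C₁) + D₂) < 1 := by
    refine lt_of_eq_of_lt ?_ hgain
    ring
  obtain ⟨T, hT0, hT1, hT2, hT3⟩ := ((eventually_gt_atTop (0 : ℝ)).and
    ((hδ.eventually_lt_const hκ).and ((hη.eventually_lt_const one_pos).and
      (hall.eventually_lt_const hlim)))).exists
  exact ⟨T⁻¹ ^ 2, ⟨by positivity, hT1⟩, T, hT0.le, hT2, hT3⟩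

end SmallGain

/-! ### Weighted estimates for the plant -/

section ClosedLoop

variable {𝕜 : Type*} [RCLike 𝕜] {H : Type*} [NormedAddCommGroup H] [InnerProductSpace 𝕜 H]
  [NormedSpace ℝ H] {m n mv N₀ : ℕ}
  {sys : BoundaryControlSystem 𝕜 H m} {R : RieszSpectral sys.A0}
  {α D t₀ : ℝ} {φ : ℝ → ℝ} {K : Matrix (Fin m) (Fin N₀) 𝕜}
  {P : Matrix (Fin N₀) (Fin N₀) 𝕜} {β γ₁ γ₂ : ℝ}
  {f₁ : Euc 𝕜 n × H × Euc 𝕜 mv → Euc 𝕜 n} {f₂ : Euc 𝕜 n × H × Euc 𝕜 mv → H}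
  {x₀ : Euc 𝕜 n} {X₀ : H} {v : ℝ → Euc 𝕜 mv}
  {x : ℝ → Euc 𝕜 n} {X : ℝ → H} {u : ℝ → Euc 𝕜 m}

/-- A bound for the Lyapunov functional at time `T`, per unit square of the state on `[0, T]`. -/
noncomputable def lyapunovInitBound (sys : BoundaryControlSystem 𝕜 H m) (R : RieszSpectral sys.A0)
    (D T : ℝ) (K : Matrix (Fin m) (Fin N₀) 𝕜) (P : Matrix (Fin N₀) (Fin N₀) 𝕜) (γ₁ γ₂ : ℝ) : ℝ :=
  (γ₁ * (1 + D) + γ₂) * (lamMax P * predictorBound sys R D T K ^ 2)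
    + 1 / 2 * ((1 + normBK sys K * predictorBound sys R D T K) ^ 2 / R.mR)

theorem LyapunovData.lyapunovInitBound_nonneg (h : LyapunovData sys R α D K P β γ₁ γ₂) (T : ℝ) :
    0 ≤ lyapunovInitBound sys R D T K P γ₁ γ₂ := by
  have := h.γ₁_pos
  have := h.γ₂_pos
  have := h.D_pos
  have := h.lamMax_pos
  have := R.mR_pos
  unfold lyapunovInitBound
  positivity

/-- Exponentially weighted estimates of the state and of the control by the in-domain
perturbation. -/
theorem IsClassicalSolution.exp_mul_norm_le [IsScalarTower ℝ 𝕜 H] [CompleteSpace H]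
    (h : IsClassicalSolution sys R D φ K f₁ f₂ x₀ X₀ v x X u)
    (hL : LyapunovData sys R α D K P β γ₁ γ₂) (ht₀ : 0 < t₀) (hφ : IsTransitionSignal D t₀ φ)
    {δ Φ M t : ℝ} (hδ0 : 0 ≤ δ) (hδ : δ < constKappa sys R α D K P β γ₂) (ht : D + t₀ ≤ t)
    (hM0 : 0 ≤ M) (hM : ∀ τ ∈ Icc 0 (D + t₀), ‖X τ‖ ≤ M)
    (hΦ : ∀ τ ∈ Icc t₀ t, Real.exp (δ * τ) * ‖f₂ (x τ, X τ, v τ)‖ ≤ Φ) :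
    Real.exp (δ * t) * ‖X t‖ ≤ constC4 sys R K P γ₂ *
      (Real.exp (δ * (D + t₀)) * √(lyapunovInitBound sys R D (D + t₀) K P γ₁ γ₂) * M
        + √(constC6 sys R α D K P β γ₁ γ₂ / (2 * (constKappa sys R α D K P β γ₂ - δ)))
          * Real.exp (δ * D) * Φ) ∧
    Real.exp (δ * t) * ‖u t‖ ≤ matNorm K / √(γ₁ * lamMin P) *
      (Real.exp (δ * (D + t₀)) * √(lyapunovInitBound sys R D (D + t₀) K P γ₁ γ₂) * M
        + √(constC6 sys R α D K P β γ₁ γ₂ / (2 * (constKappa sys R α D K P β γ₂ - δ)))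
          * Real.exp (δ * D) * Φ) := by
  have hD := hL.D_pos
  have hT := h.isTargetSystem hD ht₀ hφ
  have hv0 := hL.lyapunovInitBound_nonneg (D + t₀)
  have hC6 := hL.constC6_nonneg
  have hκδ : 0 < 2 * (constKappa sys R α D K P β γ₂ - δ) := by linarith
  have hγ : 0 < γ₁ * lamMin P := mul_pos hL.γ₁_pos hL.lamMin_pos
  have hΦ0 : 0 ≤ Φ := le_trans (by positivity) (hΦ t ⟨by linarith, le_rfl⟩)
  set Z := fun t => predictor sys R N₀ D X u (max t 0) with hZdef
  have hZ := h.norm_predictor_le hD.le hφ hM0 hM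
  set q := Real.exp (δ * (D + t₀)) * √(lyapunovInitBound sys R D (D + t₀) K P γ₁ γ₂) * M
        + √(constC6 sys R α D K P β γ₁ γ₂ / (2 * (constKappa sys R α D K P β γ₂ - δ)))
          * Real.exp (δ * D) * Φ with hq
  have hq0 : 0 ≤ q := by positivity
  have hexp : ∀ τ, Real.exp (2 * δ * τ) = Real.exp (δ * τ) ^ 2 := fun τ => by
    rw [← Real.exp_nat_mul]; push_cast; ring_nf
  have hinit : ∀ N, lyapunov sys R D K P γ₁ γ₂ X Z N (D + t₀)
      ≤ lyapunovInitBound sys R D (D + t₀) K P γ₁ γ₂ * M ^ 2 := by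
    intro N
    have e1 := hL.lyapunov_le (X := X) (Z := Z) (t := D + t₀)
      (M := predictorBound sys R D (D + t₀) K * M) hT.continuous_Z
      (fun s hs => hZ s ⟨by linarith [hs.1], hs.2⟩) N
    have e2 : ‖X (D + t₀)‖ + normBK sys K * (predictorBound sys R D (D + t₀) K * M)
        ≤ (1 + normBK sys K * predictorBound sys R D (D + t₀) K) * M := by
      linarith [hM (D + t₀) ⟨by linarith, le_rfl⟩]
    have e3 : 0 ≤ ‖X (D + t₀)‖ + normBK sys K * (predictorBound sys R D (D + t₀) K * M) := by
      have e4 := (norm_nonneg _).trans (hZ 0 ⟨le_rfl, by linarith⟩)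
      have e5 := normBK_nonneg (sys := sys) (K := K)
      positivity
    have hmR := R.mR_pos
    refine e1.trans ?_
    calc _ ≤ (γ₁ * (1 + D) + γ₂) * (lamMax P * (predictorBound sys R D (D + t₀) K * M) ^ 2)
          + 1 / 2 * (((1 + normBK sys K * predictorBound sys R D (D + t₀) K) * M) ^ 2 / R.mR) := by
          gcongr
      _ = _ := by rw [lyapunovInitBound]; ring
  -- The initial value and the forcing contribute two squares, whose sum is at most the square `q²`
  -- of the sum of their roots.
  have hV : ∀ N, lyapunov sys R D K P γ₁ γ₂ X Z N t ≤ (Real.exp (-(δ * t)) * q) ^ 2 := by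
    intro N
    have e1 := hT.exp_mul_lyapunov_le hL N hδ0 hδ ht hΦ
    have e2 := mul_le_mul_of_nonneg_left (hinit N) (Real.exp_pos (2 * δ * (D + t₀))).le
    have e3 : Real.exp (2 * δ * (D + t₀))
          * (lyapunovInitBound sys R D (D + t₀) K P γ₁ γ₂ * M ^ 2)
        + constC6 sys R α D K P β γ₁ γ₂ * (Real.exp (δ * D) * Φ) ^ 2
          / (2 * (constKappa sys R α D K P β γ₂ - δ)) ≤ q ^ 2 := by
      have s1 := Real.sq_sqrt hv0
      have s2 := Real.sq_sqrt (div_nonneg hC6 hκδ.le)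
      set a := √(lyapunovInitBound sys R D (D + t₀) K P γ₁ γ₂)
      set b := √(constC6 sys R α D K P β γ₁ γ₂ / (2 * (constKappa sys R α D K P β γ₂ - δ)))
      have s3 : constC6 sys R α D K P β γ₁ γ₂ * (Real.exp (δ * D) * Φ) ^ 2
          / (2 * (constKappa sys R α D K P β γ₂ - δ)) = (b * Real.exp (δ * D) * Φ) ^ 2 := by
        rw [mul_assoc, mul_pow b, s2]; ring
      have s4 : Real.exp (2 * δ * (D + t₀))
          * (lyapunovInitBound sys R D (D + t₀) K P γ₁ γ₂ * M ^ 2)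
          = (Real.exp (δ * (D + t₀)) * a * M) ^ 2 := by
        rw [hexp, ← s1]; ring
      rw [s3, s4, hq]
      have p1 : 0 ≤ Real.exp (δ * (D + t₀)) * a * M := by positivity
      have p2 : 0 ≤ b * Real.exp (δ * D) * Φ := by positivity
      nlinarith [mul_nonneg p1 p2]
    have e4 : Real.exp (2 * δ * t) * lyapunov sys R D K P γ₁ γ₂ X Z N t ≤ q ^ 2 := by linarith
    rw [hexp] at e4
    rw [Real.exp_neg, mul_pow, inv_pow, ← div_eq_inv_mul, le_div_iff₀' (by positivity)]
    exact e4
  have hcancel : Real.exp (δ * t) * Real.exp (-(δ * t)) = 1 := by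
    rw [← Real.exp_add]; simp
  have hsq0 : 0 ≤ Real.exp (-(δ * t)) * q := by positivity
  constructor
  · have e1 := hT.norm_le_of_lyapunov_le hL ht hV
    rw [Real.sqrt_sq hsq0] at e1
    calc _ ≤ Real.exp (δ * t) * (constC4 sys R K P γ₂ * (Real.exp (-(δ * t)) * q)) := by gcongr
      _ = constC4 sys R K P γ₂ * q * (Real.exp (δ * t) * Real.exp (-(δ * t))) := by ring
      _ = _ := by rw [hcancel, mul_one]
  -- The control is `K Z`, so the `γ₁` term alone bounds it and no modes are needed.
  · have e1 := (hL.norm_sq_le_lyapunov (X := X) (Z := Z) 0 t).trans (hV 0)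
    have e2 : ‖Z t‖ ≤ Real.exp (-(δ * t)) * q / √(γ₁ * lamMin P) := by
      rw [le_div_iff₀ (Real.sqrt_pos.2 hγ)]
      refine abs_le_of_sq_le_sq' ?_ hsq0 |>.2
      rw [mul_pow, Real.sq_sqrt hγ.le]
      linarith
    have ht' : 0 ≤ t := by linarith
    have e3 : u t = matCLM K (Z t) := by
      rw [h.u_eq_predictor ht', hφ.eq_one t (by linarith), one_smul, hZdef]
      simp only [max_eq_left ht']
    have hK0 : 0 ≤ matNorm K := norm_nonneg _
    calc _ ≤ Real.exp (δ * t) * (matNorm K * (Real.exp (-(δ * t)) * q / √(γ₁ * lamMin P))) := by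
          rw [e3]
          gcongr
          exact (norm_matCLM_le K (Z t)).trans (by gcongr)
      _ = matNorm K / √(γ₁ * lamMin P) * q * (Real.exp (δ * t) * Real.exp (-(δ * t))) := by ring
      _ = _ := by rw [hcancel, mul_one]

end ClosedLoop

/-! ### Closing the loop -/

theorem theorem2 {𝕜 : Type*} [RCLike 𝕜] {H : Type*} [NormedAddCommGroup H]
    [InnerProductSpace 𝕜 H] [NormedSpace ℝ H] [IsScalarTower ℝ 𝕜 H] [CompleteSpace H]
    [TopologicalSpace.SeparableSpace H] {m n mv N₀ : ℕ}
    -- the boundary control system and its Riesz spectral structure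
    (sys : BoundaryControlSystem 𝕜 H m) (R : RieszSpectral sys.A0)
    -- finitely many modes are not uniformly exponentially stable
    (hN₀ : 1 ≤ N₀) {α : ℝ} (hα : 0 < α) (hstable : ∀ k, N₀ ≤ k → RCLike.re (R.lam k) ≤ -α)
    (hKalman : KalmanCondition (matA R N₀) (matB sys R N₀))
    -- delay, transition signal, feedback gain and Lyapunov matrix
    {D t₀ : ℝ} (hD : 0 < D) (ht₀ : 0 < t₀) {φ : ℝ → ℝ} (hφ : IsTransitionSignal D t₀ φ)
    (K : Matrix (Fin m) (Fin N₀) 𝕜) (hK : IsHurwitz (matAcl sys R D K))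
    (P : Matrix (Fin N₀) (Fin N₀) 𝕜) (hP : P.PosDef)
    (hLyap : (matAcl sys R D K)ᴴ * P + P * matAcl sys R D K = -1)
    -- the free parameters of the Lyapunov function
    {β γ₁ γ₂ : ℝ} (hβ : β ∈ Set.Ioo (0 : ℝ) 1) (hγ₁ : constC1 sys R D K / lamMin P < γ₁)
    (hγ₂ : max (normBK sys K ^ 2 / (R.mR * lamMin P)) (constC5 sys R α D K / (1 - β)) < γ₂)
    -- the coupling with the ODE
    (f₁ : Euc 𝕜 n × H × Euc 𝕜 mv → Euc 𝕜 n) (f₂ : Euc 𝕜 n × H × Euc 𝕜 mv → H)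
    (hf₁ : ContDiff ℝ 1 f₁) (hf₂ : ContDiff ℝ 1 f₂) {D₁ D₂ D₃ κt Ct₀ Ct₁ Ct₂ : ℝ}
    (hf : CouplingAssumption f₁ f₂ D₁ D₂ D₃ κt Ct₀ Ct₁ Ct₂)
    -- the small gain condition
    (hgain : (D₁ * Ct₁ + D₂) * constC4 sys R K P γ₂ *
      √(constC6 sys R α D K P β γ₁ γ₂ / (2 * constKappa sys R α D K P β γ₂)) < 1) :
    ∃ δ ∈ Set.Ioo (0 : ℝ) (constKappa sys R α D K P β γ₂), ∃ Gc Hc : Fin 4 → ℝ,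
      (∀ i, 0 ≤ Gc i) ∧ (∀ i, 0 ≤ Hc i) ∧
      ∀ (x₀ : Euc 𝕜 n), ∀ X₀ ∈ sys.A0.domain, ∀ v : ℝ → Euc 𝕜 mv,
        ContDiffOn ℝ 1 v (Set.Ici 0) →
        ∀ (x : ℝ → Euc 𝕜 n) (X : ℝ → H) (u : ℝ → Euc 𝕜 m),
          IsClassicalSolution sys R D φ K f₁ f₂ x₀ X₀ v x X u →
          ∀ t, D + t₀ ≤ t →
            ‖x t‖ + ‖X t‖ ≤ Gc 0 * Real.exp (-δ * t) * (‖x₀‖ + ‖X₀‖)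
                + Gc 1 * Real.exp (-δ * t) * supOn (fun τ => ‖x τ‖) 0 (D + t₀)
                + Gc 2 * Real.exp (-δ * t) * supOn (fun τ => ‖X τ‖) 0 (D + t₀)
                + Gc 3 * supOn (fun τ => Real.exp (-δ * (t - τ)) * ‖v τ‖) 0 t ∧
            ‖u t‖ ≤ Hc 0 * Real.exp (-δ * t) * (‖x₀‖ + ‖X₀‖)
                + Hc 1 * Real.exp (-δ * t) * supOn (fun τ => ‖x τ‖) 0 (D + t₀)
                + Hc 2 * Real.exp (-δ * t) * supOn (fun τ => ‖X τ‖) 0 (D + t₀)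
                + Hc 3 * supOn (fun τ => Real.exp (-δ * (t - τ)) * ‖v τ‖) 0 t := by
  have hL : LyapunovData sys R α D K P β γ₁ γ₂ :=
    ⟨hD, hN₀, hα, hstable, hP, hLyap, hβ, hγ₁, hγ₂⟩
  have hC4 := hL.constC4_pos
  have hκ := hL.constKappa_pos
  have hC1 := hf.Ct₁_nonneg
  have hC0 := hf.Ct₀_nonneg
  have hC2 := hf.Ct₂_nonneg
  have hD1 := hf.D₁_nonneg
  have hD2 := hf.D₂_nonneg
  have hD3 := hf.D₃_nonneg
  obtain ⟨δ, hδ, Tr, hTr, hη, hg⟩ := exists_decay_rate (C₀ := Ct₀) (D := D) hf.κt_pos hκ hgain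
  set ρ := √(Real.exp (2 * δ * Tr)
    / (1 - Ct₀ ^ 2 * Real.exp (-2 * κt * Tr) * Real.exp (2 * δ * Tr)))
  set C₄ := constC4 sys R K P γ₂
  set b := √(constC6 sys R α D K P β γ₁ γ₂ / (2 * (constKappa sys R α D K P β γ₂ - δ)))
    * Real.exp (δ * D)
  set a := Real.exp (δ * (D + t₀)) * √(lyapunovInitBound sys R D (D + t₀) K P γ₁ γ₂)
  set g := C₄ * b * (D₁ * (ρ * Ct₁) + D₂)
  set c := matNorm K / √(γ₁ * lamMin P)
  have hρ0 : 0 ≤ ρ := Real.sqrt_nonneg _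
  have hb0 : 0 ≤ b := by positivity
  have ha0 : 0 ≤ a := by positivity
  have hc0 : 0 ≤ c := div_nonneg (norm_nonneg _) (Real.sqrt_nonneg _)
  have h1g : 0 < 1 - g := sub_pos.2 hg
  -- gains of the weighted supremum of `X` from `x₀`, from the past of `X` and from `v`
  set k₀ := C₄ * b * (D₁ * (ρ * Ct₀)) / (1 - g) with hk₀
  set k₂ := (Real.exp (δ * (D + t₀)) + C₄ * a) / (1 - g) with hk₂
  set k₃ := C₄ * b * (D₁ * (ρ * Ct₂) + D₃) / (1 - g) with hk₃
  have hk₀0 : 0 ≤ k₀ := by positivity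
  have hk₂0 : 0 ≤ k₂ := by positivity
  have hk₃0 : 0 ≤ k₃ := by positivity
  -- The weighted ISS estimate starts from `x₀` at time 0, so the supremum of `‖x‖` over the
  -- transition period enters with coefficient 0.
  refine ⟨δ, hδ, ![ρ * Ct₀ + (ρ * Ct₁ + 1) * k₀, 0, (ρ * Ct₁ + 1) * k₂,
      ρ * Ct₂ + (ρ * Ct₁ + 1) * k₃],
    ![c * (b * (D₁ * (ρ * Ct₀) + (D₁ * (ρ * Ct₁) + D₂) * k₀)), 0,
      c * (a + b * ((D₁ * (ρ * Ct₁) + D₂) * k₂)),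
      c * (b * (D₁ * (ρ * Ct₂) + D₃ + (D₁ * (ρ * Ct₁) + D₂) * k₃))], ?_, ?_, ?_⟩
  · intro i
    fin_cases i <;> simp <;> positivity
  · intro i
    fin_cases i <;> simp <;> positivity
  intro x₀ X₀ _ v hv x X u h t ht
  have ht0 : 0 ≤ t := by linarith
  have hXc : ContinuousOn X (Set.Ici 0) := h.X_contDiff.continuousOn
  have hvc : ContinuousOn v (Set.Ici 0) := hv.continuousOn
  set M := supOn (fun τ => ‖X τ‖) 0 (D + t₀)
  set w := supOn (fun τ => Real.exp (-δ * (t - τ)) * ‖v τ‖) 0 t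
  have hM : ∀ τ ∈ Set.Icc 0 (D + t₀), ‖X τ‖ ≤ M := fun τ hτ =>
    le_supOn (g := fun τ => ‖X τ‖) (hXc.mono fun s hs => Set.mem_Ici.2 hs.1).norm hτ
  have hM0 : 0 ≤ M := (norm_nonneg _).trans (hM 0 ⟨le_rfl, by linarith⟩)
  have hexpc : Continuous fun τ : ℝ => Real.exp (-δ * (t - τ)) := by fun_prop
  have hw : ∀ τ ∈ Set.Icc 0 t, Real.exp (-δ * (t - τ)) * ‖v τ‖ ≤ w := fun τ hτ =>
    le_supOn (g := fun τ => Real.exp (-δ * (t - τ)) * ‖v τ‖)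
      (hexpc.continuousOn.mul (hvc.mono fun s hs => Set.mem_Ici.2 hs.1).norm) hτ
  have hw0 : 0 ≤ w := le_trans (by positivity) (hw 0 ⟨le_rfl, ht0⟩)
  -- Multiplying by `e^{δt}` turns the fading supremum of `v` into a bound for the weight `e^{δτ}`;
  -- `hνw` undoes this at the end.
  set ν := Real.exp (δ * t) * w with hν
  have hν0 : 0 ≤ ν := by positivity
  have hνv : ∀ τ ∈ Set.Icc 0 t, Real.exp (δ * τ) * ‖v τ‖ ≤ ν := fun τ hτ => by
    have e1 := mul_le_mul_of_nonneg_left (hw τ hτ) (Real.exp_pos (δ * t)).le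
    rw [← mul_assoc, ← Real.exp_add] at e1
    refine le_trans (le_of_eq ?_) e1
    congr 2
    ring
  have hexpX : ContinuousOn (fun τ => Real.exp (δ * τ) * ‖X τ‖) (Set.Icc 0 t) :=
    (by fun_prop : Continuous fun τ : ℝ => Real.exp (δ * τ)).continuousOn.mul
      (hXc.mono fun s hs => Set.mem_Ici.2 hs.1).norm
  -- Finite because `[0, t]` is compact, so it can be absorbed below; none of the constants depends
  -- on `t`.
  set ξ := supOn (fun τ => Real.exp (δ * τ) * ‖X τ‖) 0 t with hξdef
  have hξ : ∀ τ ∈ Set.Icc 0 t, Real.exp (δ * τ) * ‖X τ‖ ≤ ξ := fun τ hτ => le_supOn hexpX hτ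
  have hξ0 : 0 ≤ ξ := le_trans (by positivity) (hξ 0 ⟨le_rfl, ht0⟩)
  have hx := hf.exp_mul_norm_le hXc hvc h.x_deriv hδ.1.le hTr ht0 hη hξ hνv
  rw [h.x_init] at hx
  set ζ := ρ * (Ct₀ * ‖x₀‖ + Ct₁ * ξ + Ct₂ * ν) with hζ
  have hF : ∀ τ ∈ Set.Icc 0 t, Real.exp (δ * τ) * ‖f₂ (x τ, X τ, v τ)‖
      ≤ D₁ * ζ + D₂ * ξ + D₃ * ν := fun τ hτ => by
    have e1 := mul_le_mul_of_nonneg_left (hf.bound (x τ) (X τ) (v τ)) (Real.exp_pos (δ * τ)).le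
    have e2 := mul_le_mul_of_nonneg_left (hx τ hτ) hD1
    have e3 := mul_le_mul_of_nonneg_left (hξ τ hτ) hD2
    have e4 := mul_le_mul_of_nonneg_left (hνv τ hτ) hD3
    linarith
  set Φ := D₁ * ζ + D₂ * ξ + D₃ * ν with hΦ
  have hζ0 : 0 ≤ ζ := by positivity
  have hΦ0 : 0 ≤ Φ := by positivity
  have hXu : ∀ τ, D + t₀ ≤ τ → τ ≤ t → Real.exp (δ * τ) * ‖X τ‖ ≤ C₄ * (a * M + b * Φ) ∧
      Real.exp (δ * τ) * ‖u τ‖ ≤ c * (a * M + b * Φ) := fun τ h1 h2 =>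
    h.exp_mul_norm_le hL ht₀ hφ hδ.1.le hδ.2 h1 hM0 hM
      fun s hs => hF s ⟨ht₀.le.trans hs.1, hs.2.trans h2⟩
  have hξle : ξ ≤ Real.exp (δ * (D + t₀)) * M + C₄ * (a * M + b * Φ) := by
    refine supOn_le ht0 fun τ hτ => ?_
    rcases le_total τ (D + t₀) with hle | hle
    · have e1 : Real.exp (δ * τ) * ‖X τ‖ ≤ Real.exp (δ * (D + t₀)) * M := by
        have := hδ.1.le
        gcongr
        exact hM τ ⟨hτ.1, hle⟩
      have e2 : 0 ≤ C₄ * (a * M + b * Φ) := by positivity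
      linarith
    · have e2 : 0 ≤ Real.exp (δ * (D + t₀)) * M := by positivity
      linarith [(hXu τ hle hτ.2).1]
  -- The small gain step: `Φ` contains `ξ` itself, with total loop gain `g < 1`, and this share is
  -- moved to the left side.
  have hξk : ξ ≤ k₀ * ‖x₀‖ + k₂ * M + k₃ * ν := by
    have e1 : (1 - g) * ξ ≤ C₄ * b * (D₁ * (ρ * Ct₀)) * ‖x₀‖
        + (Real.exp (δ * (D + t₀)) + C₄ * a) * M + C₄ * b * (D₁ * (ρ * Ct₂) + D₃) * ν := by
      have e2 : g * ξ = C₄ * b * (D₁ * (ρ * Ct₁) + D₂) * ξ := rfl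
      rw [sub_mul, one_mul, e2]
      rw [hΦ, hζ] at hξle
      linarith
    have e3 : k₀ * ‖x₀‖ + k₂ * M + k₃ * ν = (C₄ * b * (D₁ * (ρ * Ct₀)) * ‖x₀‖
        + (Real.exp (δ * (D + t₀)) + C₄ * a) * M + C₄ * b * (D₁ * (ρ * Ct₂) + D₃) * ν) / (1 - g) := by
      rw [hk₀, hk₂, hk₃]; ring
    rw [e3, le_div_iff₀ h1g]
    linarith
  have hsum : ‖x₀‖ ≤ ‖x₀‖ + ‖X₀‖ := by linarith [norm_nonneg X₀]
  have hcancel : Real.exp (-δ * t) * Real.exp (δ * t) = 1 := by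
    rw [← Real.exp_add]; simp
  have hdiv : ∀ y z : ℝ, Real.exp (δ * t) * y ≤ z → y ≤ Real.exp (-δ * t) * z := fun y z hyz => by
    have := mul_le_mul_of_nonneg_left hyz (Real.exp_pos (-δ * t)).le
    rwa [← mul_assoc, hcancel, one_mul] at this
  have hνw : Real.exp (-δ * t) * ν = w := by rw [hν, ← mul_assoc, hcancel, one_mul]
  have htt : t ∈ Set.Icc 0 t := ⟨ht0, le_rfl⟩
  constructor
  · have e1 : ‖x t‖ + ‖X t‖ ≤ Real.exp (-δ * t) * (ζ + ξ) :=
      hdiv _ _ (by rw [mul_add]; exact add_le_add (hx t htt) (hξ t htt))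
    have e2 : ζ + ξ ≤ (ρ * Ct₀ + (ρ * Ct₁ + 1) * k₀) * (‖x₀‖ + ‖X₀‖) + (ρ * Ct₁ + 1) * k₂ * M
        + (ρ * Ct₂ + (ρ * Ct₁ + 1) * k₃) * ν := by
      have e3 := mul_le_mul_of_nonneg_left hξk (by positivity : 0 ≤ ρ * Ct₁ + 1)
      have e4 := mul_le_mul_of_nonneg_left hsum
        (by positivity : 0 ≤ ρ * Ct₀ + (ρ * Ct₁ + 1) * k₀)
      rw [hζ]
      linarith
    refine e1.trans ((mul_le_mul_of_nonneg_left e2 (Real.exp_pos _).le).trans (le_of_eq ?_))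
    simp only [Matrix.cons_val]
    rw [← hνw]
    ring
  · have e1 := hdiv _ _ (hXu t ht le_rfl).2
    have e2 : c * (a * M + b * Φ)
        ≤ c * (b * (D₁ * (ρ * Ct₀) + (D₁ * (ρ * Ct₁) + D₂) * k₀)) * (‖x₀‖ + ‖X₀‖)
          + c * (a + b * ((D₁ * (ρ * Ct₁) + D₂) * k₂)) * M
          + c * (b * (D₁ * (ρ * Ct₂) + D₃ + (D₁ * (ρ * Ct₁) + D₂) * k₃)) * ν := by
      have e3 := mul_le_mul_of_nonneg_left hξk
        (by positivity : 0 ≤ c * (b * (D₁ * (ρ * Ct₁) + D₂)))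
      have e4 := mul_le_mul_of_nonneg_left hsum
        (by positivity : 0 ≤ c * (b * (D₁ * (ρ * Ct₀) + (D₁ * (ρ * Ct₁) + D₂) * k₀)))
      rw [hΦ, hζ]
      linarith
    refine e1.trans ((mul_le_mul_of_nonneg_left e2 (Real.exp_pos _).le).trans (le_of_eq ?_))
    simp only [Matrix.cons_val]
    rw [← hνw]
    ring
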